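/- Let $d\ge 1$, $\alpha\in(0,2)$, $\gamma\in[1,d]$, and let $S$ be the unit sphere of $\mathbb R^d$. Let $\mu$ be a finite Borel measure on $S$ which is nondegenerate (its support is not contained in any proper linear subspace of $\mathbb R^d$) and a $(\gamma-1)$-measure: there is $K$ with $\mu(S\cap B(\theta,\rho))\le K\rho^{\gamma-1}$ for all $\theta\in S$, $\rho>0$. Let $c,C>0$. Then there are constants $c_1,\dots,c_6>0$, depending only on $d,\alpha,\gamma,\mu,c,C$, such that the following holds. Let $Q:S\times(0,\infty)\to(0,\infty)$ be a Borel function with $C^{-1}e^{-cs}\le Q(\theta,s)\le Ce^{-cs}$ for all $\theta\in S$, $s>0$ (for instance such a $Q$ with $Q(\theta,\cdot)$ completely monotone, the tempered stable case), let $$\nu(A)=\int_S\int_0^\infty \mathbf 1_A(s\theta)\,s^{-1-\alpha}Q(\theta,s)\,ds\,\mu(d\theta),$$ let $b\in\mathbb R^d$, and let $\{P_t\}_{t\ge0}$ be the convolution semigroup of probability measures on $\mathbb R^d$ with $\int e^{i\langle\xi,y\rangle}P_t(dy)=e^{-t\Phi(\xi)}$, where $$\Phi(\xi)=-\int\bigl(e^{i\langle\xi,y\rangle}-1-i\langle\xi,y\rangle\mathbf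 1_{B(0,1)}(y)\bigr)\,\nu(dy)-i\langle\xi,b\rangle .$$ Put $b_r=b-\int_{r<|y|<1}y\,\nu(dy)$ for $0<r\le1$ and $b_r=b+\int_{1<|y|<r}y\,\nu(dy)$ for $r>1$. Then for every $t>0$ the measure $P_t$ has a continuous density $p_t$ with respect to Lebesgue measure, and $$p_t(x+tb_{t^{1/\alpha}})\le c_1t^{-d/\alpha}\min\{1,\;t^{1+\gamma/\alpha}|x|^{-\gamma-\alpha}e^{-c_2|x|}\}\qquad (0<t\le1,\ x\in\mathbb R^d),$$ $$p_t(x+tb_{\sqrt t})\le c_3t^{-d/2}\Bigl(\min\{1,\;t^{1+\gamma/2}|x|^{-\gamma-\alpha}e^{-c_4|x|}\}+\exp\Bigl(-\frac{c_5|x|}{\sqrt t}\log\Bigl(1+\frac{c_6|x|}{\sqrt t}\Bigr)\Bigr)\Bigr)\qquad (t>1,\ x\in\mathbb R^d),$$ where the minima are read as $1$ at $x=0$. -/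

import Mathlib

open MeasureTheory

noncomputable section

/-- A measure on `ℝ^d` is nondegenerate if its support is not contained in any proper linear
subspace. -/
def IsNondegenerate {d : ℕ} (lam : Measure (EuclideanSpace ℝ (Fin d))) : Prop :=
  ∀ M : Submodule ℝ (EuclideanSpace ℝ (Fin d)), M ≠ ⊤ →
    ¬ lam.support ⊆ (M : Set (EuclideanSpace ℝ (Fin d)))

/-- `μ` is a `κ`-measure on the unit sphere: `μ (S ∩ B(θ, ρ)) ≤ K ρ ^ κ` for all `θ ∈ S`, `ρ > 0`
(balls of the subtype are intersections of the sphere with Euclidean balls). -/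
def IsKappaMeasure {d : ℕ}
    (μ : Measure (Metric.sphere (0 : EuclideanSpace ℝ (Fin d)) 1)) (κ : ℝ) : Prop :=
  ∃ K : ℝ, ∀ (θ : Metric.sphere (0 : EuclideanSpace ℝ (Fin d)) 1) (ρ : ℝ), 0 < ρ →
    μ (Metric.ball θ ρ) ≤ ENNReal.ofReal (K * ρ ^ κ)

/-- The measure `ν(A) = ∫_S ∫_0^∞ 1_A(s θ) s^(-1-α) Q(θ, s) ds μ(dθ)`: the image of the measure
`s^(-1-α) Q(θ, s) ds μ(dθ)` on `S × (0, ∞)` under `(θ, s) ↦ s θ`. -/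
def temperedLevyMeasure {d : ℕ} (α : ℝ)
    (μ : Measure (Metric.sphere (0 : EuclideanSpace ℝ (Fin d)) 1))
    (Q : Metric.sphere (0 : EuclideanSpace ℝ (Fin d)) 1 → ℝ → ℝ) :
    Measure (EuclideanSpace ℝ (Fin d)) :=
  ((μ.prod (volume.restrict (Set.Ioi (0 : ℝ)))).withDensity
      (fun p => ENNReal.ofReal (p.2 ^ (-1 - α) * Q p.1 p.2))).map
    (fun p => p.2 • (p.1 : EuclideanSpace ℝ (Fin d)))

/-- The characteristic exponent
`Φ(ξ) = -∫ (e^{i⟨ξ,y⟩} - 1 - i⟨ξ,y⟩ 1_{B(0,1)}(y)) ν(dy) - i⟨ξ,b⟩`. -/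
def charExponent {d : ℕ} (ν : Measure (EuclideanSpace ℝ (Fin d)))
    (b ξ : EuclideanSpace ℝ (Fin d)) : ℂ :=
  -(∫ y, (Complex.exp (Complex.I * ((inner ℝ ξ y : ℝ) : ℂ)) - 1
      - (Metric.ball (0 : EuclideanSpace ℝ (Fin d)) 1).indicator
          (fun y => Complex.I * ((inner ℝ ξ y : ℝ) : ℂ)) y) ∂ν)
    - Complex.I * ((inner ℝ ξ b : ℝ) : ℂ)

/-- `P` (only `P t` with `t ≥ 0` matters) is the convolution semigroup of probability measures
with `∫ e^{i⟨ξ,y⟩} P_t(dy) = e^{-t Φ(ξ)}`. -/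
structure IsConvolutionSemigroup {d : ℕ} (Φ : EuclideanSpace ℝ (Fin d) → ℂ)
    (P : ℝ → Measure (EuclideanSpace ℝ (Fin d))) : Prop where
  isProbabilityMeasure : ∀ t : ℝ, 0 ≤ t → IsProbabilityMeasure (P t)
  conv_eq : ∀ s t : ℝ, 0 ≤ s → 0 ≤ t → (P s).conv (P t) = P (s + t)
  charFun_eq : ∀ t : ℝ, 0 ≤ t → ∀ ξ, charFun (P t) ξ = Complex.exp (-(t : ℂ) * Φ ξ)

/-- The drift `b_r = b - ∫_{r<|y|<1} y ν(dy)` if `r ≤ 1`, and `b_r = b + ∫_{1<|y|<r} y ν(dy)`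
if `r > 1`. -/
def shiftedDrift {d : ℕ} (ν : Measure (EuclideanSpace ℝ (Fin d)))
    (b : EuclideanSpace ℝ (Fin d)) (r : ℝ) : EuclideanSpace ℝ (Fin d) :=
  if r ≤ 1 then b - ∫ y in {y | r < ‖y‖ ∧ ‖y‖ < 1}, y ∂ν
  else b + ∫ y in {y | 1 < ‖y‖ ∧ ‖y‖ < r}, y ∂ν

/-- `min {1, τ ρ^(-γ-α) e^(-c ρ)}` for `ρ ≥ 0` and `τ > 0`. At `ρ = 0` the second entry is `+∞`,
so that the minimum is `1`; this case is separated because `0 ^ (-γ-α) = 0` for real powers. -/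
def tailBound (γ α c τ ρ : ℝ) : ℝ :=
  if ρ = 0 then 1 else min 1 (τ * ρ ^ (-γ - α) * Real.exp (-c * ρ))

end

/-! The jumps are cut at size `h = t^(1/α)` for `t ≤ 1` and `h = √t` for `t > 1`. After removal of
the drift `t b_h`, the law is that of the compensated jumps smaller than `h` convolved with a
compound Poisson law of the jumps of size at least `h`. At these scales the bounds on both parts are
uniform in `t` and `Q` (`exists_jumpBounds`). The small jumps have second moment at most `M h²`, and
the real part of their exponent is at most `-κ((h‖ξ‖)^α - 1)`. The large jumps `Λ` have a bounded
integral of `exp(c‖y‖/2)`, and their weighted mass in a ball of radius `ρ`, outside the ball of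
radius `R` about the origin, is at most of order `t ρ^γ R^(-γ-α)`. The power `γ` is `γ - 1` from the
spherical cap plus `1` from the radius.

Small jumps: since the jumps are bounded, the exponent extends to an entire function, and the
inversion integral may be moved to the contour `ξ + iβx`. A tilt of size `a` gains `exp(-a‖x‖/h)`,
costs `exp(M a² e^a)`, and weakens the frequency decay by `e^(-a)`, which after integration costs
only `exp(a d/α)`. The choice `a = ½ log(1 + u/(2M))`, `u = ‖x‖/h`, gives the Poisson-type profile
`smallJumpProfile` times `h^(-d)` (`exists_norm_smallJumpDensity_le`).

Large jumps: expanding the exponential of the transform of `Λ` gives terms in which the small jump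
density is averaged over `n` large jumps. To reach `x`, either the small part travels `‖x‖/2`, or
the large jumps have total length at least `‖x‖/2`. In the second case repeated halving locates one
big jump (`lintegral_big_jumpMeasure_le`). The halvings cost a factor geometric in `n`, which the
`1/n!` of the series absorbs (`exists_norm_inversionIntegral_le`).

For `t ≤ 1` the profile is itself dominated by the tempered power term; for `t > 1` it remains as
the second summand. -/

/-! ### Fourier inversion for probability measures with integrable characteristic function. -/

section CharFunInversion

open Filter Topology FourierTransform Real
open scoped RealInnerProductSpace ENNReal

variable {V : Type*} [NormedAddCommGroup V] [InnerProductSpace ℝ V] [FiniteDimensional ℝ V]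
  [MeasurableSpace V] [BorelSpace V]

/-- The centred Gaussian density whose Fourier transform is `exp (-δ ‖ζ‖ ^ 2)`. -/
noncomputable def gaussKernel (V : Type*) [NormedAddCommGroup V] [InnerProductSpace ℝ V]
    (δ : ℝ) (x : V) : ℝ :=
  (π / δ) ^ (Module.finrank ℝ V / 2 : ℝ) * rexp (-(π ^ 2 / δ) * ‖x‖ ^ 2)

lemma gaussKernel_nonneg {δ : ℝ} (hδ : 0 < δ) (x : V) : 0 ≤ gaussKernel V δ x := by
  unfold gaussKernel; positivity

lemma gaussKernel_le {δ : ℝ} (hδ : 0 < δ) (x : V) :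
    gaussKernel V δ x ≤ (π / δ) ^ (Module.finrank ℝ V / 2 : ℝ) := by
  unfold gaussKernel
  refine mul_le_of_le_one_right (by positivity) ?_
  rw [Real.exp_le_one_iff]
  have : 0 ≤ π ^ 2 / δ * ‖x‖ ^ 2 := by positivity
  linarith

lemma continuous_gaussKernel (δ : ℝ) : Continuous (gaussKernel V δ) := by
  unfold gaussKernel; fun_prop

lemma integral_gaussKernel {δ : ℝ} (hδ : 0 < δ) : ∫ x, gaussKernel V δ x = 1 := by
  unfold gaussKernel
  rw [integral_const_mul, GaussianFourier.integral_rexp_neg_mul_sq_norm (by positivity),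
    ← Real.mul_rpow (by positivity) (by positivity)]
  have : π / δ * (π / (π ^ 2 / δ)) = 1 := by field_simp
  rw [this, Real.one_rpow]

lemma integrable_gaussKernel {δ : ℝ} (hδ : 0 < δ) : Integrable (gaussKernel V δ) := by
  by_contra h
  have := integral_gaussKernel (V := V) hδ
  rw [integral_undef h] at this
  exact zero_ne_one this

lemma fourier_gauss_eq_gaussKernel {δ : ℝ} (hδ : 0 < δ) (x : V) :
    𝓕 (fun v : V ↦ Complex.exp (-(δ : ℂ) * ‖v‖ ^ 2)) x = gaussKernel V δ x := by
  rw [fourier_gaussian_innerProductSpace (by simpa)]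
  unfold gaussKernel
  push_cast
  rw [Complex.ofReal_cpow (by positivity)]
  push_cast
  congr 2
  field_simp

variable (P : Measure V) [IsProbabilityMeasure P]

lemma charFun_two_pi_smul (ζ : V) :
    charFun P ((2 * π) • ζ) = ∫ y, Complex.exp ((2 * π * ⟪y, ζ⟫ : ℝ) * Complex.I) ∂P := by
  simp [charFun_apply, inner_smul_right]

/-- The Gaussian factor makes the double integral over frequency and `P` absolutely convergent, so
Fubini applies without integrability of `charFun P`. The damped inversion integral is thereby an
average of a nonnegative kernel, which is where positivity of the density comes from. -/
lemma fourier_charFun_mul_gauss {δ : ℝ} (hδ : 0 < δ) (x : V) :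
    𝓕 (fun ζ : V ↦ charFun P ((2 * π) • ζ) * Complex.exp (-(δ : ℂ) * ‖ζ‖ ^ 2)) x
      = ((∫ y, gaussKernel V δ (x - y) ∂P : ℝ) : ℂ) := by
  have hg : Integrable (fun ζ : V ↦ Complex.exp (-(δ : ℂ) * ‖ζ‖ ^ 2)) := by
    simpa using GaussianFourier.integrable_cexp_neg_mul_sq_norm_add (V := V)
      (b := δ) (by simpa) 0 0
  have key : ∀ ζ : V, Complex.exp ((-2 * π * ⟪ζ, x⟫ : ℝ) * Complex.I) •
      (charFun P ((2 * π) • ζ) * Complex.exp (-(δ : ℂ) * ‖ζ‖ ^ 2))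
      = ∫ y, Complex.exp ((-2 * π * ⟪ζ, x - y⟫ : ℝ) * Complex.I) *
          Complex.exp (-(δ : ℂ) * ‖ζ‖ ^ 2) ∂P := by
    intro ζ
    rw [charFun_two_pi_smul, integral_mul_const, smul_eq_mul, ← mul_assoc, ← integral_const_mul]
    congr 2
    ext y
    rw [← Complex.exp_add, inner_sub_right, real_inner_comm y ζ]
    congr 1
    push_cast
    ring
  rw [Real.fourier_eq']
  simp_rw [key]
  rw [integral_integral_swap]
  · rw [← integral_complex_ofReal]
    congr 1
    ext y
    rw [← fourier_gauss_eq_gaussKernel hδ, Real.fourier_eq']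
    simp
  · have h2 : Integrable (fun p : V × V ↦ Complex.exp (-(δ : ℂ) * ‖p.1‖ ^ 2))
        ((volume : Measure V).prod P) := hg.comp_fst P
    refine h2.mono (Continuous.aestronglyMeasurable ?_) (Eventually.of_forall fun p ↦ ?_)
    · unfold Function.uncurry; fun_prop
    · simp only [Function.uncurry, norm_mul]
      rw [Complex.norm_exp_ofReal_mul_I, one_mul]

lemma lintegral_gauss_conv {δ : ℝ} (hδ : 0 < δ) :
    ∫⁻ x, ENNReal.ofReal (∫ y, gaussKernel V δ (x - y) ∂P) = 1 := by
  have hm : Measurable (Function.uncurry fun x y : V ↦ ENNReal.ofReal (gaussKernel V δ (x - y))) :=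
    ENNReal.measurable_ofReal.comp
      ((continuous_gaussKernel δ).comp (continuous_fst.sub continuous_snd)).measurable
  have h1 : ∀ x, ENNReal.ofReal (∫ y, gaussKernel V δ (x - y) ∂P)
      = ∫⁻ y, ENNReal.ofReal (gaussKernel V δ (x - y)) ∂P := by
    intro x
    rw [ofReal_integral_eq_lintegral_ofReal]
    · refine Integrable.of_bound (C := (π / δ) ^ (Module.finrank ℝ V / 2 : ℝ)) ?_ ?_
      · exact ((continuous_gaussKernel δ).comp (continuous_const.sub continuous_id)).aestronglyMeasurable
      · refine Eventually.of_forall fun y ↦ ?_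
        rw [Real.norm_of_nonneg (gaussKernel_nonneg hδ _)]
        exact gaussKernel_le hδ _
    · exact Eventually.of_forall fun y ↦ gaussKernel_nonneg hδ _
  simp_rw [h1]
  rw [lintegral_lintegral_swap hm.aemeasurable]
  have h2 : ∀ y : V, ∫⁻ x, ENNReal.ofReal (gaussKernel V δ (x - y)) = 1 := by
    intro y
    rw [lintegral_sub_right_eq_self (fun x ↦ ENNReal.ofReal (gaussKernel V δ x)) y,
      ← ofReal_integral_eq_lintegral_ofReal (integrable_gaussKernel hδ)
      (Eventually.of_forall fun y ↦ gaussKernel_nonneg hδ _), integral_gaussKernel hδ]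
    simp
  simp [h2]

lemma continuous_charFun_two_pi_smul : Continuous fun ζ : V ↦ charFun P ((2 * π) • ζ) := by
  have : Continuous (charFun P) := continuous_charFun
  fun_prop

lemma tendsto_gauss_conv (hφ : Integrable fun ζ : V ↦ charFun P ((2 * π) • ζ)) (x : V) :
    Tendsto (fun n : ℕ ↦ ((∫ y, gaussKernel V (1 / ((n : ℝ) + 1)) (x - y) ∂P : ℝ) : ℂ)) atTop
      (𝓝 (𝓕 (fun ζ : V ↦ charFun P ((2 * π) • ζ)) x)) := by
  have h0 : ∀ n : ℕ, (0 : ℝ) < 1 / ((n : ℝ) + 1) := fun n ↦ by positivity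
  simp_rw [← fun n : ℕ ↦ fourier_charFun_mul_gauss P (h0 n) x, Real.fourier_eq']
  refine tendsto_integral_of_dominated_convergence
    (fun ζ ↦ ‖charFun P ((2 * π) • ζ)‖) ?_ hφ.norm ?_ ?_
  · intro n
    have := continuous_charFun_two_pi_smul P
    exact Continuous.aestronglyMeasurable (by fun_prop)
  · intro n
    refine Eventually.of_forall fun ζ ↦ ?_
    rw [norm_smul, Complex.norm_exp_ofReal_mul_I, one_mul, norm_mul]
    refine mul_le_of_le_one_right (norm_nonneg _) ?_
    rw [Complex.norm_exp, Real.exp_le_one_iff]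
    have h1 := h0 n
    have : (-((1 / ((n : ℝ) + 1) : ℝ) : ℂ) * (‖ζ‖ : ℂ) ^ 2).re
      = -(1 / ((n : ℝ) + 1) * ‖ζ‖ ^ 2) := by norm_cast; simp
    rw [this]
    have : 0 ≤ 1 / ((n : ℝ) + 1) * ‖ζ‖ ^ 2 := by positivity
    linarith
  · refine Eventually.of_forall fun ζ ↦ ?_
    have h1 : Tendsto (fun n : ℕ ↦ Complex.exp (-((1 / ((n : ℝ) + 1) : ℝ) : ℂ) * (‖ζ‖ : ℂ) ^ 2))
        atTop (𝓝 1) := by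
      have h2 : Tendsto (fun n : ℕ ↦ ((1 / ((n : ℝ) + 1) : ℝ) : ℂ)) atTop (𝓝 ((0 : ℝ) : ℂ)) :=
        (Complex.continuous_ofReal.tendsto _).comp tendsto_one_div_add_atTop_nhds_zero_nat
      have h3 := ((h2.neg.mul_const ((‖ζ‖ : ℂ) ^ 2)).cexp)
      simpa using h3
    simpa using ((h1.const_mul (charFun P ((2 * π) • ζ))).const_smul
      (Complex.exp ((-2 * π * ⟪ζ, x⟫ : ℝ) * Complex.I)))

/-- A probability measure with integrable characteristic function has a continuous density, given
by Fourier inversion. -/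
theorem density_of_integrable_charFun (hφ : Integrable (charFun P)) :
    ∃ q : V → ℝ, Continuous q ∧ (∀ x, 0 ≤ q x) ∧
      P = volume.withDensity (fun x ↦ ENNReal.ofReal (q x)) ∧
      ∀ x, (q x : ℂ) = (((2 * π) ^ Module.finrank ℝ V)⁻¹ : ℝ) •
        ∫ ξ, Complex.exp (-(⟪ξ, x⟫ : ℝ) * Complex.I) * charFun P ξ := by
  set f : V → ℂ := fun ζ ↦ charFun P ((2 * π) • ζ) with hf
  have hfint : Integrable f := hφ.comp_smul (by positivity : (2 * π : ℝ) ≠ 0)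
  have hfcont : Continuous f := continuous_charFun_two_pi_smul P
  set r : ℕ → V → ℝ := fun n x ↦ ∫ y, gaussKernel V (1 / ((n : ℝ) + 1)) (x - y) ∂P with hr
  have h0 : ∀ n : ℕ, (0 : ℝ) < 1 / ((n : ℝ) + 1) := fun n ↦ by positivity
  have hlim : ∀ x, Tendsto (fun n ↦ (r n x : ℂ)) atTop (𝓝 (𝓕 f x)) := tendsto_gauss_conv P hfint
  set q : V → ℝ := fun x ↦ (𝓕 f x).re with hq
  have hlimre : ∀ x, Tendsto (fun n ↦ r n x) atTop (𝓝 (q x)) := fun x ↦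
    (Complex.continuous_re.tendsto _).comp (hlim x)
  have hqf : ∀ x, (q x : ℂ) = 𝓕 f x := fun x ↦
    tendsto_nhds_unique ((Complex.continuous_ofReal.tendsto _).comp (hlimre x)) (hlim x)
  have hq0 : ∀ x, 0 ≤ q x := fun x ↦ ge_of_tendsto' (hlimre x) fun n ↦
    integral_nonneg fun y ↦ gaussKernel_nonneg (h0 n) _
  have hFc : Continuous (𝓕 f) :=
    VectorFourier.fourierIntegral_continuous Real.continuous_fourierChar continuous_inner hfint
  have hqc : Continuous q := Complex.continuous_re.comp hFc
  -- Fatou along the Gaussian regularizations, each of total mass one. This makes `𝓕 f` integrable,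
  -- as the inversion theorem for `f` requires; the full mass of `q` then follows from equality of
  -- characteristic functions.
  have hqle : ∫⁻ x, ENNReal.ofReal (q x) ≤ 1 := by
    have h1 : ∀ x, ENNReal.ofReal (q x) = liminf (fun n ↦ ENNReal.ofReal (r n x)) atTop :=
      fun x ↦ ((ENNReal.continuous_ofReal.tendsto _).comp (hlimre x)).liminf_eq.symm
    simp_rw [h1]
    refine (lintegral_liminf_le' fun n ↦ ?_).trans ?_
    · refine AEMeasurable.ennreal_ofReal ?_
      have : StronglyMeasurable (r n) := by
        refine StronglyMeasurable.integral_prod_right (f := fun x y : V ↦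
          gaussKernel V (1 / ((n : ℝ) + 1)) (x - y)) ?_
        exact ((continuous_gaussKernel _).comp
          (continuous_fst.sub continuous_snd)).stronglyMeasurable
      exact this.measurable.aemeasurable
    · simp only [hr, lintegral_gauss_conv P (h0 _), liminf_const, le_refl]
  have hqint : Integrable q := by
    refine ⟨hqc.aestronglyMeasurable, ?_⟩
    rw [hasFiniteIntegral_iff_ofReal (Eventually.of_forall hq0)]
    exact hqle.trans_lt ENNReal.one_lt_top
  have hFint : Integrable (𝓕 f) := by
    have : 𝓕 f = fun x ↦ (q x : ℂ) := by ext x; rw [hqf]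
    rw [this]; exact hqint.ofReal
  have hinv := hfcont.fourierInv_fourier_eq hfint hFint
  refine ⟨q, hqc, hq0, ?_, ?_⟩
  · have : IsFiniteMeasure (volume.withDensity (fun x ↦ ENNReal.ofReal (q x))) :=
      isFiniteMeasure_withDensity_ofReal hqint.2
    refine Measure.ext_of_charFun ?_
    ext ξ
    have h1 : charFun P ξ = f ((2 * π)⁻¹ • ξ) := by
      simp only [hf]; rw [smul_smul, mul_inv_cancel₀ (by positivity), one_smul]
    rw [h1, ← hinv, Real.fourierInv_eq', charFun_apply,
      integral_withDensity_eq_integral_toReal_smul (by fun_prop) (by simp)]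
    congr 1
    ext x
    rw [ENNReal.toReal_ofReal (hq0 x), ← hqf, Complex.real_smul, smul_eq_mul, mul_comm]
    congr 2
    rw [inner_smul_right]
    push_cast
    field_simp
  · intro x
    rw [hqf, Real.fourier_eq']
    have := Measure.integral_comp_smul (volume : Measure V)
      (fun ξ ↦ Complex.exp (-(⟪ξ, x⟫ : ℝ) * Complex.I) * charFun P ξ) (2 * π)
    rw [abs_of_pos (by positivity)] at this
    rw [← this]
    congr 1
    ext ζ
    simp only [hf, smul_eq_mul, inner_smul_left]
    congr 2
    push_cast
    simp

end CharFunInversion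

/-! ### Entire functions defined by integrals. -/

section ParametricHolomorphic

open Filter Topology

lemma tendsto_add_ofReal_one_div (z₀ : ℂ) :
    Tendsto (fun n : ℕ ↦ z₀ + (((1 / ((n : ℝ) + 1) : ℝ)) : ℂ)) atTop (𝓝[≠] z₀) := by
  refine tendsto_nhdsWithin_iff.2 ⟨?_, ?_⟩
  · have h2 : Tendsto (fun n : ℕ ↦ ((1 / ((n : ℝ) + 1) : ℝ) : ℂ)) atTop (𝓝 ((0 : ℝ) : ℂ)) :=
      (Complex.continuous_ofReal.tendsto _).comp tendsto_one_div_add_atTop_nhds_zero_nat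
    simpa using h2.const_add z₀
  · refine Eventually.of_forall fun n ↦ ?_
    have : (0 : ℝ) < 1 / ((n : ℝ) + 1) := by positivity
    have h3 : ((1 / ((n : ℝ) + 1) : ℝ) : ℂ) ≠ 0 := by exact_mod_cast this.ne'
    simpa using h3

/-- A locally dominated integral of entire functions is entire. -/
theorem differentiable_integral_of_entire {X : Type*} [MeasurableSpace X] {m : Measure X}
    {f : ℂ → X → ℂ} (hmeas : ∀ z, AEStronglyMeasurable (f z) m)
    (hd : ∀ x, Differentiable ℂ fun z ↦ f z x)
    (hb : ∀ R : ℝ, ∃ g : X → ℝ, Integrable g m ∧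
      ∀ᵐ x ∂m, ∀ z : ℂ, ‖z‖ ≤ R → ‖f z x‖ ≤ g x) :
    Differentiable ℂ fun z ↦ ∫ x, f z x ∂m := by
  intro z₀
  obtain ⟨g, hg, hgb⟩ := hb (‖z₀‖ + 2)
  -- Cauchy's estimate on the unit circle about `z`: that circle stays within radius `‖z₀‖ + 2`, so
  -- the majorant of the function also bounds the derivative.
  have hderiv : ∀ᵐ x ∂m, ∀ z ∈ Metric.ball z₀ 1, ‖deriv (fun w ↦ f w x) z‖ ≤ g x := by
    filter_upwards [hgb] with x hx z hz
    have h1 := Complex.norm_deriv_le_of_forall_mem_sphere_norm_le (c := z) (R := 1) (C := g x)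
      one_pos ((hd x).diffContOnCl) (fun w hw ↦ hx w ?_)
    · simpa using h1
    · have h2 : ‖w - z‖ = 1 := by simpa [dist_eq_norm] using hw
      have h3 : ‖z - z₀‖ < 1 := by simpa [dist_eq_norm] using hz
      calc ‖w‖ = ‖(w - z) + (z - z₀) + z₀‖ := by congr 1; ring
        _ ≤ ‖w - z‖ + ‖z - z₀‖ + ‖z₀‖ := norm_add₃_le
        _ ≤ ‖z₀‖ + 2 := by linarith
  -- Only measurability of `f z` is given; the derivative is measurable as a limit of difference
  -- quotients along `z₀ + 1/(n+1)`.
  have hmeas' : AEStronglyMeasurable (fun x ↦ deriv (fun w ↦ f w x) z₀) m := by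
    have hseq := tendsto_add_ofReal_one_div z₀
    refine aestronglyMeasurable_of_tendsto_ae (u := (atTop : Filter ℕ))
      (f := fun n x ↦ slope (fun w ↦ f w x) z₀ (z₀ + (((1 / ((n : ℝ) + 1) : ℝ)) : ℂ))) ?_ ?_
    · intro n
      simp only [slope, vsub_eq_sub]
      exact ((hmeas _).sub (hmeas _)).const_smul
        (z₀ + (((1 / ((n : ℝ) + 1) : ℝ)) : ℂ) - z₀)⁻¹
    · exact Eventually.of_forall fun x ↦ ((hd x z₀).hasDerivAt.tendsto_slope).comp hseq
  refine (hasDerivAt_integral_of_dominated_loc_of_deriv_le (F' := fun z x ↦ deriv (fun w ↦ f w x) z)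
    (Metric.ball_mem_nhds z₀ one_pos) (Eventually.of_forall hmeas) ?_ hmeas' hderiv hg
    (Eventually.of_forall fun x z _ ↦ (hd x z).hasDerivAt)).2.differentiableAt
  refine hg.mono' (hmeas z₀) ?_
  filter_upwards [hgb] with x hx using hx z₀ (by linarith)

/-- An entire function which is constant on the real line is constant. -/
theorem entire_eq_of_real_const {F : ℂ → ℂ} (hF : Differentiable ℂ F)
    (h : ∀ a : ℝ, F a = F 0) (z : ℂ) : F z = F 0 := by
  have h1 : AnalyticOnNhd ℂ F Set.univ := fun z _ ↦ hF.analyticAt z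
  have h2 : AnalyticOnNhd ℂ (fun _ : ℂ ↦ F 0) Set.univ := fun z _ ↦ analyticAt_const
  have hseq := tendsto_add_ofReal_one_div 0
  have h3 : ∃ᶠ w in 𝓝[≠] (0 : ℂ), F w = F 0 :=
    hseq.frequently (Frequently.of_forall fun n ↦ by simpa using h (1 / ((n : ℝ) + 1)))
  exact congrFun (h1.eq_of_frequently_eq h2 h3) z

end ParametricHolomorphic

/-! ### Integrals of stretched exponentials. -/

section RadialExp

variable {V : Type*} [NormedAddCommGroup V] [InnerProductSpace ℝ V] [FiniteDimensional ℝ V]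
  [MeasurableSpace V] [BorelSpace V]

open Real

lemma integrable_exp_neg_norm_rpow [Nontrivial V] {α : ℝ} (hα : 0 < α) :
    Integrable fun ξ : V ↦ rexp (-‖ξ‖ ^ α) := by
  refine (integrable_fun_norm_addHaar (volume : Measure V) (f := fun r ↦ rexp (-r ^ α))).2 ?_
  have := integrableOn_rpow_mul_exp_neg_rpow (p := α) (s := (Module.finrank ℝ V - 1 : ℕ))
    (by have : (0 : ℝ) ≤ (Module.finrank ℝ V - 1 : ℕ) := Nat.cast_nonneg _
        linarith) hα
  refine this.congr_fun (fun x hx ↦ ?_) measurableSet_Ioi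
  simp [rpow_natCast]

lemma exp_neg_mul_norm_rpow_eq {α h c : ℝ} (hα : 0 < α) (hh : 0 < h) (hc : 0 < c) (ξ : V) :
    rexp (-(c * (h * ‖ξ‖) ^ α)) = rexp (-‖(h * c ^ (1 / α)) • ξ‖ ^ α) := by
  have h1 : (c ^ (1 / α)) ^ α = c := by
    rw [← rpow_mul hc.le, one_div_mul_cancel hα.ne', rpow_one]
  rw [norm_smul, Real.norm_of_nonneg (by positivity), mul_right_comm,
    mul_rpow (x := h * ‖ξ‖) (by positivity) (by positivity), h1, mul_comm c]

lemma integrable_exp_neg_mul_norm_rpow [Nontrivial V] {α h c : ℝ} (hα : 0 < α) (hh : 0 < h)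
    (hc : 0 < c) : Integrable fun ξ : V ↦ rexp (-(c * (h * ‖ξ‖) ^ α)) := by
  simp_rw [exp_neg_mul_norm_rpow_eq hα hh hc]
  exact (integrable_exp_neg_norm_rpow hα).comp_smul (by positivity : h * c ^ (1 / α) ≠ 0)

/-- Scaling by `h c^(1/α)`. The explicit power `c^(-d/α)` matters: with `c = e^(-a) κ` it equals
`e^(a d/α) κ^(-d/α)`, so weakened decay costs only a term linear in `a` in the exponent. -/
lemma integral_exp_neg_mul_norm_rpow {α h c : ℝ} (hα : 0 < α) (hh : 0 < h) (hc : 0 < c) :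
    ∫ ξ : V, rexp (-(c * (h * ‖ξ‖) ^ α)) =
      (h ^ Module.finrank ℝ V)⁻¹ * c ^ (-(Module.finrank ℝ V : ℝ) / α) *
        ∫ ξ : V, rexp (-‖ξ‖ ^ α) := by
  simp_rw [exp_neg_mul_norm_rpow_eq hα hh hc]
  rw [Measure.integral_comp_smul (volume : Measure V) (fun ξ ↦ rexp (-‖ξ‖ ^ α)),
    abs_of_pos (by positivity), smul_eq_mul, mul_pow, mul_inv]
  congr 2
  rw [← rpow_natCast, ← rpow_mul hc.le, ← rpow_neg hc.le]
  congr 1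
  ring

end RadialExp

/-! ### The exponent of the small jumps at complex frequencies. -/

section SmallJumps

open Filter Topology Real
open scoped RealInnerProductSpace

/-- The compensated kernel `exp (i w) - 1 - i w`. -/
noncomputable def levyKernel (w : ℂ) : ℂ := Complex.exp (Complex.I * w) - 1 - Complex.I * w

lemma norm_levyKernel_le (w : ℂ) : ‖levyKernel w‖ ≤ ‖w‖ ^ 2 * rexp ‖w‖ := by
  have := Complex.norm_exp_sub_sum_le_norm_mul_exp (Complex.I * w) 2
  simpa [levyKernel, Finset.sum_range_succ, sub_sub] using this

lemma differentiable_levyKernel : Differentiable ℂ levyKernel := by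
  unfold levyKernel; fun_prop

lemma continuous_levyKernel : Continuous levyKernel := differentiable_levyKernel.continuous

/-- The complex estimate at `w = -i s`, where `i w = s`. -/
lemma exp_sub_one_sub_le (s : ℝ) : rexp s - 1 - s ≤ s ^ 2 * rexp |s| := by
  have h1 := norm_levyKernel_le (-Complex.I * s)
  have h2 : levyKernel (-Complex.I * s) = ((rexp s - 1 - s : ℝ) : ℂ) := by
    have : Complex.I * (-Complex.I * s) = s := by
      rw [← mul_assoc, mul_neg, Complex.I_mul_I]; simp
    simp only [levyKernel, this]
    push_cast
    rfl
  rw [h2, Complex.norm_real] at h1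
  refine (le_abs_self _).trans (h1.trans_eq ?_)
  simp

lemma re_levyKernel (v s : ℝ) :
    (levyKernel (v - s * Complex.I)).re = (rexp s - 1 - s) - rexp s * (1 - Real.cos v) := by
  have : Complex.I * (v - s * Complex.I) = (s : ℂ) + v * Complex.I := by
    ring_nf; simp
  simp only [levyKernel, this, Complex.sub_re, Complex.exp_re, Complex.add_re, Complex.ofReal_re,
    Complex.mul_re, Complex.I_re, Complex.ofReal_im, Complex.I_im, Complex.add_im, Complex.mul_im,
    Complex.one_re]
  ring_nf

/-- Separates the cost of an imaginary shift, a quadratic term without oscillation, from the decay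
in the real frequency, which survives up to the factor `e^(-τ)`. -/
lemma re_levyKernel_le {v s τ : ℝ} (hs : |s| ≤ τ) :
    (levyKernel (v - s * Complex.I)).re ≤ s ^ 2 * rexp τ - rexp (-τ) * (1 - Real.cos v) := by
  rw [re_levyKernel]
  have h1 := exp_sub_one_sub_le s
  have h2 : rexp |s| ≤ rexp τ := by gcongr
  have h3 : rexp (-τ) ≤ rexp s := by
    gcongr; exact (abs_le.1 hs).1
  have h4 : 0 ≤ 1 - Real.cos v := by linarith [Real.cos_le_one v]
  have := mul_le_mul_of_nonneg_right h3 h4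
  have := mul_le_mul_of_nonneg_left h2 (sq_nonneg s)
  linarith

variable {V : Type*} [NormedAddCommGroup V] [InnerProductSpace ℝ V] [FiniteDimensional ℝ V]
  [MeasurableSpace V] [BorelSpace V]

/-- A measure `N` on the ball of radius `h`, with second moment at most `M h ^ 2` and whose
symmetrized exponent dominates `κ ((h ‖ξ‖) ^ α - 1)`. -/
structure SmallJumpBounds (N : Measure V) (α h κ M : ℝ) : Prop where
  α_pos : 0 < α
  α_lt : α < 2
  h_pos : 0 < h
  κ_pos : 0 < κ
  M_pos : 0 < M
  norm_le : ∀ᵐ y ∂N, ‖y‖ ≤ h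
  integrable_sq : Integrable (fun y ↦ ‖y‖ ^ 2) N
  integral_sq_le : ∫ y, ‖y‖ ^ 2 ∂N ≤ M * h ^ 2
  le_integral : ∀ ξ : V, κ * ((h * ‖ξ‖) ^ α - 1) ≤ ∫ y, (1 - Real.cos ⟪ξ, y⟫) ∂N

/-- The exponent `∫ (exp (i w) - 1 - i w) N(dy)` at `w = ⟪ξ, y⟫ + z ⟪η, y⟫`. -/
noncomputable def smallExponent (N : Measure V) (ξ η : V) (z : ℂ) : ℂ :=
  ∫ y, levyKernel ((⟪ξ, y⟫ : ℝ) + z * (⟪η, y⟫ : ℝ)) ∂N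

lemma norm_pairing_le (ξ η y : V) (z : ℂ) :
    ‖((⟪ξ, y⟫ : ℝ) : ℂ) + z * (⟪η, y⟫ : ℝ)‖ ≤ (‖ξ‖ + ‖z‖ * ‖η‖) * ‖y‖ := by
  refine (norm_add_le _ _).trans ?_
  rw [norm_mul, Complex.norm_real, Complex.norm_real]
  have h1 := norm_inner_le_norm (𝕜 := ℝ) ξ y
  have h2 := norm_inner_le_norm (𝕜 := ℝ) η y
  have := mul_le_mul_of_nonneg_left h2 (norm_nonneg z)
  linarith

lemma norm_levyKernel_pairing_le {h B : ℝ} {ξ η y : V} {z : ℂ}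
    (hB : ‖ξ‖ + ‖z‖ * ‖η‖ ≤ B) (hy : ‖y‖ ≤ h) :
    ‖levyKernel ((⟪ξ, y⟫ : ℝ) + z * (⟪η, y⟫ : ℝ))‖ ≤ B ^ 2 * rexp (B * h) * ‖y‖ ^ 2 := by
  have hB0 : 0 ≤ B := le_trans (by positivity) hB
  have h1 : ‖((⟪ξ, y⟫ : ℝ) : ℂ) + z * (⟪η, y⟫ : ℝ)‖ ≤ B * ‖y‖ :=
    (norm_pairing_le ξ η y z).trans (by gcongr)
  refine (norm_levyKernel_le _).trans ?_
  calc _ ≤ (B * ‖y‖) ^ 2 * rexp (B * h) := by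
        gcongr
        exact h1.trans (by gcongr)
    _ = _ := by ring

lemma integrable_one_sub_cos {N : Measure V} (hN : Integrable (fun y ↦ ‖y‖ ^ 2) N) (ξ : V) :
    Integrable (fun y ↦ 1 - Real.cos ⟪ξ, y⟫) N := by
  refine (hN.const_mul (‖ξ‖ ^ 2)).mono' ?_ ?_
  · exact Continuous.aestronglyMeasurable (by fun_prop)
  · refine Eventually.of_forall fun y ↦ ?_
    rw [Real.norm_of_nonneg (by linarith [Real.cos_le_one ⟪ξ, y⟫])]
    have h1 := Real.one_sub_sq_div_two_le_cos (x := ⟪ξ, y⟫)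
    have h2 : ⟪ξ, y⟫ ^ 2 ≤ (‖ξ‖ * ‖y‖) ^ 2 := by
      rw [← sq_abs]; gcongr; exact abs_real_inner_le_norm ξ y
    nlinarith [sq_nonneg (‖ξ‖ * ‖y‖)]

namespace SmallJumpBounds

variable {N : Measure V} {α h κ M : ℝ}

lemma integrable_levyKernel (H : SmallJumpBounds N α h κ M) (ξ η : V) (z : ℂ) :
    Integrable (fun y ↦ levyKernel ((⟪ξ, y⟫ : ℝ) + z * (⟪η, y⟫ : ℝ))) N := by
  refine (H.integrable_sq.const_mul
    ((‖ξ‖ + ‖z‖ * ‖η‖) ^ 2 * rexp ((‖ξ‖ + ‖z‖ * ‖η‖) * h))).mono' ?_ ?_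
  · have := continuous_levyKernel
    exact Continuous.aestronglyMeasurable (by fun_prop)
  · filter_upwards [H.norm_le] with y hy using norm_levyKernel_pairing_le le_rfl hy

/-- Because `N` lives on the ball of radius `h`, the kernel is dominated by a constant times `‖y‖²`,
uniformly for bounded `z`. -/
lemma differentiable_smallExponent (H : SmallJumpBounds N α h κ M) (ξ η : V) :
    Differentiable ℂ (smallExponent N ξ η) := by
  refine differentiable_integral_of_entire (fun z ↦ (H.integrable_levyKernel ξ η z).1)
    (fun y ↦ differentiable_levyKernel.comp (by fun_prop)) fun R ↦
    ⟨_, H.integrable_sq.const_mul ((‖ξ‖ + R * ‖η‖) ^ 2 * rexp ((‖ξ‖ + R * ‖η‖) * h)), ?_⟩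
  filter_upwards [H.norm_le] with y hy z hz
  exact norm_levyKernel_pairing_le (by gcongr) hy

lemma stronglyMeasurable_smallExponent [SFinite N] (η : V) (z : ℂ) :
    StronglyMeasurable fun ξ ↦ smallExponent N ξ η z := by
  refine StronglyMeasurable.integral_prod_right
    (f := fun ξ y : V ↦ levyKernel ((⟪ξ, y⟫ : ℝ) + z * (⟪η, y⟫ : ℝ))) ?_
  have := continuous_levyKernel
  refine Continuous.stronglyMeasurable ?_
  unfold Function.uncurry
  fun_prop

/-- A real shift of the contour parameter is a translation of the frequency; this identifies the
integrals on all real contours. -/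
lemma smallExponent_shift (ξ η : V) (a : ℝ) (z : ℂ) :
    smallExponent N ξ η (a + z) = smallExponent N (ξ + a • η) η z := by
  unfold smallExponent
  congr 1
  ext y
  congr 1
  rw [inner_add_left, inner_smul_left]
  push_cast
  simp
  ring

/-- Integration of the pointwise kernel bound: the second moment bound controls the cost of the
shift, and the lower bound on the symmetrized exponent supplies the decay. It serves both the
domination along contours and the choice of tilt; `τ = 0` is the untilted case. -/
lemma re_smallExponent_le (H : SmallJumpBounds N α h κ M) (ξ η : V) {b τ : ℝ}
    (hτ : |b| * ‖η‖ * h ≤ τ) :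
    (smallExponent N ξ η (b * Complex.I)).re ≤
      M * τ ^ 2 * rexp τ + κ - rexp (-τ) * κ * (h * ‖ξ‖) ^ α := by
  have hh := H.h_pos
  have hM := H.M_pos
  have hτ0 : 0 ≤ τ := le_trans (by positivity) hτ
  have h1 : (smallExponent N ξ η (b * Complex.I)).re =
      ∫ y, (levyKernel ((⟪ξ, y⟫ : ℝ) + b * Complex.I * (⟪η, y⟫ : ℝ))).re ∂N :=
    (integral_re (H.integrable_levyKernel ξ η (b * Complex.I))).symm
  have h2 : ∀ᵐ y ∂N, (levyKernel ((⟪ξ, y⟫ : ℝ) + b * Complex.I * (⟪η, y⟫ : ℝ))).re ≤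
      (|b| * ‖η‖) ^ 2 * rexp τ * ‖y‖ ^ 2 - rexp (-τ) * (1 - Real.cos ⟪ξ, y⟫) := by
    filter_upwards [H.norm_le] with y hy
    have h3 : |-b * ⟪η, y⟫| ≤ |b| * ‖η‖ * ‖y‖ := by
      rw [abs_mul, abs_neg, mul_assoc]
      gcongr
      exact abs_real_inner_le_norm η y
    have h4 : ((⟪ξ, y⟫ : ℝ) : ℂ) + b * Complex.I * (⟪η, y⟫ : ℝ)
        = (⟪ξ, y⟫ : ℝ) - ((-b * ⟪η, y⟫ : ℝ) : ℂ) * Complex.I := by push_cast; ring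
    rw [h4]
    refine (re_levyKernel_le (τ := τ) (h3.trans (le_trans (by gcongr) hτ))).trans ?_
    have h5 : (-b * ⟪η, y⟫) ^ 2 ≤ (|b| * ‖η‖ * ‖y‖) ^ 2 := by
      rw [← sq_abs]; gcongr
    have := mul_le_mul_of_nonneg_right h5 (exp_pos τ).le
    linarith
  have h6 := integral_mono_ae ((H.integrable_levyKernel ξ η (b * Complex.I)).re)
    ((H.integrable_sq.const_mul ((|b| * ‖η‖) ^ 2 * rexp τ)).sub
      ((integrable_one_sub_cos H.integrable_sq ξ).const_mul (rexp (-τ)))) h2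
  rw [h1]
  refine h6.trans ?_
  simp only [Pi.sub_apply]
  rw [integral_sub (H.integrable_sq.const_mul _) ((integrable_one_sub_cos H.integrable_sq ξ).const_mul _),
    integral_const_mul, integral_const_mul]
  have h7 : (|b| * ‖η‖) ^ 2 * rexp τ * ∫ y, ‖y‖ ^ 2 ∂N ≤ M * τ ^ 2 * rexp τ := by
    calc _ ≤ (|b| * ‖η‖) ^ 2 * rexp τ * (M * h ^ 2) := by
          gcongr; exact H.integral_sq_le
      _ = M * (|b| * ‖η‖ * h) ^ 2 * rexp τ := by ring
      _ ≤ _ := by gcongr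
  have h8 := mul_le_mul_of_nonneg_left (H.le_integral ξ) (exp_pos (-τ)).le
  have h9 : rexp (-τ) * κ ≤ κ := mul_le_of_le_one_left H.κ_pos.le
    (by rw [Real.exp_le_one_iff]; linarith)
  linarith

end SmallJumpBounds

end SmallJumps

/-! ### Contour shift and tilt for the small jump density. -/

section SmallJumpDensity

open Filter Topology Real
open scoped RealInnerProductSpace

/-- This is `a ≤ sinh a` multiplied by `2 e^a`. -/
lemma two_mul_mul_exp_le {a : ℝ} (ha : 0 ≤ a) : 2 * a * rexp a ≤ rexp (2 * a) - 1 := by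
  have h1 : a ≤ Real.sinh a := Real.self_le_sinh_iff.2 ha
  rw [Real.sinh_eq] at h1
  have h2 : rexp (-a) * rexp a = 1 := by rw [← Real.exp_add]; simp
  have h3 : rexp (2 * a) = rexp a * rexp a := by rw [← Real.exp_add]; ring_nf
  nlinarith [exp_pos a]

lemma add_rpow_le_four_mul {u v α : ℝ} (hu : 0 ≤ u) (hv : 0 ≤ v) (hα : 0 ≤ α) (hα2 : α ≤ 2) :
    (u + v) ^ α ≤ 4 * (u ^ α + v ^ α) := by
  have h2 : (2 : ℝ) ^ α ≤ 4 := by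
    calc (2 : ℝ) ^ α ≤ 2 ^ (2 : ℝ) := rpow_le_rpow_of_exponent_le (by norm_num) hα2
      _ = 4 := by norm_num
  have h3 : (max u v) ^ α ≤ u ^ α + v ^ α := by
    have := rpow_nonneg hu α
    have := rpow_nonneg hv α
    rcases max_choice u v with h | h <;> rw [h] <;> linarith
  calc (u + v) ^ α ≤ (2 * max u v) ^ α := by
        gcongr
        linarith [le_max_left u v, le_max_right u v]
    _ = 2 ^ α * (max u v) ^ α := mul_rpow (by norm_num) (le_max_of_le_left hu)
    _ ≤ 4 * (u ^ α + v ^ α) := by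
        gcongr

/-- The profile `exp (-(u / 4) log (1 + u / (2 M)))` of the small jump density. -/
noncomputable def smallJumpProfile (M u : ℝ) : ℝ := rexp (-(u / 4) * Real.log (1 + u / (2 * M)))

/-- Choice of the exponential tilt in the Chernoff type estimate. -/
lemma exists_tilt_exponent_le {M δ : ℝ} (hM : 0 < M) (hδ : 0 ≤ δ) :
    ∃ K₀ : ℝ, ∀ u : ℝ, 0 ≤ u → ∃ a : ℝ, 0 ≤ a ∧
      -(a * u) + M * a ^ 2 * rexp a + a * δ ≤ K₀ + -(u / 4) * Real.log (1 + u / (2 * M)) := by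
  -- With this `a` one has `e^(2a) - 1 = u/(2M)`, hence `M a² e^a ≤ a u/4`. The term `a δ` is
  -- absorbed by another `a u/4` when `u ≥ 4δ`; otherwise `a` is at most its value at `u = 4δ`,
  -- which gives the constant. What remains, `-a u/2`, is the exponent of the profile.
  refine ⟨1 / 2 * Real.log (1 + 4 * δ / (2 * M)) * δ, fun u hu ↦
    ⟨1 / 2 * Real.log (1 + u / (2 * M)), ?_, ?_⟩⟩
  · have : 0 ≤ u / (2 * M) := by positivity
    have := Real.log_nonneg (by linarith : 1 ≤ 1 + u / (2 * M))
    positivity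
  have hpos : 0 ≤ u / (2 * M) := by positivity
  have hlog := Real.log_nonneg (by linarith : 1 ≤ 1 + u / (2 * M))
  set a := 1 / 2 * Real.log (1 + u / (2 * M)) with ha
  have ha0 : 0 ≤ a := by positivity
  have h1 := two_mul_mul_exp_le ha0
  have h2 : rexp (2 * a) = 1 + u / (2 * M) := by
    rw [ha, ← mul_assoc]; norm_num
    rw [Real.exp_log (by linarith)]
  rw [h2] at h1
  have h3 : M * a ^ 2 * rexp a ≤ a * u / 4 := by
    calc M * a ^ 2 * rexp a = M * a / 2 * (2 * a * rexp a) := by ring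
      _ ≤ M * a / 2 * (1 + u / (2 * M) - 1) := by gcongr
      _ = a * u / 4 := by field_simp; ring
  have h0 : 0 ≤ 4 * δ / (2 * M) := by positivity
  have h4 : a * δ ≤ 1 / 2 * Real.log (1 + 4 * δ / (2 * M)) * δ + a * u / 4 := by
    rcases le_total (4 * δ) u with h | h
    · have h5 := Real.log_nonneg (by linarith : 1 ≤ 1 + 4 * δ / (2 * M))
      have : 0 ≤ 1 / 2 * Real.log (1 + 4 * δ / (2 * M)) * δ := by positivity
      have := mul_le_mul_of_nonneg_left h ha0
      linarith
    · have h5 : a ≤ 1 / 2 * Real.log (1 + 4 * δ / (2 * M)) := by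
        rw [ha]; gcongr
      have := mul_le_mul_of_nonneg_right h5 hδ
      have : 0 ≤ a * u / 4 := by positivity
      linarith
  have h5 : -(u / 4) * Real.log (1 + u / (2 * M)) = -(a * u) / 2 := by rw [ha]; ring
  rw [h5]
  linarith

variable {V : Type*} [NormedAddCommGroup V] [InnerProductSpace ℝ V] [FiniteDimensional ℝ V]
  [MeasurableSpace V] [BorelSpace V]

/-- The integrand of the Fourier inversion formula for the small jump part, on the shifted contour
`ξ + z η`. -/
noncomputable def shiftedIntegrand (N : Measure V) (x η : V) (z : ℂ) (ξ : V) : ℂ :=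
  Complex.exp (-Complex.I * ((⟪ξ, x⟫ : ℝ) + z * (⟪η, x⟫ : ℝ))) *
    Complex.exp (smallExponent N ξ η z)

lemma norm_shiftedIntegrand (N : Measure V) (x η : V) (z : ℂ) (ξ : V) :
    ‖shiftedIntegrand N x η z ξ‖ =
      rexp (z.im * ⟪η, x⟫) * rexp (smallExponent N ξ η z).re := by
  rw [shiftedIntegrand, norm_mul, Complex.norm_exp, Complex.norm_exp]
  congr 2
  simp

namespace SmallJumpBounds

variable {N : Measure V} {α h κ M : ℝ}

/-- An integrable majorant common to all `‖z‖ ≤ R`. The real part of `z` recentres the decay at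
`-z.re • η`; quasi-subadditivity of the power moves it back to the origin for a factor `4`. -/
lemma norm_shiftedIntegrand_le (H : SmallJumpBounds N α h κ M) (x η ξ : V) {R : ℝ} {z : ℂ}
    (hz : ‖z‖ ≤ R) :
    ‖shiftedIntegrand N x η z ξ‖ ≤ rexp (R * (‖η‖ * ‖x‖)) *
      rexp (M * (R * ‖η‖ * h) ^ 2 * rexp (R * ‖η‖ * h) + κ +
        rexp (-(R * ‖η‖ * h)) * κ * (R * ‖η‖ * h) ^ α) *
      rexp (-(rexp (-(R * ‖η‖ * h)) * κ / 4 * (h * ‖ξ‖) ^ α)) := by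
  have hR : 0 ≤ R := (norm_nonneg z).trans hz
  have hh := H.h_pos
  have hκ := H.κ_pos
  set τ := R * ‖η‖ * h with hτ
  have hτ0 : 0 ≤ τ := by positivity
  have h1 : z.im * ⟪η, x⟫ ≤ R * (‖η‖ * ‖x‖) := by
    refine (le_abs_self _).trans ?_
    rw [abs_mul]
    gcongr
    · exact (Complex.abs_im_le_norm z).trans hz
    · exact abs_real_inner_le_norm η x
  have h2 : (smallExponent N ξ η z).re ≤
      M * τ ^ 2 * rexp τ + κ - rexp (-τ) * κ * (h * ‖ξ + z.re • η‖) ^ α := by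
    have h3 : smallExponent N ξ η z = smallExponent N (ξ + z.re • η) η (z.im * Complex.I) := by
      rw [← smallExponent_shift, Complex.re_add_im]
    rw [h3]
    refine H.re_smallExponent_le _ _ ?_
    rw [hτ]
    gcongr
    exact (Complex.abs_im_le_norm z).trans hz
  have h4 : (h * ‖ξ‖) ^ α ≤ 4 * ((h * ‖ξ + z.re • η‖) ^ α + τ ^ α) := by
    refine le_trans ?_ (add_rpow_le_four_mul (by positivity) hτ0 H.α_pos.le H.α_lt.le)
    refine rpow_le_rpow (by positivity) ?_ H.α_pos.le
    have h5 : ‖ξ‖ ≤ ‖ξ + z.re • η‖ + ‖z.re • η‖ := by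
      simpa using norm_sub_le (ξ + z.re • η) (z.re • η)
    have h6 : ‖z.re • η‖ ≤ R * ‖η‖ := by
      rw [norm_smul, Real.norm_eq_abs]
      gcongr
      exact (Complex.abs_re_le_norm z).trans hz
    calc h * ‖ξ‖ ≤ h * (‖ξ + z.re • η‖ + R * ‖η‖) := by gcongr; linarith
      _ = _ := by rw [hτ]; ring
  have h7 : 0 ≤ rexp (-τ) * κ := by positivity
  have h8 := mul_le_mul_of_nonneg_left h4 h7
  rw [norm_shiftedIntegrand, ← Real.exp_add, ← Real.exp_add, ← Real.exp_add, Real.exp_le_exp]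
  linarith

lemma measurable_shiftedIntegrand [SFinite N] (x η : V) (z : ℂ) :
    AEStronglyMeasurable (shiftedIntegrand N x η z) := by
  unfold shiftedIntegrand
  refine AEStronglyMeasurable.mul (Continuous.aestronglyMeasurable (by fun_prop)) ?_
  exact (Complex.continuous_exp.comp_stronglyMeasurable
    (stronglyMeasurable_smallExponent η z)).aestronglyMeasurable

/-- The inversion integral does not depend on the contour. -/
lemma integral_shiftedIntegrand_eq [Nontrivial V] [SFinite N] (H : SmallJumpBounds N α h κ M)
    (x η : V) (z : ℂ) :
    ∫ ξ, shiftedIntegrand N x η z ξ = ∫ ξ, shiftedIntegrand N x η 0 ξ := by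
  refine entire_eq_of_real_const (F := fun z ↦ ∫ ξ, shiftedIntegrand N x η z ξ) ?_ ?_ z
  · refine differentiable_integral_of_entire (measurable_shiftedIntegrand x η) ?_ ?_
    · intro ξ
      unfold shiftedIntegrand
      have := H.differentiable_smallExponent ξ η
      fun_prop
    · intro R
      have hκ := H.κ_pos
      refine ⟨_, (integrable_exp_neg_mul_norm_rpow (V := V) (c := rexp (-(R * ‖η‖ * h)) * κ / 4)
        H.α_pos H.h_pos (by positivity)).const_mul _, Eventually.of_forall fun ξ z hz ↦
          H.norm_shiftedIntegrand_le x η ξ hz⟩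
  -- For real parameters the contours differ by a translation, so invariance of Lebesgue measure
  -- suffices; the identity theorem carries the equality to complex `z` and takes the place of a
  -- contour deformation.
  · intro a
    have h1 : ∀ ξ, shiftedIntegrand N x η a ξ = shiftedIntegrand N x η 0 (ξ + a • η) := by
      intro ξ
      unfold shiftedIntegrand
      rw [← smallExponent_shift, add_zero]
      congr 3
      rw [inner_add_left, inner_smul_left]
      push_cast
      simp
    simp_rw [h1]
    exact integral_add_right_eq_self (fun ξ ↦ shiftedIntegrand N x η 0 ξ) (a • η)

lemma norm_exp_smallExponent_le (H : SmallJumpBounds N α h κ M) (ξ : V) :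
    ‖Complex.exp (smallExponent N ξ 0 0)‖ ≤ rexp κ * rexp (-(κ * (h * ‖ξ‖) ^ α)) := by
  have := H.re_smallExponent_le ξ 0 (b := 0) (τ := 0) (by simp)
  rw [Complex.norm_exp, ← Real.exp_add]
  gcongr
  simpa [sub_eq_add_neg] using this

lemma integrable_exp_smallExponent [Nontrivial V] [SFinite N] (H : SmallJumpBounds N α h κ M) :
    Integrable fun ξ ↦ Complex.exp (smallExponent N ξ 0 0) := by
  refine ((integrable_exp_neg_mul_norm_rpow (V := V) H.α_pos H.h_pos H.κ_pos).const_mul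
    (rexp κ)).mono' ?_ (Eventually.of_forall H.norm_exp_smallExponent_le)
  exact (Complex.continuous_exp.comp_stronglyMeasurable
    (stronglyMeasurable_smallExponent 0 0)).aestronglyMeasurable

lemma smallExponent_zero (N : Measure V) (ξ η : V) :
    smallExponent N ξ η 0 = smallExponent N ξ 0 0 := by
  simp [smallExponent]

end SmallJumpBounds

/-- The small jump density, up to the factor `(2 π) ^ d`. -/
noncomputable def smallJumpDensity (N : Measure V) (x : V) : ℂ :=
  ∫ ξ, Complex.exp (-(⟪ξ, x⟫ : ℝ) * Complex.I) * Complex.exp (smallExponent N ξ 0 0)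

lemma smallJumpDensity_eq (N : Measure V) (x η : V) :
    smallJumpDensity N x = ∫ ξ, shiftedIntegrand N x η 0 ξ := by
  unfold smallJumpDensity shiftedIntegrand
  congr 1
  ext ξ
  rw [SmallJumpBounds.smallExponent_zero N ξ η]
  congr 2
  ring

/-- The contour is moved in direction `x`, by an imaginary amount of length at most `a/h`. The plane
wave then contributes `exp(-a‖x‖/h)`, the exponent costs `M a² e^a`, and the integral of the
weakened decay costs `exp(a d/α)`. -/
lemma norm_smallJumpDensity_le_integral [Nontrivial V] {N : Measure V} {α h κ M : ℝ} [SFinite N]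
    (H : SmallJumpBounds N α h κ M) (x : V) {a : ℝ} (ha : 0 ≤ a) :
    ‖smallJumpDensity N x‖ ≤ rexp (-(a * (‖x‖ / h)) + M * a ^ 2 * rexp a + a *
        (Module.finrank ℝ V / α)) * (rexp κ * κ ^ (-(Module.finrank ℝ V : ℝ) / α) *
        ∫ ξ : V, rexp (-‖ξ‖ ^ α)) * (h ^ Module.finrank ℝ V)⁻¹ := by
  have hh := H.h_pos
  have hκ := H.κ_pos
  have hα := H.α_pos
  -- At `x = 0` the quotient is `0` by convention, and both required properties of `β` still hold.
  set β : ℝ := -(a / (h * ‖x‖)) with hβ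
  have hβx : β * ‖x‖ ^ 2 = -(a * (‖x‖ / h)) := by
    rcases eq_or_ne x 0 with rfl | hx
    · simp
    · have : ‖x‖ ≠ 0 := norm_ne_zero_iff.2 hx
      rw [hβ]; field_simp
  have hτ : |β| * ‖x‖ * h ≤ a := by
    rw [hβ, abs_neg, abs_of_nonneg (by positivity)]
    rcases eq_or_ne x 0 with rfl | hx
    · simpa
    · have : ‖x‖ ≠ 0 := norm_ne_zero_iff.2 hx
      apply le_of_eq; field_simp
  rw [smallJumpDensity_eq N x x, ← H.integral_shiftedIntegrand_eq x x (β * Complex.I)]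
  have hbd : ∀ ξ : V, ‖shiftedIntegrand N x x (β * Complex.I) ξ‖ ≤
      rexp (-(a * (‖x‖ / h)) + M * a ^ 2 * rexp a + κ) *
        rexp (-(rexp (-a) * κ * (h * ‖ξ‖) ^ α)) := by
    intro ξ
    rw [norm_shiftedIntegrand, ← Real.exp_add, ← Real.exp_add]
    have := H.re_smallExponent_le ξ x hτ
    rw [Real.exp_le_exp]
    have h1 : ((β : ℂ) * Complex.I).im * ⟪x, x⟫ = β * ‖x‖ ^ 2 := by
      rw [real_inner_self_eq_norm_sq]; simp
    rw [h1, hβx]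
    linarith
  refine (norm_integral_le_of_norm_le ((integrable_exp_neg_mul_norm_rpow (V := V) hα hh
    (by positivity)).const_mul _) (Eventually.of_forall hbd)).trans_eq ?_
  rw [integral_const_mul, integral_exp_neg_mul_norm_rpow hα hh (by positivity),
    mul_rpow (exp_pos _).le hκ.le, ← Real.exp_mul]
  have : rexp (-(a * (‖x‖ / h)) + M * a ^ 2 * rexp a + a * (Module.finrank ℝ V / α)) * rexp κ
      = rexp (-(a * (‖x‖ / h)) + M * a ^ 2 * rexp a + κ) *
        rexp (-a * (-(Module.finrank ℝ V : ℝ) / α)) := by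
    rw [← Real.exp_add, ← Real.exp_add]
    ring_nf
  linear_combination -(κ ^ (-(Module.finrank ℝ V : ℝ) / α) *
        ∫ ξ : V, rexp (-‖ξ‖ ^ α)) * (h ^ Module.finrank ℝ V)⁻¹ * this

/-- Pointwise bound of the small jump density. -/
theorem exists_norm_smallJumpDensity_le (V : Type*) [NormedAddCommGroup V] [InnerProductSpace ℝ V]
    [FiniteDimensional ℝ V] [MeasurableSpace V] [BorelSpace V] [Nontrivial V] {α κ M : ℝ}
    (hα : 0 < α) (hκ : 0 < κ) (hM : 0 < M) :
    ∃ K : ℝ, 0 < K ∧ ∀ (N : Measure V) (h : ℝ) [SFinite N], SmallJumpBounds N α h κ M →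
      ∀ x, ‖smallJumpDensity N x‖ ≤ K * (h ^ Module.finrank ℝ V)⁻¹ *
        smallJumpProfile M (‖x‖ / h) := by
  obtain ⟨K₀, hK₀⟩ := exists_tilt_exponent_le (δ := Module.finrank ℝ V / α) hM (by positivity)
  have hI : 0 < ∫ ξ : V, rexp (-‖ξ‖ ^ α) := integral_exp_pos (integrable_exp_neg_norm_rpow hα)
  refine ⟨rexp K₀ * (rexp κ * κ ^ (-(Module.finrank ℝ V : ℝ) / α) *
        ∫ ξ : V, rexp (-‖ξ‖ ^ α)), by positivity, fun N h _ H x ↦ ?_⟩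
  have hh := H.h_pos
  obtain ⟨a, ha, hle⟩ := hK₀ (‖x‖ / h) (by positivity)
  refine (norm_smallJumpDensity_le_integral H x ha).trans ?_
  have h1 := Real.exp_le_exp.2 hle
  rw [Real.exp_add K₀] at h1
  calc _ ≤ (rexp K₀ * rexp (-(‖x‖ / h / 4) * Real.log (1 + ‖x‖ / h / (2 * M)))) *
        (rexp κ * κ ^ (-(Module.finrank ℝ V : ℝ) / α) *
        ∫ ξ : V, rexp (-‖ξ‖ ^ α)) * (h ^ Module.finrank ℝ V)⁻¹ := by gcongr
    _ = _ := by unfold smallJumpProfile; ring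

end SmallJumpDensity

/-! ### Sums of large jumps and the single big jump. -/

section CompoundPoisson

open Filter Topology Real
open scoped RealInnerProductSpace ENNReal

variable {V : Type*} [NormedAddCommGroup V] [InnerProductSpace ℝ V] [FiniteDimensional ℝ V]
  [MeasurableSpace V] [BorelSpace V]

/-- The image of the product measure `Λ ^ n` under
`(y₁, …, yₙ) ↦ (y₁ + ⋯ + yₙ, ‖y₁‖ + ⋯ + ‖yₙ‖)`. -/
noncomputable def jumpMeasure (Λ : Measure V) : ℕ → Measure (V × ℝ)
  | 0 => Measure.dirac (0, 0)
  | n + 1 => ((jumpMeasure Λ n).prod Λ).map fun p ↦ (p.1.1 + p.2, p.1.2 + ‖p.2‖)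

lemma measurable_jumpStep :
    Measurable fun p : (V × ℝ) × V ↦ (p.1.1 + p.2, p.1.2 + ‖p.2‖) :=
  Continuous.measurable (by fun_prop)

variable (Λ : Measure V) [IsFiniteMeasure Λ]

instance isFiniteMeasure_jumpMeasure (n : ℕ) : IsFiniteMeasure (jumpMeasure Λ n) := by
  induction n with
  | zero => unfold jumpMeasure; infer_instance
  | succ n ih => unfold jumpMeasure; infer_instance

lemma lintegral_jumpMeasure_succ (n : ℕ) {f : V × ℝ → ℝ≥0∞} (hf : Measurable f) :
    ∫⁻ p, f p ∂(jumpMeasure Λ (n + 1)) =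
      ∫⁻ p, ∫⁻ y, f (p.1 + y, p.2 + ‖y‖) ∂Λ ∂(jumpMeasure Λ n) := by
  rw [jumpMeasure, lintegral_map hf measurable_jumpStep,
    lintegral_prod (fun q : (V × ℝ) × V ↦ f (q.1.1 + q.2, q.1.2 + ‖q.2‖))
      (hf.comp measurable_jumpStep).aemeasurable]

lemma ae_jumpMeasure_norm_le (n : ℕ) : ∀ᵐ p ∂(jumpMeasure Λ n), ‖p.1‖ ≤ p.2 := by
  induction n with
  | zero =>
    rw [jumpMeasure, ae_dirac_iff (measurableSet_le (by fun_prop) (by fun_prop))]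
    simp
  | succ n ih =>
    rw [jumpMeasure, ae_map_iff measurable_jumpStep.aemeasurable
      (measurableSet_le (by fun_prop) (by fun_prop))]
    have h1 : ∀ᵐ q ∂((jumpMeasure Λ n).prod Λ), ‖q.1.1‖ ≤ q.1.2 :=
      Measure.quasiMeasurePreserving_fst.ae ih
    filter_upwards [h1] with q hq
    exact (norm_add_le _ _).trans (by linarith)

lemma integral_cexp_jumpMeasure (ξ : V) (n : ℕ) :
    ∫ p, Complex.exp (Complex.I * (⟪ξ, p.1⟫ : ℝ)) ∂(jumpMeasure Λ n) =
      (∫ y, Complex.exp (Complex.I * (⟪ξ, y⟫ : ℝ)) ∂Λ) ^ n := by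
  induction n with
  | zero => simp [jumpMeasure]
  | succ n ih =>
    rw [jumpMeasure, integral_map measurable_jumpStep.aemeasurable
      (Continuous.aestronglyMeasurable (by fun_prop)), pow_succ, ← ih, ← integral_prod_mul]
    congr 1
    ext q
    rw [← Complex.exp_add, inner_add_right]
    push_cast
    ring_nf

variable {c : ℝ} {M : ℝ≥0∞}

/-- The reason for recording the total length next to the displacement: length is additive, so its
exponential moment factorizes over the jumps. -/
lemma lintegral_exp_jumpMeasure_le
    (hM : ∫⁻ y, ENNReal.ofReal (rexp (c * ‖y‖)) ∂Λ ≤ M) (n : ℕ) :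
    ∫⁻ p, ENNReal.ofReal (rexp (c * p.2)) ∂(jumpMeasure Λ n) ≤ M ^ n := by
  induction n with
  | zero => rw [jumpMeasure, lintegral_dirac' _ (by fun_prop)]; simp
  | succ n ih =>
    rw [lintegral_jumpMeasure_succ Λ n (by fun_prop), pow_succ]
    calc _ = ∫⁻ p, ENNReal.ofReal (rexp (c * p.2)) * ∫⁻ y, ENNReal.ofReal (rexp (c * ‖y‖)) ∂Λ
          ∂(jumpMeasure Λ n) := by
          refine lintegral_congr fun p ↦ ?_
          rw [← lintegral_const_mul _ (by fun_prop)]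
          refine lintegral_congr fun y ↦ ?_
          rw [← ENNReal.ofReal_mul (exp_pos _).le, ← Real.exp_add, mul_add]
      _ ≤ ∫⁻ p, ENNReal.ofReal (rexp (c * p.2)) * M ∂(jumpMeasure Λ n) := by gcongr
      _ = (∫⁻ p, ENNReal.ofReal (rexp (c * p.2)) ∂(jumpMeasure Λ n)) * M :=
          lintegral_mul_const _ (by fun_prop)
      _ ≤ M ^ n * M := by gcongr

/-- One big jump: at least one of the jumps is of the order of their total length. -/
lemma lintegral_big_jumpMeasure_le {g : V → ℝ≥0∞} (hg : Measurable g) {b : ℝ → ℝ≥0∞} {L : ℝ≥0∞}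
    (hM : ∫⁻ y, ENNReal.ofReal (rexp (c * ‖y‖)) ∂Λ ≤ M) (hM1 : 1 ≤ M) (hL1 : 1 ≤ L)
    (hb : ∀ w : V, ∀ R : ℝ, 0 < R → ∫⁻ y, {y : V | R ≤ ‖y‖}.indicator
      (fun y ↦ g (w - y) * ENNReal.ofReal (rexp (c * ‖y‖))) y ∂Λ ≤ b R)
    (hbL : ∀ R : ℝ, 0 < R → b (R / 2) ≤ L * b R) (n : ℕ) :
    ∀ w : V, ∀ R : ℝ, 0 < R → ∫⁻ p, {p : V × ℝ | R ≤ p.2}.indicator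
      (fun p ↦ g (w - p.1) * ENNReal.ofReal (rexp (c * p.2))) p ∂(jumpMeasure Λ n) ≤
        (2 * (L * M)) ^ n * b R := by
  have hmeas : ∀ (w : V) (R : ℝ), Measurable ({p : V × ℝ | R ≤ p.2}.indicator
      (fun p ↦ g (w - p.1) * ENNReal.ofReal (rexp (c * p.2)))) := fun w R ↦
    Measurable.indicator (by fun_prop) (measurableSet_le (by fun_prop) (by fun_prop))
  have hmeas' : ∀ (w : V) (R : ℝ), Measurable ({y : V | R ≤ ‖y‖}.indicator
      (fun y ↦ g (w - y) * ENNReal.ofReal (rexp (c * ‖y‖)))) := fun w R ↦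
    Measurable.indicator (by fun_prop) (measurableSet_le (by fun_prop) (by fun_prop))
  induction n with
  | zero =>
    intro w R hR
    rw [jumpMeasure, lintegral_dirac' _ (hmeas w R)]
    simp [hR]
  | succ n ih =>
    intro w R hR
    rw [lintegral_jumpMeasure_succ Λ n (hmeas w R)]
    -- If the total length is at least `R`, then either the last jump is at least `R/2` (`A`) or the
    -- earlier jumps together have length at least `R/2` (`B`). The one-jump bound handles `A`,
    -- uniformly in the position `w - p.1`; the induction hypothesis handles `B` after exchanging
    -- the integrals.
    set A : V × ℝ → V → ℝ≥0∞ := fun p y ↦ ENNReal.ofReal (rexp (c * p.2)) *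
      {y : V | R / 2 ≤ ‖y‖}.indicator
        (fun y ↦ g ((w - p.1) - y) * ENNReal.ofReal (rexp (c * ‖y‖))) y with hA
    set B : V × ℝ → V → ℝ≥0∞ := fun p y ↦ ENNReal.ofReal (rexp (c * ‖y‖)) *
      {p : V × ℝ | R / 2 ≤ p.2}.indicator
        (fun p ↦ g ((w - y) - p.1) * ENNReal.ofReal (rexp (c * p.2))) p with hB
    have hAm : ∀ p, Measurable (A p) := fun p ↦ (hmeas' _ _).const_mul _
    have hBm : Measurable (Function.uncurry B) := by
      have : Function.uncurry B = fun q : (V × ℝ) × V ↦ ENNReal.ofReal (rexp (c * ‖q.2‖)) *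
          {q : (V × ℝ) × V | R / 2 ≤ q.1.2}.indicator
          (fun q ↦ g ((w - q.2) - q.1.1) * ENNReal.ofReal (rexp (c * q.1.2))) q := by
        ext q; simp [Set.indicator, hB, Function.uncurry]
      rw [this]
      refine Measurable.mul (by fun_prop) ?_
      exact Measurable.indicator (by fun_prop) (measurableSet_le (by fun_prop) (by fun_prop))
    have hle : ∀ p y, {p : V × ℝ | R ≤ p.2}.indicator
        (fun p ↦ g (w - p.1) * ENNReal.ofReal (rexp (c * p.2))) (p.1 + y, p.2 + ‖y‖) ≤
        A p y + B p y := by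
      intro p y
      by_cases hR1 : R ≤ p.2 + ‖y‖
      · have heq : g (w - (p.1 + y)) * ENNReal.ofReal (rexp (c * (p.2 + ‖y‖))) =
            ENNReal.ofReal (rexp (c * p.2)) *
              (g ((w - p.1) - y) * ENNReal.ofReal (rexp (c * ‖y‖))) := by
          rw [mul_add, Real.exp_add, ENNReal.ofReal_mul (exp_pos _).le, sub_sub]
          ring
        have heq' : g (w - (p.1 + y)) * ENNReal.ofReal (rexp (c * (p.2 + ‖y‖))) =
            ENNReal.ofReal (rexp (c * ‖y‖)) *
              (g ((w - y) - p.1) * ENNReal.ofReal (rexp (c * p.2))) := by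
          rw [mul_add, Real.exp_add, ENNReal.ofReal_mul (exp_pos _).le, sub_sub, add_comm y]
          ring
        rw [Set.indicator_of_mem (by exact hR1)]
        rcases le_total (R / 2) ‖y‖ with h | h
        · refine le_add_right ?_
          simp only [hA]
          rw [Set.indicator_of_mem (by exact h)]
          exact heq.le
        · refine le_add_left ?_
          simp only [hB]
          rw [Set.indicator_of_mem (by show R / 2 ≤ p.2; linarith)]
          exact heq'.le
      · rw [Set.indicator_of_notMem (by exact hR1)]
        exact zero_le
    have h1 : ∫⁻ p, ∫⁻ y, A p y ∂Λ ∂(jumpMeasure Λ n) ≤ M ^ n * (L * b R) := by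
      calc _ ≤ ∫⁻ p, ENNReal.ofReal (rexp (c * p.2)) * (L * b R) ∂(jumpMeasure Λ n) := by
            refine lintegral_mono fun p ↦ ?_
            simp only [hA]
            rw [lintegral_const_mul _ (hmeas' _ _)]
            gcongr
            exact (hb _ _ (by linarith)).trans (hbL R hR)
        _ = (∫⁻ p, ENNReal.ofReal (rexp (c * p.2)) ∂(jumpMeasure Λ n)) * (L * b R) :=
            lintegral_mul_const _ (by fun_prop)
        _ ≤ _ := by gcongr; exact lintegral_exp_jumpMeasure_le Λ hM n
    have h2 : ∫⁻ p, ∫⁻ y, B p y ∂Λ ∂(jumpMeasure Λ n) ≤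
        M * ((2 * (L * M)) ^ n * (L * b R)) := by
      rw [lintegral_lintegral_swap hBm.aemeasurable]
      calc _ ≤ ∫⁻ y, ENNReal.ofReal (rexp (c * ‖y‖)) * ((2 * (L * M)) ^ n * (L * b R)) ∂Λ := by
            refine lintegral_mono fun y ↦ ?_
            simp only [hB]
            rw [lintegral_const_mul _ (hmeas _ _)]
            gcongr
            exact (ih _ _ (by linarith)).trans (by gcongr; exact hbL R hR)
        _ = (∫⁻ y, ENNReal.ofReal (rexp (c * ‖y‖)) ∂Λ) * ((2 * (L * M)) ^ n * (L * b R)) :=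
            lintegral_mul_const _ (by fun_prop)
        _ ≤ _ := by gcongr
    -- This makes both contributions equal to `M (2LM)^n L b R`; their sum is exactly the next
    -- power.
    have h3 : M ^ n ≤ M * (2 * (L * M)) ^ n := by
      have h4 : M ≤ 2 * (L * M) := by
        calc M = 1 * (1 * M) := by simp
          _ ≤ 2 * (L * M) := by gcongr; exact one_le_two
      calc M ^ n = 1 * M ^ n := (one_mul _).symm
        _ ≤ _ := by gcongr
    calc _ ≤ ∫⁻ p, ∫⁻ y, (A p y + B p y) ∂Λ ∂(jumpMeasure Λ n) := by
          gcongr with p y; exact hle p y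
      _ = ∫⁻ p, ∫⁻ y, A p y ∂Λ ∂(jumpMeasure Λ n) + ∫⁻ p, ∫⁻ y, B p y ∂Λ ∂(jumpMeasure Λ n) := by
          rw [lintegral_congr fun p ↦ lintegral_add_left (hAm p) (B p), lintegral_add_right]
          exact hBm.lintegral_prod_right'
      _ ≤ M ^ n * (L * b R) + M * ((2 * (L * M)) ^ n * (L * b R)) := add_le_add h1 h2
      _ ≤ M * (2 * (L * M)) ^ n * (L * b R) + M * ((2 * (L * M)) ^ n * (L * b R)) := by gcongr
      _ = (2 * (L * M)) ^ (n + 1) * b R := by ring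

/-- Either `x - p.1` has norm at least `‖x‖/2`, where `g ≤ a`, or the displacement, hence the total
length, is at least `‖x‖/2`. In the latter case the exponential weight can be inserted at the price
`exp(-c‖x‖/2)`, after which the big jump estimate applies. -/
lemma lintegral_jumpMeasure_le (hc : 0 ≤ c) {g : V → ℝ≥0∞} (hg : Measurable g)
    {b : ℝ → ℝ≥0∞} {L : ℝ≥0∞}
    (hM : ∫⁻ y, ENNReal.ofReal (rexp (c * ‖y‖)) ∂Λ ≤ M) (hM1 : 1 ≤ M) (hL1 : 1 ≤ L)
    (hb : ∀ w : V, ∀ R : ℝ, 0 < R → ∫⁻ y, {y : V | R ≤ ‖y‖}.indicator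
      (fun y ↦ g (w - y) * ENNReal.ofReal (rexp (c * ‖y‖))) y ∂Λ ≤ b R)
    (hbL : ∀ R : ℝ, 0 < R → b (R / 2) ≤ L * b R) (n : ℕ) {x : V} (hx : x ≠ 0) {a : ℝ≥0∞}
    (ha : ∀ u : V, ‖x‖ / 2 ≤ ‖u‖ → g u ≤ a) :
    ∫⁻ p, g (x - p.1) ∂(jumpMeasure Λ n) ≤
      M ^ n * a + (2 * (L * M)) ^ n * (ENNReal.ofReal (rexp (-(c * (‖x‖ / 2)))) * (L * b ‖x‖)) := by
  have hx0 : 0 < ‖x‖ := norm_pos_iff.2 hx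
  have hmeas : Measurable ({p : V × ℝ | ‖x‖ / 2 ≤ p.2}.indicator
      (fun p ↦ g (x - p.1) * ENNReal.ofReal (rexp (c * p.2)))) :=
    Measurable.indicator (by fun_prop) (measurableSet_le (by fun_prop) (by fun_prop))
  have hpt : ∀ᵐ p ∂(jumpMeasure Λ n), g (x - p.1) ≤ ENNReal.ofReal (rexp (c * p.2)) * a +
      ENNReal.ofReal (rexp (-(c * (‖x‖ / 2)))) * {p : V × ℝ | ‖x‖ / 2 ≤ p.2}.indicator
      (fun p ↦ g (x - p.1) * ENNReal.ofReal (rexp (c * p.2))) p := by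
    filter_upwards [ae_jumpMeasure_norm_le Λ n] with p hp
    have hp0 : 0 ≤ p.2 := (norm_nonneg _).trans hp
    rcases le_total (‖x‖ / 2) ‖x - p.1‖ with h | h
    · refine le_add_right ((ha _ h).trans ?_)
      refine le_mul_of_one_le_left zero_le ?_
      rw [← ENNReal.ofReal_one]
      exact ENNReal.ofReal_le_ofReal (Real.one_le_exp (by positivity))
    · refine le_add_left ?_
      have h1 : ‖x‖ ≤ ‖x - p.1‖ + ‖p.1‖ := by
        simpa using norm_add_le (x - p.1) p.1
      have h2 : ‖x‖ / 2 ≤ p.2 := by linarith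
      rw [Set.indicator_of_mem (by exact h2), mul_comm, mul_assoc]
      refine le_mul_of_one_le_right zero_le ?_
      rw [← ENNReal.ofReal_mul (exp_pos _).le, ← Real.exp_add, ← ENNReal.ofReal_one]
      refine ENNReal.ofReal_le_ofReal (Real.one_le_exp ?_)
      have := mul_le_mul_of_nonneg_left h2 hc
      linarith
  refine (lintegral_mono_ae hpt).trans ?_
  rw [lintegral_add_left (by fun_prop), lintegral_mul_const _ (by fun_prop),
    lintegral_const_mul _ hmeas]
  have h1 := lintegral_exp_jumpMeasure_le Λ hM n
  have h2 := lintegral_big_jumpMeasure_le Λ hg hM hM1 hL1 hb hbL n x (‖x‖ / 2) (by linarith)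
  have h3 := hbL ‖x‖ hx0
  calc _ ≤ M ^ n * a + ENNReal.ofReal (rexp (-(c * (‖x‖ / 2)))) *
        ((2 * (L * M)) ^ n * (L * b ‖x‖)) := by
        gcongr; exact h2.trans (by gcongr)
    _ = _ := by ring

end CompoundPoisson

/-! ### Combining small and large jumps. -/

section InversionBound

open Filter Topology Real
open scoped RealInnerProductSpace ENNReal

lemma smallJumpProfile_nonneg (M u : ℝ) : 0 ≤ smallJumpProfile M u := (exp_pos _).le

lemma smallJumpProfile_anti {M u v : ℝ} (hM : 0 < M) (hu : 0 ≤ u) (huv : u ≤ v) :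
    smallJumpProfile M v ≤ smallJumpProfile M u := by
  unfold smallJumpProfile
  have h0 : 0 ≤ u / (2 * M) := by positivity
  have h1 : u / (2 * M) ≤ v / (2 * M) := by gcongr
  have h2 : Real.log (1 + u / (2 * M)) ≤ Real.log (1 + v / (2 * M)) := by gcongr
  have h3 := Real.log_nonneg (by linarith : 1 ≤ 1 + u / (2 * M))
  have h4 : u / 4 * Real.log (1 + u / (2 * M)) ≤ v / 4 * Real.log (1 + v / (2 * M)) := by
    gcongr
    linarith
  rw [Real.exp_le_exp]
  linarith

/-- Once the logarithm exceeds `4l` the decay is at least `e^(-l u)`; before that `u ≤ 2M e^(4l)`,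
and the constant makes up the difference. -/
lemma smallJumpProfile_le_exp {M : ℝ} (hM : 0 < M) (l : ℝ) (hl : 0 ≤ l) :
    ∃ C : ℝ, 0 < C ∧ ∀ u : ℝ, 0 ≤ u → smallJumpProfile M u ≤ C * rexp (-l * u) := by
  refine ⟨rexp (l * (2 * M * rexp (4 * l))), exp_pos _, fun u hu ↦ ?_⟩
  unfold smallJumpProfile
  rw [← Real.exp_add]
  gcongr
  have h0 : 0 ≤ u / (2 * M) := by positivity
  have hlog := Real.log_nonneg (by linarith : 1 ≤ 1 + u / (2 * M))
  rcases le_total (4 * l) (Real.log (1 + u / (2 * M))) with h | h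
  · have := mul_le_mul_of_nonneg_left h (by positivity : 0 ≤ u / 4)
    have : 0 ≤ l * (2 * M * rexp (4 * l)) := by positivity
    linarith
  · have h1 : 1 + u / (2 * M) ≤ rexp (4 * l) := (Real.log_le_iff_le_exp (by linarith)).1 h
    have h2 : u ≤ 2 * M * rexp (4 * l) := by
      have h3 : u / (2 * M) ≤ rexp (4 * l) := by linarith
      rw [div_le_iff₀ (by positivity)] at h3
      linarith
    have := mul_le_mul_of_nonneg_left h2 hl
    have : 0 ≤ u / 4 * Real.log (1 + u / (2 * M)) := by positivity
    linarith

lemma measurable_smallJumpProfile (M : ℝ) : Measurable (smallJumpProfile M) := by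
  unfold smallJumpProfile; fun_prop

lemma lintegral_exp_neg_Ioi {u : ℝ} (hu : 0 ≤ u) :
    ∫⁻ ρ in Set.Ioi (0 : ℝ), (Set.Ioi u).indicator (fun ρ ↦ ENNReal.ofReal (rexp (-ρ))) ρ =
      ENNReal.ofReal (rexp (-u)) := by
  rw [lintegral_indicator measurableSet_Ioi, Measure.restrict_restrict measurableSet_Ioi,
    Set.inter_eq_left.2 (Set.Ioi_subset_Ioi hu),
    ← ofReal_integral_eq_lintegral_ofReal (integrableOn_exp_neg_Ioi u)
      (Eventually.of_forall fun _ ↦ (exp_pos _).le), integral_exp_neg_Ioi]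

lemma lintegral_exp_neg_mul_rpow {γ : ℝ} (hγ : 0 < γ) :
    ∫⁻ ρ in Set.Ioi (0 : ℝ), ENNReal.ofReal (rexp (-ρ) * ρ ^ γ) =
      ENNReal.ofReal (Real.Gamma (γ + 1)) := by
  have h1 := Real.GammaIntegral_convergent (s := γ + 1) (by linarith)
  rw [Real.Gamma_eq_integral (by linarith), ofReal_integral_eq_lintegral_ofReal h1]
  · simp
  · filter_upwards [ae_restrict_mem measurableSet_Ioi] with ρ hρ
    have : (0 : ℝ) < ρ := hρ
    positivity

variable {V : Type*} [NormedAddCommGroup V] [InnerProductSpace ℝ V] [FiniteDimensional ℝ V]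
  [MeasurableSpace V] [BorelSpace V]

/-- Bounds on a finite measure of large jumps with exponential moments: total mass, and mass of
balls away from the origin. -/
structure LargeJumpBounds (Λ : Measure V) (α γ c M B : ℝ) : Prop where
  nonneg : 0 ≤ B
  lintegral_exp_le : ∫⁻ y, ENNReal.ofReal (rexp (c * ‖y‖)) ∂Λ ≤ ENNReal.ofReal M
  lintegral_ball_le : ∀ (w : V) (ρ R : ℝ), 0 < ρ → 0 < R →
    ∫⁻ y, (Metric.ball w ρ ∩ {y | R ≤ ‖y‖}).indicator
      (fun y ↦ ENNReal.ofReal (rexp (c * ‖y‖))) y ∂Λ ≤ ENNReal.ofReal (B * ρ ^ γ * R ^ (-γ - α))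

/-- Layer cake: since `e^(-u)` is the integral of `e^(-ρ)` over `ρ > u`, the profile is dominated by
a mixture of indicators of balls of radius `ρ h` about `w`. The ball bound is then integrated
against `e^(-ρ)`, and `ρ^γ` produces `Γ(γ + 1)`. -/
lemma LargeJumpBounds.lintegral_profile_le {Λ : Measure V} [IsFiniteMeasure Λ]
    {α γ c M B h M' C : ℝ} (H : LargeJumpBounds Λ α γ c M B) (hγ : 0 < γ) (hh : 0 < h)
    (hC : 0 < C) (hprof : ∀ u : ℝ, 0 ≤ u → smallJumpProfile M' u ≤ C * rexp (-1 * u))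
    (w : V) {R : ℝ} (hR : 0 < R) :
    ∫⁻ y, {y : V | R ≤ ‖y‖}.indicator (fun y ↦ ENNReal.ofReal (smallJumpProfile M' (‖w - y‖ / h)) *
        ENNReal.ofReal (rexp (c * ‖y‖))) y ∂Λ ≤
      ENNReal.ofReal (C * Real.Gamma (γ + 1) * (B * h ^ γ) * R ^ (-γ - α)) := by
  have hB := H.nonneg
  have hset : MeasurableSet {y : V | R ≤ ‖y‖} := measurableSet_le (by fun_prop) (by fun_prop)
  set F : V → ℝ → ℝ≥0∞ := fun y ρ ↦ (Metric.ball w (ρ * h) ∩ {y | R ≤ ‖y‖}).indicator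
      (fun y ↦ ENNReal.ofReal (rexp (c * ‖y‖))) y * ENNReal.ofReal (C * rexp (-ρ)) with hF
  have hFm : Measurable (Function.uncurry F) := by
    have h1 : Function.uncurry F = fun q : V × ℝ ↦
        ({q : V × ℝ | dist q.1 w < q.2 * h} ∩ {q : V × ℝ | R ≤ ‖q.1‖}).indicator
        (fun q ↦ ENNReal.ofReal (rexp (c * ‖q.1‖))) q * ENNReal.ofReal (C * rexp (-q.2)) := by
      ext q
      simp [hF, Function.uncurry, Set.indicator]
    rw [h1]
    refine Measurable.mul (Measurable.indicator (by fun_prop) ?_) (by fun_prop)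
    exact (measurableSet_lt (by fun_prop) (by fun_prop)).inter
      (measurableSet_le (by fun_prop) (by fun_prop))
  have hpt : ∀ y, {y : V | R ≤ ‖y‖}.indicator
      (fun y ↦ ENNReal.ofReal (smallJumpProfile M' (‖w - y‖ / h)) *
        ENNReal.ofReal (rexp (c * ‖y‖))) y ≤ ∫⁻ ρ in Set.Ioi (0 : ℝ), F y ρ := by
    intro y
    by_cases hy : R ≤ ‖y‖
    · rw [Set.indicator_of_mem (by exact hy)]
      have h1 : ∀ ρ, F y ρ = ENNReal.ofReal (rexp (c * ‖y‖)) * ENNReal.ofReal C *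
          (Set.Ioi (‖w - y‖ / h)).indicator (fun ρ ↦ ENNReal.ofReal (rexp (-ρ))) ρ := by
        intro ρ
        simp only [hF, Set.indicator, Set.mem_inter_iff, Metric.mem_ball, Set.mem_ofPred_eq, hy,
          and_true, Set.mem_Ioi, div_lt_iff₀ hh, dist_eq_norm, norm_sub_rev y w]
        split_ifs
        · rw [ENNReal.ofReal_mul hC.le, mul_assoc]
        · simp
      simp_rw [h1]
      rw [lintegral_const_mul _ (Measurable.indicator (by fun_prop) measurableSet_Ioi),
        lintegral_exp_neg_Ioi (by positivity), mul_comm, mul_assoc, ← ENNReal.ofReal_mul hC.le]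
      gcongr
      simpa using hprof (‖w - y‖ / h) (by positivity)
    · rw [Set.indicator_of_notMem (by exact hy)]; exact zero_le
  refine (lintegral_mono hpt).trans ?_
  rw [lintegral_lintegral_swap hFm.aemeasurable]
  calc _ ≤ ∫⁻ ρ in Set.Ioi (0 : ℝ), ENNReal.ofReal (C * (B * h ^ γ) * R ^ (-γ - α)) *
        ENNReal.ofReal (rexp (-ρ) * ρ ^ γ) := by
        refine setLIntegral_mono' measurableSet_Ioi fun ρ hρ ↦ ?_
        have hρ0 : (0 : ℝ) < ρ := hρ
        simp only [hF]
        rw [lintegral_mul_const _ (Measurable.indicator (by fun_prop)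
          (Metric.isOpen_ball.measurableSet.inter hset))]
        refine (mul_le_mul_left (H.lintegral_ball_le w (ρ * h) R (by positivity) hR) _).trans ?_
        rw [← ENNReal.ofReal_mul (by positivity), ← ENNReal.ofReal_mul (by positivity)]
        apply ENNReal.ofReal_le_ofReal
        rw [mul_rpow hρ0.le hh.le]
        apply le_of_eq
        ring
    _ = _ := by
        rw [lintegral_const_mul _ (by fun_prop), lintegral_exp_neg_mul_rpow hγ,
          ← ENNReal.ofReal_mul (by positivity)]
        congr 1
        ring

/-- The Fourier inversion integral for small jumps `N` and compound Poisson large jumps `Λ`. -/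
noncomputable def inversionIntegral (N Λ : Measure V) (x : V) : ℂ :=
  ∫ ξ, Complex.exp (-(⟪ξ, x⟫ : ℝ) * Complex.I) * (Complex.exp (smallExponent N ξ 0 0) *
    Complex.exp (∫ y, Complex.exp (Complex.I * (⟪ξ, y⟫ : ℝ)) ∂Λ))

lemma norm_integral_cexp_le (Λ : Measure V) (ξ : V) :
    ‖∫ y, Complex.exp (Complex.I * (⟪ξ, y⟫ : ℝ)) ∂Λ‖ ≤ Λ.real Set.univ := by
  refine (norm_integral_le_integral_norm _).trans_eq ?_
  simp [Complex.norm_exp]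

lemma continuous_integral_cexp (Λ : Measure V) [IsFiniteMeasure Λ] :
    Continuous fun ξ : V ↦ ∫ y, Complex.exp (Complex.I * (⟪ξ, y⟫ : ℝ)) ∂Λ := by
  have : (fun ξ : V ↦ ∫ y, Complex.exp (Complex.I * (⟪ξ, y⟫ : ℝ)) ∂Λ) = charFun Λ := by
    ext ξ
    rw [charFun_apply]
    congr 1; ext y; rw [real_inner_comm, mul_comm]
  rw [this]
  exact continuous_charFun

/-- The `n`-th power of the transform of `Λ` is an integral over sums of `n` jumps; Fubini is
justified by integrability of the small jump characteristic function. -/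
lemma integral_mul_pow_eq [Nontrivial V] {N Λ : Measure V} [SFinite N] [IsFiniteMeasure Λ]
    {α h κ M : ℝ} (H : SmallJumpBounds N α h κ M) (x : V) (n : ℕ) :
    ∫ ξ, Complex.exp (-(⟪ξ, x⟫ : ℝ) * Complex.I) * (Complex.exp (smallExponent N ξ 0 0) *
      (∫ y, Complex.exp (Complex.I * (⟪ξ, y⟫ : ℝ)) ∂Λ) ^ n) =
      ∫ p, smallJumpDensity N (x - p.1) ∂(jumpMeasure Λ n) := by
  have hint := H.integrable_exp_smallExponent
  unfold smallJumpDensity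
  rw [integral_integral_swap]
  · congr 1
    ext ξ
    rw [← integral_cexp_jumpMeasure, ← integral_const_mul, ← integral_const_mul]
    congr 1
    ext p
    rw [inner_sub_right, mul_comm (Complex.exp (smallExponent N ξ 0 0)),
      ← mul_assoc, ← Complex.exp_add]
    congr 2
    push_cast
    ring
  · have h2 : Integrable (fun q : (V × ℝ) × V ↦ Complex.exp (smallExponent N q.2 0 0))
        ((jumpMeasure Λ n).prod volume) := hint.comp_snd _
    refine h2.mono (AEStronglyMeasurable.mul (Continuous.aestronglyMeasurable (by fun_prop)) h2.1)
      (Eventually.of_forall fun p ↦ ?_)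
    simp only [Function.uncurry, norm_mul]
    rw [Complex.norm_exp, ← Complex.ofReal_neg, Complex.re_ofReal_mul]
    simp

/-- The exponential series may be integrated termwise because the transform of `Λ` is bounded by its
finite mass `m`, so the terms are dominated by `m^n/n!` times an integrable function. -/
lemma hasSum_inversionIntegral [Nontrivial V] {N Λ : Measure V} [SFinite N] [IsFiniteMeasure Λ]
    {α h κ M : ℝ} (H : SmallJumpBounds N α h κ M) (x : V) :
    HasSum (fun n : ℕ ↦ ((n.factorial : ℂ)⁻¹) *
      ∫ p, smallJumpDensity N (x - p.1) ∂(jumpMeasure Λ n)) (inversionIntegral N Λ x) := by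
  have hint := H.integrable_exp_smallExponent
  set m := Λ.real Set.univ with hm
  set F : ℕ → V → ℂ := fun n ξ ↦ ((n.factorial : ℂ)⁻¹) *
    (Complex.exp (-(⟪ξ, x⟫ : ℝ) * Complex.I) * (Complex.exp (smallExponent N ξ 0 0) *
      (∫ y, Complex.exp (Complex.I * (⟪ξ, y⟫ : ℝ)) ∂Λ) ^ n)) with hF
  have hbd : ∀ n ξ, ‖F n ξ‖ ≤ ((n.factorial : ℝ)⁻¹ * m ^ n) *
      ‖Complex.exp (smallExponent N ξ 0 0)‖ := by
    intro n ξ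
    have h1 : ‖Complex.exp (-(⟪ξ, x⟫ : ℝ) * Complex.I)‖ = 1 := by
      rw [Complex.norm_exp, ← Complex.ofReal_neg, Complex.re_ofReal_mul]; simp
    simp only [hF, norm_mul, norm_inv, Complex.norm_natCast, norm_pow, h1, one_mul]
    have := norm_integral_cexp_le Λ ξ
    calc _ ≤ (n.factorial : ℝ)⁻¹ * (‖Complex.exp (smallExponent N ξ 0 0)‖ * m ^ n) := by gcongr
      _ = _ := by ring
  have hmeas : ∀ n, AEStronglyMeasurable (F n) volume := by
    intro n
    have := continuous_integral_cexp Λ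
    refine (AEStronglyMeasurable.mul (Continuous.aestronglyMeasurable (by fun_prop))
      (hint.1.mul (Continuous.aestronglyMeasurable (by fun_prop)))).const_mul _
  have hFint : ∀ n, Integrable (F n) := fun n ↦
    (hint.norm.const_mul _).mono' (hmeas n) (Eventually.of_forall (hbd n))
  have hsum : Summable fun n ↦ ∫ ξ, ‖F n ξ‖ := by
    have h1 : Summable fun n : ℕ ↦ ((n.factorial : ℝ)⁻¹ * m ^ n) *
        ∫ ξ, ‖Complex.exp (smallExponent N ξ 0 0)‖ := by
      refine Summable.mul_right _ ?_
      simpa [div_eq_inv_mul] using Real.summable_pow_div_factorial m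
    refine h1.of_nonneg_of_le (fun n ↦ integral_nonneg fun _ ↦ norm_nonneg _) fun n ↦ ?_
    rw [← integral_const_mul]
    exact integral_mono (hFint n).norm (hint.norm.const_mul _) (hbd n)
  have := hasSum_integral_of_summable_integral_norm hFint hsum
  have hF' : ∀ n, ∫ ξ, F n ξ = ((n.factorial : ℂ)⁻¹) *
      ∫ p, smallJumpDensity N (x - p.1) ∂(jumpMeasure Λ n) := fun n ↦ by
    rw [integral_const_mul, integral_mul_pow_eq H]
  simp_rw [hF'] at this
  have hlim : ∫ ξ, ∑' n, F n ξ = inversionIntegral N Λ x := by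
    unfold inversionIntegral
    congr 1
    ext ξ
    simp only [hF]
    have h2 := (NormedSpace.expSeries_div_hasSum_exp
      (∫ y, Complex.exp (Complex.I * (⟪ξ, y⟫ : ℝ)) ∂Λ)).tsum_eq
    rw [← Complex.exp_eq_exp_ℂ] at h2
    rw [← h2, ← tsum_mul_left, ← tsum_mul_left]
    congr 1
    ext n
    rw [div_eq_inv_mul]
    ring
  rwa [hlim] at this

lemma norm_inversionIntegral_le [Nontrivial V] {N Λ : Measure V} [SFinite N] [IsFiniteMeasure Λ]
    {α h κ M : ℝ} (H : SmallJumpBounds N α h κ M) (x : V) :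
    ‖inversionIntegral N Λ x‖ ≤ rexp (Λ.real Set.univ) * (rexp κ *
      (κ ^ (-(Module.finrank ℝ V : ℝ) / α) * ∫ ξ : V, rexp (-‖ξ‖ ^ α))) *
        (h ^ Module.finrank ℝ V)⁻¹ := by
  have hbd : ∀ ξ : V, ‖Complex.exp (-(⟪ξ, x⟫ : ℝ) * Complex.I) *
      (Complex.exp (smallExponent N ξ 0 0) *
        Complex.exp (∫ y, Complex.exp (Complex.I * (⟪ξ, y⟫ : ℝ)) ∂Λ))‖ ≤
      rexp (Λ.real Set.univ) * rexp κ * rexp (-(κ * (h * ‖ξ‖) ^ α)) := by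
    intro ξ
    have h1 : ‖Complex.exp (-(⟪ξ, x⟫ : ℝ) * Complex.I)‖ = 1 := by
      rw [Complex.norm_exp, ← Complex.ofReal_neg, Complex.re_ofReal_mul]; simp
    have h2 := H.norm_exp_smallExponent_le ξ
    have h3 : ‖Complex.exp (∫ y, Complex.exp (Complex.I * (⟪ξ, y⟫ : ℝ)) ∂Λ)‖ ≤
        rexp (Λ.real Set.univ) := by
      rw [Complex.norm_exp]
      gcongr
      exact (Complex.re_le_norm _).trans (norm_integral_cexp_le Λ ξ)
    rw [norm_mul, norm_mul, h1, one_mul]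
    calc _ ≤ (rexp κ * rexp (-(κ * (h * ‖ξ‖) ^ α))) * rexp (Λ.real Set.univ) := by gcongr
      _ = _ := by ring
  refine (norm_integral_le_of_norm_le ((integrable_exp_neg_mul_norm_rpow (V := V) H.α_pos H.h_pos
    H.κ_pos).const_mul _) (Eventually.of_forall hbd)).trans_eq ?_
  rw [integral_const_mul, integral_exp_neg_mul_norm_rpow H.α_pos H.h_pos H.κ_pos]
  ring

lemma LargeJumpBounds.real_univ_le {Λ : Measure V} [IsFiniteMeasure Λ] {α γ c M B : ℝ}
    (H : LargeJumpBounds Λ α γ c M B) (hc : 0 ≤ c) (hM : 0 ≤ M) : Λ.real Set.univ ≤ M := by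
  have h1 : Λ Set.univ ≤ ENNReal.ofReal M := by
    refine le_trans ?_ H.lintegral_exp_le
    rw [← lintegral_one]
    refine lintegral_mono fun y ↦ ?_
    rw [← ENNReal.ofReal_one]
    exact ENNReal.ofReal_le_ofReal (Real.one_le_exp (by positivity))
  exact ENNReal.toReal_le_of_le_ofReal hM h1

/-- Bounds for the inversion integral, uniform over all jump measures with given constants. -/
theorem exists_norm_inversionIntegral_le (V : Type*) [NormedAddCommGroup V] [InnerProductSpace ℝ V]
    [FiniteDimensional ℝ V] [MeasurableSpace V] [BorelSpace V] [Nontrivial V] {α κ M γ c : ℝ}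
    (hα : 0 < α) (hκ : 0 < κ) (hM : 1 ≤ M) (hγ : 0 < γ) (hc : 0 ≤ c) :
    ∃ K : ℝ, 0 < K ∧ ∀ (N Λ : Measure V) (h B : ℝ) [SFinite N] [IsFiniteMeasure Λ],
      SmallJumpBounds N α h κ M → LargeJumpBounds Λ α γ c M B →
      ∀ x, ‖inversionIntegral N Λ x‖ ≤ K * (h ^ Module.finrank ℝ V)⁻¹ ∧
        (x ≠ 0 → ‖inversionIntegral N Λ x‖ ≤ K * (h ^ Module.finrank ℝ V)⁻¹ *
          (smallJumpProfile M (‖x‖ / 2 / h) +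
            B * h ^ γ * ‖x‖ ^ (-γ - α) * rexp (-(c * (‖x‖ / 2))))) := by
  have hM0 : 0 < M := by linarith
  obtain ⟨K₁, hK₁, hD⟩ := exists_norm_smallJumpDensity_le V hα hκ hM0
  obtain ⟨C, hC, hprof⟩ := smallJumpProfile_le_exp hM0 1 zero_le_one
  have hI : 0 < ∫ ξ : V, rexp (-‖ξ‖ ^ α) := integral_exp_pos (integrable_exp_neg_norm_rpow hα)
  have hΓ : 0 < Real.Gamma (γ + 1) := Real.Gamma_pos_of_pos (by linarith)
  -- Exactly the factor gained by `R^(-γ-α)` when `R` is halved.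
  set L : ℝ := 2 ^ (γ + α) with hL
  have hL1 : 1 ≤ L := Real.one_le_rpow (by norm_num) (by linarith)
  set K₂ := rexp M * (rexp κ *
      (κ ^ (-(Module.finrank ℝ V : ℝ) / α) * ∫ ξ : V, rexp (-‖ξ‖ ^ α))) with hK₂
  set K₃ := K₁ * (rexp M + rexp (2 * (L * M)) * (L * (C * Real.Gamma (γ + 1)))) with hK₃
  have hK₂0 : 0 < K₂ := by positivity
  have hK₃0 : 0 < K₃ := by positivity
  refine ⟨K₂ + K₃, by positivity, fun N Λ h B _ _ HN HΛ x ↦ ⟨?_, fun hx ↦ ?_⟩⟩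
  · have hh := HN.h_pos
    refine (norm_inversionIntegral_le HN x).trans ?_
    have := HΛ.real_univ_le hc hM0.le
    calc _ ≤ K₂ * (h ^ Module.finrank ℝ V)⁻¹ := by rw [hK₂]; gcongr
      _ ≤ _ := by gcongr; linarith
  have hh := HN.h_pos
  have hB := HΛ.nonneg
  have hx0 : 0 < ‖x‖ := norm_pos_iff.2 hx
  set H := (h ^ Module.finrank ℝ V)⁻¹ with hH
  have hH0 : 0 < H := by positivity
  set a := smallJumpProfile M (‖x‖ / 2 / h) with ha
  have ha0 : 0 ≤ a := smallJumpProfile_nonneg _ _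
  set b := rexp (-(c * (‖x‖ / 2))) * (L * (C * Real.Gamma (γ + 1) * (B * h ^ γ) *
    ‖x‖ ^ (-γ - α))) with hb
  have hb0 : 0 ≤ b := by positivity
  have hn : ∀ n, ‖∫ p, smallJumpDensity N (x - p.1) ∂(jumpMeasure Λ n)‖ ≤
      K₁ * H * (M ^ n * a + (2 * (L * M)) ^ n * b) := by
    intro n
    have h1 : ‖∫ p, smallJumpDensity N (x - p.1) ∂(jumpMeasure Λ n)‖ₑ ≤
        ENNReal.ofReal (K₁ * H) * ∫⁻ p, ENNReal.ofReal (smallJumpProfile M (‖x - p.1‖ / h))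
          ∂(jumpMeasure Λ n) := by
      refine (enorm_integral_le_lintegral_enorm _).trans ?_
      have hm := measurable_smallJumpProfile M
      rw [← lintegral_const_mul _ (by fun_prop)]
      refine lintegral_mono fun p ↦ ?_
      rw [← ENNReal.ofReal_mul (by positivity), ← ofReal_norm]
      exact ENNReal.ofReal_le_ofReal (hD N h HN _)
    have h2 := lintegral_jumpMeasure_le Λ (c := c) (M := ENNReal.ofReal M) hc
      (g := fun u ↦ ENNReal.ofReal (smallJumpProfile M (‖u‖ / h)))
      (ENNReal.measurable_ofReal.comp ((measurable_smallJumpProfile M).comp (by fun_prop)))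
      (b := fun R ↦ ENNReal.ofReal (C * Real.Gamma (γ + 1) * (B * h ^ γ) * R ^ (-γ - α)))
      (L := ENNReal.ofReal L) HΛ.lintegral_exp_le (by simpa using hM) (by simpa using hL1)
      (fun w R hR ↦ HΛ.lintegral_profile_le hγ hh hC hprof w hR)
      (fun R hR ↦ by
        rw [← ENNReal.ofReal_mul (by positivity)]
        apply ENNReal.ofReal_le_ofReal
        rw [div_rpow hR.le (by norm_num), hL, show -γ - α = -(γ + α) by ring,
          rpow_neg (by norm_num : (0 : ℝ) ≤ 2)]
        apply le_of_eq
        field_simp) n hx (a := ENNReal.ofReal a) (fun u hu ↦ ENNReal.ofReal_le_ofReal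
          (smallJumpProfile_anti hM0 (by positivity) (by gcongr)))
    have h3 : ‖∫ p, smallJumpDensity N (x - p.1) ∂(jumpMeasure Λ n)‖ₑ ≤
        ENNReal.ofReal (K₁ * H * (M ^ n * a + (2 * (L * M)) ^ n * b)) := by
      refine h1.trans ((mul_le_mul_right h2 _).trans_eq ?_)
      rw [ENNReal.ofReal_mul (p := K₁ * H) (by positivity), ENNReal.ofReal_add (by positivity)
        (by positivity), ENNReal.ofReal_mul (p := M ^ n) (by positivity), ENNReal.ofReal_pow hM0.le,
        ENNReal.ofReal_mul (p := (2 * (L * M)) ^ n) (by positivity),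
        ENNReal.ofReal_pow (by positivity), ENNReal.ofReal_mul (p := 2) (by positivity),
        ENNReal.ofReal_mul (p := L) (by positivity), hb, ENNReal.ofReal_mul (exp_pos _).le,
        ENNReal.ofReal_mul (p := L) (by positivity)]
      simp
    rw [← ofReal_norm] at h3
    exact (ENNReal.ofReal_le_ofReal_iff (by positivity)).1 h3
  -- The geometric factors `M^n` and `(2LM)^n` sum against `1/n!` to exponentials that depend only
  -- on the fixed constants.
  have hsum : HasSum (fun n : ℕ ↦ (n.factorial : ℝ)⁻¹ *
      (K₁ * H * (M ^ n * a + (2 * (L * M)) ^ n * b)))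
      (K₁ * H * (rexp M * a + rexp (2 * (L * M)) * b)) := by
    have e : ∀ r : ℝ, HasSum (fun n : ℕ ↦ r ^ n / n.factorial) (rexp r) := fun r ↦ by
      rw [Real.exp_eq_exp_ℝ]; exact NormedSpace.expSeries_div_hasSum_exp r
    have h1 := (((e M).mul_right a).add ((e (2 * (L * M))).mul_right b)).mul_left (K₁ * H)
    refine h1.congr_fun fun n ↦ ?_
    ring
  have htot : ‖inversionIntegral N Λ x‖ ≤ K₁ * H * (rexp M * a + rexp (2 * (L * M)) * b) := by
    refine (hasSum_inversionIntegral HN x).norm_le_of_bounded hsum fun n ↦ ?_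
    rw [norm_mul, norm_inv, Complex.norm_natCast]
    gcongr
    exact hn n
  refine htot.trans ?_
  set T := B * h ^ γ * ‖x‖ ^ (-γ - α) * rexp (-(c * (‖x‖ / 2))) with hT
  have hT0 : 0 ≤ T := by positivity
  have hbT : b = L * (C * Real.Gamma (γ + 1)) * T := by rw [hb, hT]; ring
  calc K₁ * H * (rexp M * a + rexp (2 * (L * M)) * b)
      = H * (K₁ * rexp M * a + K₁ * (rexp (2 * (L * M)) * (L * (C * Real.Gamma (γ + 1)))) * T) := by
        rw [hbT]; ring
    _ ≤ H * ((K₂ + K₃) * a + (K₂ + K₃) * T) := by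
        have e1 : 0 ≤ K₁ * (rexp (2 * (L * M)) * (L * (C * Real.Gamma (γ + 1)))) := by positivity
        have e2 : 0 ≤ K₁ * rexp M := by positivity
        gcongr <;> rw [hK₃] <;> linarith
    _ = _ := by ring

end InversionBound

/-! ### Splitting the Lévy–Khintchine exponent at jump size `h`. -/

section Decomposition

open Filter Topology Real
open scoped RealInnerProductSpace ENNReal

variable {d : ℕ} {ν : Measure (EuclideanSpace ℝ (Fin d))}

/-- The jumps of size less than `h` of the Lévy measure `ν`, up to time `t`. -/
noncomputable def smallJumps (ν : Measure (EuclideanSpace ℝ (Fin d))) (t h : ℝ) :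
    Measure (EuclideanSpace ℝ (Fin d)) :=
  ENNReal.ofReal t • ν.restrict (Metric.ball 0 h)

/-- The jumps of size at least `h` of the Lévy measure `ν`, up to time `t`. -/
noncomputable def largeJumps (ν : Measure (EuclideanSpace ℝ (Fin d))) (t h : ℝ) :
    Measure (EuclideanSpace ℝ (Fin d)) :=
  ENNReal.ofReal t • ν.restrict (Metric.ball 0 h)ᶜ

lemma measurableSet_annulus (r R : ℝ) :
    MeasurableSet {y : EuclideanSpace ℝ (Fin d) | r < ‖y‖ ∧ ‖y‖ < R} := by
  have h : MeasurableSet ({y : EuclideanSpace ℝ (Fin d) | r < ‖y‖} ∩ {y | ‖y‖ < R}) :=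
    (measurableSet_lt (by fun_prop) (by fun_prop)).inter
      (measurableSet_lt (by fun_prop) (by fun_prop))
  exact h

lemma integrableOn_norm_annulus (hfin : ∀ r : ℝ, 0 < r → ν {y | r ≤ ‖y‖} < ∞) {r R : ℝ}
    (hr : 0 < r) : IntegrableOn (fun y ↦ y) {y | r < ‖y‖ ∧ ‖y‖ < R} ν := by
  have hset := measurableSet_annulus (d := d) r R
  refine IntegrableOn.of_bound (C := R) ?_ (by fun_prop) ?_
  · exact (measure_mono fun y hy ↦ hy.1.le).trans_lt (hfin r hr)
  · filter_upwards [ae_restrict_mem hset] with y hy using hy.2.le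

/-- Differences of indicators of open balls give annuli containing their inner sphere, whereas the
drift is defined with that sphere removed; the two agree because `ν` does not charge spheres. -/
lemma integral_inner_annulus (hfin : ∀ r : ℝ, 0 < r → ν {y | r ≤ ‖y‖} < ∞)
    (hnull : ∀ r : ℝ, 0 < r → ν {y | ‖y‖ = r} = 0) {r R : ℝ} (hr : 0 < r)
    (ξ : EuclideanSpace ℝ (Fin d)) :
    Integrable ({y | r ≤ ‖y‖ ∧ ‖y‖ < R}.indicator fun y ↦ Complex.I * ((⟪ξ, y⟫ : ℝ) : ℂ)) ν ∧
    ∫ y, {y | r ≤ ‖y‖ ∧ ‖y‖ < R}.indicator (fun y ↦ Complex.I * ((⟪ξ, y⟫ : ℝ) : ℂ)) y ∂ν =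
      Complex.I * ((⟪ξ, ∫ y in {y | r < ‖y‖ ∧ ‖y‖ < R}, y ∂ν⟫ : ℝ) : ℂ) := by
  have hset := measurableSet_annulus (d := d) r R
  have hint := integrableOn_norm_annulus (R := R) hfin hr
  have hae : ({y | r ≤ ‖y‖ ∧ ‖y‖ < R}.indicator fun y ↦ Complex.I * ((⟪ξ, y⟫ : ℝ) : ℂ)) =ᵐ[ν]
      ({y | r < ‖y‖ ∧ ‖y‖ < R}.indicator fun y ↦ Complex.I * ((⟪ξ, y⟫ : ℝ) : ℂ)) := by
    have h1 : ∀ᵐ y ∂ν, ‖y‖ ≠ r := by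
      rw [ae_iff]; simpa using hnull r hr
    filter_upwards [h1] with y hy
    have : r ≤ ‖y‖ ↔ r < ‖y‖ := ⟨fun h ↦ lt_of_le_of_ne h (Ne.symm hy), le_of_lt⟩
    simp [Set.indicator, this]
  have hint2 : IntegrableOn (fun y ↦ Complex.I * ((⟪ξ, y⟫ : ℝ) : ℂ))
      {y | r < ‖y‖ ∧ ‖y‖ < R} ν := ((hint.const_inner ξ).ofReal (𝕜 := ℂ)).const_mul Complex.I
  refine ⟨((integrable_indicator_iff hset).2 hint2).congr hae.symm, ?_⟩
  rw [integral_congr_ae hae, integral_indicator hset, integral_const_mul]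
  congr 1
  rw [integral_complex_ofReal, integral_inner hint]

/-- Splitting of the characteristic exponent at jump size `h`. -/
lemma charExponent_decomposition {α t h κ M : ℝ} (ht : 0 < t)
    (hfin : ∀ r : ℝ, 0 < r → ν {y | r ≤ ‖y‖} < ∞)
    (hnull : ∀ r : ℝ, 0 < r → ν {y | ‖y‖ = r} = 0)
    (H : SmallJumpBounds (smallJumps ν t h) α h κ M) (b ξ : EuclideanSpace ℝ (Fin d)) :
    -(t : ℂ) * charExponent ν b ξ =
      Complex.I * ((⟪ξ, t • shiftedDrift ν b h⟫ : ℝ) : ℂ) + smallExponent (smallJumps ν t h) ξ 0 0 +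
      ((∫ y, Complex.exp (Complex.I * (⟪ξ, y⟫ : ℝ)) ∂(largeJumps ν t h)) -
        (largeJumps ν t h).real Set.univ) := by
  have hh := H.h_pos
  have ht0 : ENNReal.ofReal t ≠ 0 := by simpa using ht
  have hball : MeasurableSet (Metric.ball (0 : EuclideanSpace ℝ (Fin d)) h) :=
    Metric.isOpen_ball.measurableSet
  have hcompl : ν (Metric.ball (0 : EuclideanSpace ℝ (Fin d)) h)ᶜ < ∞ := by
    refine (measure_mono fun y hy ↦ ?_).trans_lt (hfin h hh)
    simpa using hy
  have : IsFiniteMeasure (ν.restrict (Metric.ball (0 : EuclideanSpace ℝ (Fin d)) h)ᶜ) :=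
    ⟨by simpa using hcompl⟩
  set f₀ : EuclideanSpace ℝ (Fin d) → ℂ := fun y ↦ levyKernel (⟪ξ, y⟫ : ℝ) with hf₀
  set f₁ : EuclideanSpace ℝ (Fin d) → ℂ := fun y ↦ Complex.exp (Complex.I * (⟪ξ, y⟫ : ℝ)) - 1
    with hf₁
  -- The difference between compensating up to `h` and up to `1`. It is supported on an annulus,
  -- with sign depending on whether `h ≤ 1`, and its integral is the change of drift from `b` to
  -- `b_h`.
  set D : EuclideanSpace ℝ (Fin d) → ℂ := fun y ↦
    (Metric.ball 0 h).indicator (fun y ↦ Complex.I * ((⟪ξ, y⟫ : ℝ) : ℂ)) y -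
    (Metric.ball 0 1).indicator (fun y ↦ Complex.I * ((⟪ξ, y⟫ : ℝ) : ℂ)) y with hD
  have hint₀ : IntegrableOn f₀ (Metric.ball 0 h) ν := by
    have h1 := H.integrable_levyKernel ξ 0 0
    rw [smallJumps, integrable_smul_measure ht0 ENNReal.ofReal_ne_top] at h1
    simpa [hf₀, IntegrableOn] using h1
  have hexp : Integrable (fun y ↦ Complex.exp (Complex.I * (⟪ξ, y⟫ : ℝ)))
      (ν.restrict (Metric.ball (0 : EuclideanSpace ℝ (Fin d)) h)ᶜ) := by
    refine Integrable.of_bound (C := 1) (Continuous.aestronglyMeasurable (by fun_prop)) ?_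
    exact Eventually.of_forall fun y ↦ by simp [Complex.norm_exp]
  have hint₁ : IntegrableOn f₁ (Metric.ball 0 h)ᶜ ν := hexp.sub (integrable_const _)
  have hDint : Integrable D ν ∧ ∫ y, D y ∂ν =
      Complex.I * ((⟪ξ, shiftedDrift ν b h - b⟫ : ℝ) : ℂ) := by
    rcases le_or_gt h 1 with h1 | h1
    · obtain ⟨i1, i2⟩ := integral_inner_annulus hfin hnull (R := 1) hh ξ
      have : D = fun y ↦ -{y | h ≤ ‖y‖ ∧ ‖y‖ < 1}.indicator
          (fun y ↦ Complex.I * ((⟪ξ, y⟫ : ℝ) : ℂ)) y := by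
        ext y
        simp only [hD, Set.indicator, Metric.mem_ball, dist_zero_right, Set.mem_ofPred_eq]
        split_ifs <;> first | (exfalso; grind) | simp
      rw [this]
      refine ⟨i1.neg, ?_⟩
      rw [integral_neg, i2]
      simp [shiftedDrift, h1]
    · obtain ⟨i1, i2⟩ := integral_inner_annulus hfin hnull (R := h) one_pos ξ
      have : D = fun y ↦ {y | 1 ≤ ‖y‖ ∧ ‖y‖ < h}.indicator
          (fun y ↦ Complex.I * ((⟪ξ, y⟫ : ℝ) : ℂ)) y := by
        ext y
        simp only [hD, Set.indicator, Metric.mem_ball, dist_zero_right, Set.mem_ofPred_eq]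
        split_ifs <;> first | (exfalso; grind) | simp
      rw [this]
      refine ⟨i1, ?_⟩
      rw [i2]
      simp [shiftedDrift, not_le.2 h1]
  have hsplit : (fun y ↦ Complex.exp (Complex.I * ((inner ℝ ξ y : ℝ) : ℂ)) - 1
      - (Metric.ball (0 : EuclideanSpace ℝ (Fin d)) 1).indicator
          (fun y ↦ Complex.I * ((inner ℝ ξ y : ℝ) : ℂ)) y) =
      fun y ↦ ((Metric.ball 0 h).indicator f₀ + (Metric.ball 0 h)ᶜ.indicator f₁) y + D y := by
    ext y
    rw [Pi.add_apply]
    by_cases hy : y ∈ Metric.ball (0 : EuclideanSpace ℝ (Fin d)) h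
    · simp only [hD, Set.indicator_of_mem hy, Set.indicator_of_notMem (Set.notMem_compl_iff.2 hy),
        hf₀, levyKernel]
      ring
    · simp only [hD, Set.indicator_of_notMem hy, Set.indicator_of_mem (Set.mem_compl hy), hf₁]
      ring
  have hreal : ((largeJumps ν t h).real Set.univ : ℂ) =
      t * (ν.real (Metric.ball (0 : EuclideanSpace ℝ (Fin d)) h)ᶜ : ℂ) := by
    simp [largeJumps, Measure.real, ht.le]
  have hlarge : ∫ y, Complex.exp (Complex.I * (⟪ξ, y⟫ : ℝ)) ∂(largeJumps ν t h) =
      t * ∫ y in (Metric.ball 0 h)ᶜ, Complex.exp (Complex.I * (⟪ξ, y⟫ : ℝ)) ∂ν := by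
    rw [largeJumps, integral_smul_measure, ENNReal.toReal_ofReal ht.le, Complex.real_smul]
  have hsmall : smallExponent (smallJumps ν t h) ξ 0 0 =
      t * ∫ y in Metric.ball 0 h, f₀ y ∂ν := by
    rw [smallExponent, smallJumps, integral_smul_measure, ENNReal.toReal_ofReal ht.le,
      Complex.real_smul]
    simp [hf₀]
  have hf₁int : ∫ y in (Metric.ball 0 h)ᶜ, f₁ y ∂ν =
      (∫ y in (Metric.ball 0 h)ᶜ, Complex.exp (Complex.I * (⟪ξ, y⟫ : ℝ)) ∂ν) -
        (ν.real (Metric.ball (0 : EuclideanSpace ℝ (Fin d)) h)ᶜ : ℂ) := by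
    rw [hf₁, integral_sub hexp (integrable_const _)]
    simp [Measure.real]
  have i0 := (integrable_indicator_iff hball).2 hint₀
  have i1 := (integrable_indicator_iff hball.compl).2 hint₁
  rw [charExponent, hsplit, integral_add (i0.add i1) hDint.1, integral_add' i0 i1,
    integral_indicator hball, integral_indicator hball.compl, hDint.2, hf₁int, hreal, hlarge,
    hsmall, inner_smul_right, inner_sub_right]
  push_cast
  ring

lemma isFiniteMeasure_largeJumps (hfin : ∀ r : ℝ, 0 < r → ν {y | r ≤ ‖y‖} < ∞) (t : ℝ) {h : ℝ}
    (hh : 0 < h) : IsFiniteMeasure (largeJumps ν t h) := by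
  refine ⟨?_⟩
  simp only [largeJumps, Measure.smul_apply, Measure.restrict_apply_univ, smul_eq_mul]
  refine ENNReal.mul_lt_top ENNReal.ofReal_lt_top ((measure_mono fun y hy ↦ ?_).trans_lt (hfin h hh))
  simpa using hy

/-- The law has a continuous density, which after centring is dominated by the inversion integral
of the decomposition at jump size `h`. -/
theorem density_le_norm_inversionIntegral [SFinite ν] [Nontrivial (EuclideanSpace ℝ (Fin d))]
    {α t h κ M : ℝ} (ht : 0 < t)
    (hfin : ∀ r : ℝ, 0 < r → ν {y | r ≤ ‖y‖} < ∞)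
    (hnull : ∀ r : ℝ, 0 < r → ν {y | ‖y‖ = r} = 0)
    (H : SmallJumpBounds (smallJumps ν t h) α h κ M) (b : EuclideanSpace ℝ (Fin d))
    (P : Measure (EuclideanSpace ℝ (Fin d))) [IsProbabilityMeasure P]
    (hP : ∀ ξ, charFun P ξ = Complex.exp (-(t : ℂ) * charExponent ν b ξ)) :
    ∃ q : EuclideanSpace ℝ (Fin d) → ℝ, Continuous q ∧ (∀ x, 0 ≤ q x) ∧
      P = volume.withDensity (fun x ↦ ENNReal.ofReal (q x)) ∧
      ∀ x, q (x + t • shiftedDrift ν b h) ≤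
        ‖inversionIntegral (smallJumps ν t h) (largeJumps ν t h) x‖ := by
  have hfinL := isFiniteMeasure_largeJumps hfin t H.h_pos
  have hsf : SFinite (smallJumps ν t h) := by unfold smallJumps; infer_instance
  set N := smallJumps ν t h with hN
  set Λ := largeJumps ν t h with hΛ
  set m := Λ.real Set.univ with hm
  have hm0 : 0 ≤ m := measureReal_nonneg
  have hform : ∀ ξ, charFun P ξ = Complex.exp (Complex.I * ((⟪ξ, t • shiftedDrift ν b h⟫ : ℝ) : ℂ)) *
      (Complex.exp (smallExponent N ξ 0 0) *
        Complex.exp (∫ y, Complex.exp (Complex.I * (⟪ξ, y⟫ : ℝ)) ∂Λ)) * Complex.exp (-m : ℝ) := by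
    intro ξ
    rw [hP, charExponent_decomposition ht hfin hnull H, ← Complex.exp_add, ← Complex.exp_add,
      ← Complex.exp_add]
    congr 1
    push_cast
    ring
  -- The compound Poisson factor has modulus at most one, as `e^m` and `e^(-m)` cancel;
  -- integrability comes from the small jumps alone.
  have hint : Integrable (charFun P) := by
    refine (H.integrable_exp_smallExponent.norm).mono' measurable_charFun.aestronglyMeasurable
      (Eventually.of_forall fun ξ ↦ ?_)
    rw [hform, norm_mul, norm_mul, norm_mul, Complex.norm_exp_ofReal]
    have h1 : ‖Complex.exp (Complex.I * ((⟪ξ, t • shiftedDrift ν b h⟫ : ℝ) : ℂ))‖ = 1 := by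
      simp [Complex.norm_exp]
    have h2 : ‖Complex.exp (∫ y, Complex.exp (Complex.I * (⟪ξ, y⟫ : ℝ)) ∂Λ)‖ ≤ rexp m := by
      rw [Complex.norm_exp]
      gcongr
      exact (Complex.re_le_norm _).trans (norm_integral_cexp_le Λ ξ)
    rw [h1, one_mul]
    calc _ ≤ ‖Complex.exp (smallExponent N ξ 0 0)‖ * rexp m * rexp (-m) := by gcongr
      _ = _ := by rw [mul_assoc, ← Real.exp_add]; simp
  obtain ⟨q, hqc, hq0, hPq, hq⟩ := density_of_integrable_charFun P hint
  refine ⟨q, hqc, hq0, hPq, fun x ↦ ?_⟩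
  have hinv : ∫ ξ, Complex.exp (-(⟪ξ, x + t • shiftedDrift ν b h⟫ : ℝ) * Complex.I) *
      charFun P ξ = inversionIntegral N Λ x * Complex.exp (-m : ℝ) := by
    rw [inversionIntegral, ← integral_mul_const]
    congr 1
    ext ξ
    have h1 : Complex.exp (-(⟪ξ, x + t • shiftedDrift ν b h⟫ : ℝ) * Complex.I) *
        Complex.exp (Complex.I * ((⟪ξ, t • shiftedDrift ν b h⟫ : ℝ) : ℂ)) =
        Complex.exp (-(⟪ξ, x⟫ : ℝ) * Complex.I) := by
      rw [← Complex.exp_add, inner_add_right]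
      congr 1
      push_cast
      ring
    rw [hform, ← h1]
    ring
  have h1 : ‖(q (x + t • shiftedDrift ν b h) : ℂ)‖ ≤ ‖inversionIntegral N Λ x‖ := by
    rw [hq, hinv, norm_smul, norm_mul, Complex.norm_exp_ofReal, Real.norm_of_nonneg (by positivity)]
    -- The inversion constant and the factor `e^(-m)` are both at most one and are simply dropped.
    have h2 : ((2 * π) ^ Module.finrank ℝ (EuclideanSpace ℝ (Fin d)))⁻¹ ≤ 1 :=
      inv_le_one_of_one_le₀ (one_le_pow₀ (by linarith [Real.pi_gt_three]))
    have h3 : rexp (-m) ≤ 1 := by rw [Real.exp_le_one_iff]; linarith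
    calc _ ≤ 1 * (‖inversionIntegral N Λ x‖ * 1) := by gcongr
      _ = _ := by ring
  rw [Complex.norm_real] at h1
  exact (le_abs_self _).trans h1

end Decomposition

/-! ### Polar integration against the tempered Lévy measure. -/

section Tempered

open Filter Topology Real
open scoped RealInnerProductSpace ENNReal

variable {d : ℕ} {α : ℝ} {μ : Measure (Metric.sphere (0 : EuclideanSpace ℝ (Fin d)) 1)}
  [IsFiniteMeasure μ] {Q : Metric.sphere (0 : EuclideanSpace ℝ (Fin d)) 1 → ℝ → ℝ}

instance sFinite_temperedLevyMeasure : SFinite (temperedLevyMeasure α μ Q) := by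
  unfold temperedLevyMeasure; infer_instance

lemma measurable_polar : Measurable fun p : Metric.sphere (0 : EuclideanSpace ℝ (Fin d)) 1 × ℝ ↦
    p.2 • (p.1 : EuclideanSpace ℝ (Fin d)) := Continuous.measurable (by fun_prop)

lemma lintegral_temperedLevyMeasure (hQ : Measurable (Function.uncurry Q))
    {f : EuclideanSpace ℝ (Fin d) → ℝ≥0∞} (hf : Measurable f) :
    ∫⁻ y, f y ∂(temperedLevyMeasure α μ Q) =
      ∫⁻ θ, (∫⁻ s in Set.Ioi (0 : ℝ), ENNReal.ofReal (s ^ (-1 - α) * Q θ s) *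
        f (s • (θ : EuclideanSpace ℝ (Fin d)))) ∂μ := by
  have h1 : Measurable fun p : Metric.sphere (0 : EuclideanSpace ℝ (Fin d)) 1 × ℝ ↦
      ENNReal.ofReal (p.2 ^ (-1 - α) * Q p.1 p.2) := by
    have : Measurable fun p : Metric.sphere (0 : EuclideanSpace ℝ (Fin d)) 1 × ℝ ↦ Q p.1 p.2 := hQ
    fun_prop
  have h2 : Measurable fun p : Metric.sphere (0 : EuclideanSpace ℝ (Fin d)) 1 × ℝ ↦
      f (p.2 • (p.1 : EuclideanSpace ℝ (Fin d))) := hf.comp measurable_polar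
  rw [temperedLevyMeasure, lintegral_map hf measurable_polar,
    lintegral_withDensity_eq_lintegral_mul _ h1 h2, lintegral_prod]
  · rfl
  · exact (h1.mul h2).aemeasurable

lemma norm_smul_sphere (θ : Metric.sphere (0 : EuclideanSpace ℝ (Fin d)) 1) {s : ℝ} (hs : 0 < s) :
    ‖s • (θ : EuclideanSpace ℝ (Fin d))‖ = s := by
  rw [norm_smul, norm_eq_of_mem_sphere, mul_one, Real.norm_of_nonneg hs.le]

/-- Two sided exponential bound on the tempering function. -/
def IsTempering (c C : ℝ) (Q : Metric.sphere (0 : EuclideanSpace ℝ (Fin d)) 1 → ℝ → ℝ) : Prop :=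
  ∀ θ, ∀ s : ℝ, 0 < s → C⁻¹ * Real.exp (-c * s) ≤ Q θ s ∧ Q θ s ≤ C * Real.exp (-c * s)

variable {c C : ℝ}

lemma lintegral_temperedLevyMeasure_le (hQ : Measurable (Function.uncurry Q))
    (hQC : IsTempering c C Q) {f : EuclideanSpace ℝ (Fin d) → ℝ≥0∞} (hf : Measurable f) :
    ∫⁻ y, f y ∂(temperedLevyMeasure α μ Q) ≤
      ∫⁻ θ, (∫⁻ s in Set.Ioi (0 : ℝ), ENNReal.ofReal (s ^ (-1 - α) * (C * rexp (-c * s))) *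
        f (s • (θ : EuclideanSpace ℝ (Fin d)))) ∂μ := by
  rw [lintegral_temperedLevyMeasure hQ hf]
  refine lintegral_mono fun θ ↦ setLIntegral_mono' measurableSet_Ioi fun s hs ↦ ?_
  have hs0 : (0 : ℝ) < s := hs
  gcongr
  exact (hQC θ s hs0).2

lemma lintegral_temperedLevyMeasure_radial_le (hQ : Measurable (Function.uncurry Q))
    (hQC : IsTempering c C Q) {f : EuclideanSpace ℝ (Fin d) → ℝ≥0∞} (hf : Measurable f)
    {g : ℝ → ℝ≥0∞} (hfg : ∀ θ : Metric.sphere (0 : EuclideanSpace ℝ (Fin d)) 1, ∀ s : ℝ, 0 < s →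
      ENNReal.ofReal (s ^ (-1 - α) * (C * rexp (-c * s))) *
        f (s • (θ : EuclideanSpace ℝ (Fin d))) ≤ g s) :
    ∫⁻ y, f y ∂(temperedLevyMeasure α μ Q) ≤ μ Set.univ * ∫⁻ s in Set.Ioi (0 : ℝ), g s := by
  refine (lintegral_temperedLevyMeasure_le hQ hQC hf).trans ?_
  rw [mul_comm, ← lintegral_const]
  exact lintegral_mono fun θ ↦ setLIntegral_mono' measurableSet_Ioi fun s hs ↦ hfg θ s hs

lemma lintegral_rpow_Ici {r : ℝ} (hα : 0 < α) (hr : 0 < r) :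
    ∫⁻ s in Set.Ioi (0 : ℝ), (Set.Ici r).indicator (fun s ↦ ENNReal.ofReal (s ^ (-1 - α))) s =
      ENNReal.ofReal (r ^ (-α) / α) := by
  rw [lintegral_indicator measurableSet_Ici, Measure.restrict_restrict measurableSet_Ici,
    Set.inter_eq_left.2 (Set.Ici_subset_Ioi.2 hr), setLIntegral_congr Ioi_ae_eq_Ici.symm,
    ← ofReal_integral_eq_lintegral_ofReal (integrableOn_Ioi_rpow_of_lt (by linarith) hr),
    integral_Ioi_rpow_of_lt (by linarith) hr]
  · congr 1
    rw [show -1 - α + 1 = -α by ring, neg_div_neg_eq]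
  · filter_upwards [ae_restrict_mem measurableSet_Ioi] with s hs
    have : (0 : ℝ) < s := hr.trans hs
    positivity

lemma lintegral_rpow_Iio {r : ℝ} (hα : α < 2) (hr : 0 < r) :
    ∫⁻ s in Set.Ioi (0 : ℝ), (Set.Iio r).indicator (fun s ↦ ENNReal.ofReal (s ^ (1 - α))) s =
      ENNReal.ofReal (r ^ (2 - α) / (2 - α)) := by
  have hi : IntervalIntegrable (fun s : ℝ ↦ s ^ (1 - α)) volume 0 r :=
    intervalIntegral.intervalIntegrable_rpow' (by linarith)
  have hi' : IntegrableOn (fun s : ℝ ↦ s ^ (1 - α)) (Set.Ioo 0 r) :=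
    ((intervalIntegrable_iff_integrableOn_Ioc_of_le hr.le).1 hi).mono_set Set.Ioo_subset_Ioc_self
  rw [lintegral_indicator measurableSet_Iio, Measure.restrict_restrict measurableSet_Iio,
    Set.inter_comm, Set.Ioi_inter_Iio, ← ofReal_integral_eq_lintegral_ofReal hi',
    ← integral_Ioc_eq_integral_Ioo, ← intervalIntegral.integral_of_le hr.le,
    integral_rpow (Or.inl (by linarith))]
  · congr 1
    rw [show 1 - α + 1 = 2 - α by ring, zero_rpow (by linarith), sub_zero]
  · filter_upwards [ae_restrict_mem measurableSet_Ioo] with s hs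
    have : (0 : ℝ) < s := hs.1
    positivity

lemma temperedLevyMeasure_sphere_null (hQ : Measurable (Function.uncurry Q))
    (hQC : IsTempering c C Q) (r : ℝ) : temperedLevyMeasure α μ Q {y | ‖y‖ = r} = 0 := by
  have hset : MeasurableSet {y : EuclideanSpace ℝ (Fin d) | ‖y‖ = r} :=
    measurableSet_eq_fun (by fun_prop) (by fun_prop)
  rw [← lintegral_indicator_one hset]
  refine le_antisymm ((lintegral_temperedLevyMeasure_radial_le hQ hQC (measurable_one.indicator hset)
    (g := ({r} : Set ℝ).indicator fun s ↦ ENNReal.ofReal (s ^ (-1 - α) * (C * rexp (-c * s))))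
    fun θ s hs ↦ ?_).trans ?_) zero_le
  · by_cases h : s = r
    · subst h
      simp [Set.indicator, norm_smul_sphere θ hs]
    · simp [Set.indicator, norm_smul_sphere θ hs, h]
  · rw [lintegral_indicator (measurableSet_singleton r),
      Measure.restrict_restrict (measurableSet_singleton r), setLIntegral_measure_zero]
    · simp
    · exact measure_mono_null Set.inter_subset_left (by simp)

lemma temperedLevyMeasure_compl_ball_lt_top (hα : 0 < α) (hc : 0 ≤ c) (hC : 0 ≤ C)
    (hQ : Measurable (Function.uncurry Q)) (hQC : IsTempering c C Q) {r : ℝ} (hr : 0 < r) :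
    temperedLevyMeasure α μ Q {y | r ≤ ‖y‖} < ∞ := by
  have hset : MeasurableSet {y : EuclideanSpace ℝ (Fin d) | r ≤ ‖y‖} :=
    measurableSet_le (by fun_prop) (by fun_prop)
  rw [← lintegral_indicator_one hset]
  refine (lintegral_temperedLevyMeasure_radial_le hQ hQC (measurable_one.indicator hset)
    (g := fun s ↦ ENNReal.ofReal C *
      (Set.Ici r).indicator (fun s ↦ ENNReal.ofReal (s ^ (-1 - α))) s) fun θ s hs ↦ ?_).trans_lt ?_
  · by_cases h : r ≤ s
    · rw [Set.indicator_of_mem (by simpa [norm_smul_sphere θ hs] using h),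
        Set.indicator_of_mem (by exact h), Pi.one_apply, mul_one, ← ENNReal.ofReal_mul hC]
      apply ENNReal.ofReal_le_ofReal
      have : rexp (-c * s) ≤ 1 := by
        rw [Real.exp_le_one_iff]; nlinarith
      calc s ^ (-1 - α) * (C * rexp (-c * s)) ≤ s ^ (-1 - α) * (C * 1) := by gcongr
        _ = _ := by ring
    · rw [Set.indicator_of_notMem (by simpa [norm_smul_sphere θ hs] using h)]
      simp
  · rw [lintegral_const_mul _ (Measurable.indicator (by fun_prop) measurableSet_Ici),
      lintegral_rpow_Ici hα hr]
    exact ENNReal.mul_lt_top (measure_lt_top _ _)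
      (ENNReal.mul_lt_top ENNReal.ofReal_lt_top ENNReal.ofReal_lt_top)

end Tempered

/-! ### Ellipticity of the spherical measure. -/

section Nondegenerate

open Filter Topology Real
open scoped RealInnerProductSpace ENNReal

variable {d : ℕ}

lemma continuous_integral_inner_sq (μ : Measure (Metric.sphere (0 : EuclideanSpace ℝ (Fin d)) 1))
    [IsFiniteMeasure μ] :
    Continuous fun ξ : EuclideanSpace ℝ (Fin d) ↦
      ∫ θ, ⟪ξ, (θ : EuclideanSpace ℝ (Fin d))⟫ ^ 2 ∂μ := by
  refine continuous_iff_continuousAt.2 fun ξ₀ ↦ ?_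
  refine continuousAt_of_dominated (bound := fun _ ↦ (‖ξ₀‖ + 1) ^ 2) ?_ ?_ (integrable_const _) ?_
  · exact Eventually.of_forall fun ξ ↦ Continuous.aestronglyMeasurable (by fun_prop)
  · filter_upwards [Metric.ball_mem_nhds ξ₀ one_pos] with ξ hξ
    refine Eventually.of_forall fun θ ↦ ?_
    have h1 : ‖ξ‖ ≤ ‖ξ₀‖ + 1 := by
      have h2 : ‖ξ - ξ₀‖ < 1 := by simpa [dist_eq_norm] using hξ
      have h3 := norm_add_le (ξ - ξ₀) ξ₀
      simp only [sub_add_cancel] at h3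
      linarith
    have h4 := abs_real_inner_le_norm ξ (θ : EuclideanSpace ℝ (Fin d))
    rw [norm_eq_of_mem_sphere, mul_one] at h4
    rw [norm_pow, Real.norm_eq_abs]
    exact pow_le_pow_left₀ (abs_nonneg _) (h4.trans h1) 2
  · exact Eventually.of_forall fun θ ↦ by fun_prop

/-- A nondegenerate spherical measure has a uniformly elliptic second moment. -/
lemma exists_le_lintegral_inner_sq [Nontrivial (EuclideanSpace ℝ (Fin d))]
    (μ : Measure (Metric.sphere (0 : EuclideanSpace ℝ (Fin d)) 1)) [IsFiniteMeasure μ]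
    (hμ : IsNondegenerate (μ.map Subtype.val)) :
    ∃ n₀ : ℝ, 0 < n₀ ∧ ∀ ξ : EuclideanSpace ℝ (Fin d), ENNReal.ofReal (n₀ * ‖ξ‖ ^ 2) ≤
      ∫⁻ θ, ENNReal.ofReal (⟪ξ, (θ : EuclideanSpace ℝ (Fin d))⟫ ^ 2) ∂μ := by
  have hint : ∀ ξ : EuclideanSpace ℝ (Fin d),
      Integrable (fun θ : Metric.sphere (0 : EuclideanSpace ℝ (Fin d)) 1 ↦
        ⟪ξ, (θ : EuclideanSpace ℝ (Fin d))⟫ ^ 2) μ := by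
    intro ξ
    refine Integrable.of_bound (C := ‖ξ‖ ^ 2) (Continuous.aestronglyMeasurable (by fun_prop))
      (Eventually.of_forall fun θ ↦ ?_)
    have h4 := abs_real_inner_le_norm ξ (θ : EuclideanSpace ℝ (Fin d))
    rw [norm_eq_of_mem_sphere, mul_one] at h4
    rw [norm_pow, Real.norm_eq_abs]
    gcongr
  obtain ⟨ξ₀, hξ₀, hmin⟩ := (isCompact_sphere (0 : EuclideanSpace ℝ (Fin d)) 1).exists_isMinOn
    (NormedSpace.sphere_nonempty.2 zero_le_one) (continuous_integral_inner_sq μ).continuousOn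
  set n₀ := ∫ θ, ⟪ξ₀, (θ : EuclideanSpace ℝ (Fin d))⟫ ^ 2 ∂μ with hn₀
  -- If the minimum over unit vectors vanished, almost every `θ` would be orthogonal to the
  -- minimizer `ξ₀`, and the support would lie in the hyperplane `ξ₀ᗮ`.
  have hpos : 0 < n₀ := by
    refine lt_of_le_of_ne (integral_nonneg fun θ ↦ sq_nonneg _) fun h0 ↦ ?_
    have hae := (integral_eq_zero_iff_of_nonneg (fun θ ↦ sq_nonneg _) (hint ξ₀)).1 h0.symm
    have hne : (ℝ ∙ ξ₀)ᗮ ≠ ⊤ := by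
      intro htop
      have h1 : ξ₀ ∈ (ℝ ∙ ξ₀)ᗮ := by rw [htop]; trivial
      have h2 : ⟪ξ₀, ξ₀⟫ = 0 := Submodule.mem_orthogonal_singleton_iff_inner_right.1 h1
      rw [inner_self_eq_zero] at h2
      simp [h2] at hξ₀
    refine hμ _ hne (Measure.support_subset_of_isClosed
      (Submodule.isClosed_orthogonal _) ?_)
    have h3 : ∀ᵐ θ : Metric.sphere (0 : EuclideanSpace ℝ (Fin d)) 1 ∂μ,
        (θ : EuclideanSpace ℝ (Fin d)) ∈ (ℝ ∙ ξ₀)ᗮ := by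
      filter_upwards [hae] with θ hθ
      exact Submodule.mem_orthogonal_singleton_iff_inner_right.2 (by simpa using hθ)
    rw [mem_ae_iff, Measure.map_apply measurable_subtype_coe
      (Submodule.isClosed_orthogonal _).measurableSet.compl]
    exact ae_iff.1 h3
  refine ⟨n₀, hpos, fun ξ ↦ ?_⟩
  rw [← ofReal_integral_eq_lintegral_ofReal (hint ξ) (Eventually.of_forall fun θ ↦ sq_nonneg _)]
  apply ENNReal.ofReal_le_ofReal
  rcases eq_or_ne ξ 0 with rfl | hξ
  · simp
  have hξ' : ‖ξ‖ ≠ 0 := norm_ne_zero_iff.2 hξ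
  have h1 : n₀ ≤ ∫ θ, ⟪‖ξ‖⁻¹ • ξ, (θ : EuclideanSpace ℝ (Fin d))⟫ ^ 2 ∂μ :=
    hmin (by simp [norm_smul, hξ'])
  simp_rw [real_inner_smul_left, mul_pow] at h1
  rw [integral_const_mul] at h1
  calc n₀ * ‖ξ‖ ^ 2 ≤ (‖ξ‖⁻¹ ^ 2 * ∫ θ, ⟪ξ, (θ : EuclideanSpace ℝ (Fin d))⟫ ^ 2 ∂μ) * ‖ξ‖ ^ 2 := by
        gcongr
    _ = _ := by field_simp

end Nondegenerate

/-! ### Moments of the jumps at the scale `h`. -/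

section TemperedBounds

open Filter Topology Real
open scoped RealInnerProductSpace ENNReal

variable {d : ℕ} {α c C : ℝ} {μ : Measure (Metric.sphere (0 : EuclideanSpace ℝ (Fin d)) 1)}
  [IsFiniteMeasure μ] {Q : Metric.sphere (0 : EuclideanSpace ℝ (Fin d)) 1 → ℝ → ℝ}

lemma lintegral_smallJumps {ν : Measure (EuclideanSpace ℝ (Fin d))} (t h : ℝ)
    (f : EuclideanSpace ℝ (Fin d) → ℝ≥0∞) :
    ∫⁻ y, f y ∂(smallJumps ν t h) =
      ENNReal.ofReal t * ∫⁻ y, (Metric.ball 0 h).indicator f y ∂ν := by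
  rw [smallJumps, lintegral_smul_measure, lintegral_indicator Metric.isOpen_ball.measurableSet,
    smul_eq_mul]

lemma lintegral_largeJumps {ν : Measure (EuclideanSpace ℝ (Fin d))} (t h : ℝ)
    (f : EuclideanSpace ℝ (Fin d) → ℝ≥0∞) :
    ∫⁻ y, f y ∂(largeJumps ν t h) =
      ENNReal.ofReal t * ∫⁻ y, (Metric.ball 0 h)ᶜ.indicator f y ∂ν := by
  rw [largeJumps, lintegral_smul_measure, lintegral_indicator
    Metric.isOpen_ball.measurableSet.compl, smul_eq_mul]

/-- Admissible pairs of a time `t` and a truncation level `h`. -/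
def IsJumpScale (α t h : ℝ) : Prop :=
  0 < t ∧ 0 < h ∧ ((h ≤ 1 ∧ t = h ^ α) ∨ (1 ≤ h ∧ t = h ^ 2))

/-- Only radii `s < δ` are kept. There the tempering is at least `C⁻¹ e^(-c)` because `δ ≤ 1`, and
the cosine is controlled by a quadratic because `δ‖ξ‖ ≤ 1`; what is left is the integral of
`s^(1-α)` times the second moment of `μ`. -/
lemma lintegral_temperedLevyMeasure_one_sub_cos_ge (hα2 : α < 2) (hc : 0 ≤ c) (hC : 0 < C)
    (hQ : Measurable (Function.uncurry Q)) (hQC : IsTempering c C Q)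
    {n₀ : ℝ} (ξ : EuclideanSpace ℝ (Fin d))
    (hnd : ENNReal.ofReal (n₀ * ‖ξ‖ ^ 2) ≤
      ∫⁻ θ, ENNReal.ofReal (⟪ξ, (θ : EuclideanSpace ℝ (Fin d))⟫ ^ 2) ∂μ)
    {h δ : ℝ} (hδ : 0 < δ) (hδh : δ ≤ h) (hδ1 : δ ≤ 1) (hδξ : δ * ‖ξ‖ ≤ 1) :
    ENNReal.ofReal (C⁻¹ * rexp (-c) * (2 / π ^ 2) / (2 - α) * n₀ * (‖ξ‖ ^ 2 * δ ^ (2 - α))) ≤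
      ∫⁻ y, (Metric.ball 0 h).indicator (fun y ↦ ENNReal.ofReal (1 - Real.cos ⟪ξ, y⟫)) y
        ∂(temperedLevyMeasure α μ Q) := by
  have h2α : 0 < 2 - α := by linarith
  set A := C⁻¹ * rexp (-c) * (2 / π ^ 2) with hA
  have hA0 : 0 < A := by positivity
  rw [lintegral_temperedLevyMeasure hQ (Measurable.indicator (by fun_prop)
    Metric.isOpen_ball.measurableSet)]
  have hθ : ∀ θ : Metric.sphere (0 : EuclideanSpace ℝ (Fin d)) 1,
      ENNReal.ofReal (A / (2 - α) * δ ^ (2 - α)) *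
        ENNReal.ofReal (⟪ξ, (θ : EuclideanSpace ℝ (Fin d))⟫ ^ 2) ≤
      ∫⁻ s in Set.Ioi (0 : ℝ), ENNReal.ofReal (s ^ (-1 - α) * Q θ s) *
        (Metric.ball 0 h).indicator (fun y ↦ ENNReal.ofReal (1 - Real.cos ⟪ξ, y⟫))
          (s • (θ : EuclideanSpace ℝ (Fin d))) := by
    intro θ
    set u := ⟪ξ, (θ : EuclideanSpace ℝ (Fin d))⟫ with hu
    have hu1 : |u| ≤ ‖ξ‖ := by
      have := abs_real_inner_le_norm ξ (θ : EuclideanSpace ℝ (Fin d))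
      rwa [norm_eq_of_mem_sphere, mul_one] at this
    calc _ = ENNReal.ofReal (A * u ^ 2) * ENNReal.ofReal (δ ^ (2 - α) / (2 - α)) := by
          rw [← ENNReal.ofReal_mul (by positivity), ← ENNReal.ofReal_mul (by positivity)]
          congr 1; ring
      _ = ∫⁻ s in Set.Ioi (0 : ℝ), ENNReal.ofReal (A * u ^ 2) *
          (Set.Iio δ).indicator (fun s ↦ ENNReal.ofReal (s ^ (1 - α))) s := by
          rw [lintegral_const_mul _ (Measurable.indicator (by fun_prop) measurableSet_Iio),
            lintegral_rpow_Iio hα2 hδ]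
      _ ≤ _ := by
          refine setLIntegral_mono' measurableSet_Ioi fun s hs ↦ ?_
          have hs0 : (0 : ℝ) < s := hs
          by_cases hsδ : s < δ
          · rw [Set.indicator_of_mem (by exact hsδ), Set.indicator_of_mem
              (by simpa [norm_smul_sphere θ hs0] using hsδ.trans_le hδh), inner_smul_right, ← hu,
              ← ENNReal.ofReal_mul (by positivity)]
            have hQ1 : C⁻¹ * rexp (-c) ≤ Q θ s := by
              refine le_trans ?_ (hQC θ s hs0).1
              gcongr
              nlinarith
            have hQ0 : 0 ≤ Q θ s := le_trans (by positivity) hQ1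
            rw [← ENNReal.ofReal_mul (by positivity)]
            apply ENNReal.ofReal_le_ofReal
            have hsu : |s * u| ≤ π := by
              rw [abs_mul, abs_of_pos hs0]
              calc s * |u| ≤ δ * ‖ξ‖ := by gcongr
                _ ≤ π := by linarith [Real.pi_gt_three]
            have hcos := Real.cos_le_one_sub_mul_cos_sq hsu
            have h1 : 2 / π ^ 2 * (s * u) ^ 2 ≤ 1 - Real.cos (s * u) := by linarith
            have h2 : s ^ (1 - α) = s ^ (-1 - α) * s ^ 2 := by
              rw [← rpow_natCast s 2, ← rpow_add hs0]; congr 1; push_cast; ring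
            calc A * u ^ 2 * s ^ (1 - α) =
                  s ^ (-1 - α) * (C⁻¹ * rexp (-c)) * (2 / π ^ 2 * (s * u) ^ 2) := by
                  rw [h2, hA]; ring
              _ ≤ _ := by gcongr
          · rw [Set.indicator_of_notMem (by exact hsδ)]
            simp
  calc ENNReal.ofReal (A / (2 - α) * n₀ * (‖ξ‖ ^ 2 * δ ^ (2 - α)))
      = ENNReal.ofReal (A / (2 - α) * δ ^ (2 - α)) * ENNReal.ofReal (n₀ * ‖ξ‖ ^ 2) := by
        rw [← ENNReal.ofReal_mul (by positivity)]
        congr 1; ring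
    _ ≤ ENNReal.ofReal (A / (2 - α) * δ ^ (2 - α)) *
        ∫⁻ θ, ENNReal.ofReal (⟪ξ, (θ : EuclideanSpace ℝ (Fin d))⟫ ^ 2) ∂μ := by gcongr
    _ = ∫⁻ θ, ENNReal.ofReal (A / (2 - α) * δ ^ (2 - α)) *
        ENNReal.ofReal (⟪ξ, (θ : EuclideanSpace ℝ (Fin d))⟫ ^ 2) ∂μ :=
        (lintegral_const_mul _ (by fun_prop)).symm
    _ ≤ _ := lintegral_mono hθ

/-- The cutoff is `δ = min(1/r, 1)`. If `δ = 1/r`, the right side is `t r^α` with `t ≥ h^α`; if `r ≤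
1 ≤ h`, then `δ = 1` gives `(h r)²`, which beats `(h r)^α` since `h r > 1`. -/
lemma IsJumpScale.exists_cutoff {t h r : ℝ} (hα2 : α < 2) (H : IsJumpScale α t h)
    (hr : 1 < h * r) : ∃ δ : ℝ, 0 < δ ∧ δ ≤ h ∧ δ ≤ 1 ∧ δ * r ≤ 1 ∧
      (h * r) ^ α ≤ t * (r ^ 2 * δ ^ (2 - α)) := by
  obtain ⟨ht, hh, H⟩ := H
  have hr0 : 0 < r := pos_of_mul_pos_right (by linarith) hh.le
  have key : r ^ 2 * r⁻¹ ^ (2 - α) = r ^ α := by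
    rw [inv_rpow hr0.le, ← rpow_neg hr0.le, ← rpow_natCast r 2, ← rpow_add hr0]
    congr 1; push_cast; ring
  have hrh : r⁻¹ ≤ h := by
    rw [inv_le_iff_one_le_mul₀ hr0]; exact hr.le
  rcases H with ⟨h1, rfl⟩ | ⟨h1, rfl⟩
  · refine ⟨r⁻¹, by positivity, hrh, hrh.trans h1, (inv_mul_cancel₀ hr0.ne').le, ?_⟩
    rw [key, mul_rpow hh.le hr0.le]
  · rcases le_total 1 r with h2 | h2
    · refine ⟨r⁻¹, by positivity, hrh, inv_le_one_of_one_le₀ h2, (inv_mul_cancel₀ hr0.ne').le, ?_⟩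
      rw [key, mul_rpow hh.le hr0.le]
      gcongr
      rw [← rpow_natCast h 2]
      exact rpow_le_rpow_of_exponent_le h1 (by push_cast; linarith)
    · refine ⟨1, one_pos, h1, le_rfl, by linarith, ?_⟩
      rw [one_rpow, mul_one, ← mul_pow, ← rpow_natCast (h * r) 2]
      exact rpow_le_rpow_of_exponent_le hr.le (by push_cast; linarith)

/-- The second moment of the tempered stable density on the half line. -/
noncomputable def temperedMoment (α c : ℝ) : ℝ :=
  ∫ s in Set.Ioi (0 : ℝ), s ^ (1 - α) * rexp (-(c / 2) * s ^ (1 : ℝ))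

lemma temperedMoment_nonneg (α c : ℝ) : 0 ≤ temperedMoment α c :=
  setIntegral_nonneg measurableSet_Ioi fun s hs ↦ by
    have : (0 : ℝ) < s := hs
    positivity

lemma lintegral_temperedMoment (hα2 : α < 2) (hc : 0 < c) :
    ∫⁻ s in Set.Ioi (0 : ℝ), ENNReal.ofReal (s ^ (1 - α) * rexp (-(c / 2) * s)) =
      ENNReal.ofReal (temperedMoment α c) := by
  rw [temperedMoment, ofReal_integral_eq_lintegral_ofReal
    (integrableOn_rpow_mul_exp_neg_mul_rpow (by linarith) one_pos (by linarith))]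
  · simp
  · filter_upwards [ae_restrict_mem measurableSet_Ioi] with s hs
    have : (0 : ℝ) < s := hs
    positivity

/-- For `h ≤ 1` the tempering is ignored and `t h^(2-α) = h²`. For `h ≥ 1` the tempering makes the
full second moment finite and `t = h²`. -/
lemma lintegral_sq_smallJumps_le (hα2 : α < 2) (hc : 0 < c) (hC : 0 < C)
    (hQ : Measurable (Function.uncurry Q)) (hQC : IsTempering c C Q) {t h : ℝ}
    (H : IsJumpScale α t h) :
    ∫⁻ y, ENNReal.ofReal (‖y‖ ^ 2) ∂(smallJumps (temperedLevyMeasure α μ Q) t h) ≤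
      ENNReal.ofReal (μ.real Set.univ * C * (1 / (2 - α) + temperedMoment α c) * h ^ 2) := by
  obtain ⟨ht, hh, H⟩ := H
  have h2α : 0 < 2 - α := by linarith
  have hJ := temperedMoment_nonneg α c
  have hm : μ Set.univ = ENNReal.ofReal (μ.real Set.univ) := by simp [Measure.real]
  rw [lintegral_smallJumps]
  have hmeas : Measurable ((Metric.ball 0 h).indicator fun y : EuclideanSpace ℝ (Fin d) ↦
      ENNReal.ofReal (‖y‖ ^ 2)) :=
    Measurable.indicator (by fun_prop) Metric.isOpen_ball.measurableSet
  have hpt : ∀ s : ℝ, 0 < s → s ^ (-1 - α) * (C * rexp (-c * s)) * s ^ 2 =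
      C * (s ^ (1 - α) * rexp (-c * s)) := by
    intro s hs
    have h2 : s ^ (1 - α) = s ^ (-1 - α) * s ^ 2 := by
      rw [← rpow_natCast s 2, ← rpow_add hs]; congr 1; push_cast; ring
    rw [h2]; ring
  rcases H with ⟨h1, rfl⟩ | ⟨h1, rfl⟩
  · have h3 := lintegral_temperedLevyMeasure_radial_le (μ := μ) (α := α) hQ hQC hmeas
      (g := fun s ↦ ENNReal.ofReal C *
        (Set.Iio h).indicator (fun s ↦ ENNReal.ofReal (s ^ (1 - α))) s) fun θ s hs ↦ by
        by_cases hsh : s < h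
        · rw [Set.indicator_of_mem (by simpa [norm_smul_sphere θ hs] using hsh),
            Set.indicator_of_mem (by exact hsh), norm_smul_sphere θ hs,
            ← ENNReal.ofReal_mul' (by positivity), ← ENNReal.ofReal_mul hC.le, hpt s hs]
          apply ENNReal.ofReal_le_ofReal
          have : rexp (-c * s) ≤ 1 := by rw [Real.exp_le_one_iff]; nlinarith
          calc C * (s ^ (1 - α) * rexp (-c * s)) ≤ C * (s ^ (1 - α) * 1) := by gcongr
            _ = _ := by ring
        · rw [Set.indicator_of_notMem (by simpa [norm_smul_sphere θ hs] using hsh)]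
          simp
    rw [lintegral_const_mul _ (Measurable.indicator (by fun_prop) measurableSet_Iio),
      lintegral_rpow_Iio hα2 hh, hm, ← ENNReal.ofReal_mul hC.le,
      ← ENNReal.ofReal_mul (by positivity)] at h3
    refine (mul_le_mul_right h3 _).trans ?_
    rw [← ENNReal.ofReal_mul ht.le]
    apply ENNReal.ofReal_le_ofReal
    have h4 : h ^ α * h ^ (2 - α) = h ^ 2 := by
      rw [← rpow_add hh, ← rpow_natCast h 2]; congr 1; push_cast; ring
    calc h ^ α * (μ.real Set.univ * (C * (h ^ (2 - α) / (2 - α))))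
        = μ.real Set.univ * C * (1 / (2 - α)) * (h ^ α * h ^ (2 - α)) := by ring
      _ = μ.real Set.univ * C * (1 / (2 - α)) * h ^ 2 := by rw [h4]
      _ ≤ _ := by gcongr; linarith
  · have h3 := lintegral_temperedLevyMeasure_radial_le (μ := μ) (α := α) hQ hQC hmeas
      (g := fun s ↦ ENNReal.ofReal C *
        ENNReal.ofReal (s ^ (1 - α) * rexp (-(c / 2) * s))) fun θ s hs ↦ by
        refine (mul_le_mul_right (Set.indicator_le_self _ _ _) _).trans ?_
        rw [norm_smul_sphere θ hs,
            ← ENNReal.ofReal_mul' (by positivity), ← ENNReal.ofReal_mul hC.le, hpt s hs]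
        apply ENNReal.ofReal_le_ofReal
        gcongr
        linarith
    rw [lintegral_const_mul _ (by fun_prop), lintegral_temperedMoment hα2 hc, hm,
      ← ENNReal.ofReal_mul hC.le, ← ENNReal.ofReal_mul (by positivity)] at h3
    refine (mul_le_mul_right h3 _).trans ?_
    rw [← ENNReal.ofReal_mul ht.le]
    apply ENNReal.ofReal_le_ofReal
    have : 0 ≤ 1 / (2 - α) := by positivity
    calc h ^ 2 * (μ.real Set.univ * (C * temperedMoment α c))
        = μ.real Set.univ * C * temperedMoment α c * h ^ 2 := by ring
      _ ≤ _ := by gcongr; linarith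

/-- The weight uses half of the tempering rate. For `h ≤ 1` the tail mass `h^(-α)` cancels `t =
h^α`. For `h ≥ 1` Chebyshev's inequality `h² ≤ s²` reduces the integral to the tempered second
moment. -/
lemma lintegral_exp_largeJumps_le (hα : 0 < α) (hα2 : α < 2) (hc : 0 < c) (hC : 0 < C)
    (hQ : Measurable (Function.uncurry Q)) (hQC : IsTempering c C Q) {t h : ℝ}
    (H : IsJumpScale α t h) :
    ∫⁻ y, ENNReal.ofReal (rexp (c / 2 * ‖y‖)) ∂(largeJumps (temperedLevyMeasure α μ Q) t h) ≤
      ENNReal.ofReal (μ.real Set.univ * C * (1 / α + temperedMoment α c)) := by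
  obtain ⟨ht, hh, H⟩ := H
  have hJ := temperedMoment_nonneg α c
  have hm : μ Set.univ = ENNReal.ofReal (μ.real Set.univ) := by simp [Measure.real]
  rw [lintegral_largeJumps]
  have hmeas : Measurable ((Metric.ball 0 h)ᶜ.indicator fun y : EuclideanSpace ℝ (Fin d) ↦
      ENNReal.ofReal (rexp (c / 2 * ‖y‖))) :=
    Measurable.indicator (by fun_prop) Metric.isOpen_ball.measurableSet.compl
  have hpt : ∀ s : ℝ, s ^ (-1 - α) * (C * rexp (-c * s)) * rexp (c / 2 * s) =
      C * (s ^ (-1 - α) * rexp (-(c / 2) * s)) := by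
    intro s
    have h2 : rexp (-(c / 2) * s) = rexp (-c * s) * rexp (c / 2 * s) := by
      rw [← Real.exp_add]; ring_nf
    rw [h2]; ring
  rcases H with ⟨h1, rfl⟩ | ⟨h1, rfl⟩
  · have h3 := lintegral_temperedLevyMeasure_radial_le (μ := μ) (α := α) hQ hQC hmeas
      (g := fun s ↦ ENNReal.ofReal C *
        (Set.Ici h).indicator (fun s ↦ ENNReal.ofReal (s ^ (-1 - α))) s) fun θ s hs ↦ by
        by_cases hsh : h ≤ s
        · rw [Set.indicator_of_mem (by simpa [norm_smul_sphere θ hs] using hsh),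
            Set.indicator_of_mem (by exact hsh), norm_smul_sphere θ hs,
            ← ENNReal.ofReal_mul' (by positivity), ← ENNReal.ofReal_mul hC.le, hpt s]
          apply ENNReal.ofReal_le_ofReal
          have : rexp (-(c / 2) * s) ≤ 1 := by rw [Real.exp_le_one_iff]; nlinarith
          calc C * (s ^ (-1 - α) * rexp (-(c / 2) * s)) ≤ C * (s ^ (-1 - α) * 1) := by gcongr
            _ = _ := by ring
        · rw [Set.indicator_of_notMem (by simpa [norm_smul_sphere θ hs] using hsh)]
          simp
    rw [lintegral_const_mul _ (Measurable.indicator (by fun_prop) measurableSet_Ici),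
      lintegral_rpow_Ici hα hh, hm, ← ENNReal.ofReal_mul hC.le,
      ← ENNReal.ofReal_mul (by positivity)] at h3
    refine (mul_le_mul_right h3 _).trans ?_
    rw [← ENNReal.ofReal_mul ht.le]
    apply ENNReal.ofReal_le_ofReal
    have h4 : h ^ α * h ^ (-α) = 1 := by
      rw [← rpow_add hh]; simp
    calc h ^ α * (μ.real Set.univ * (C * (h ^ (-α) / α)))
        = μ.real Set.univ * C * (1 / α) * (h ^ α * h ^ (-α)) := by ring
      _ = μ.real Set.univ * C * (1 / α) := by rw [h4, mul_one]
      _ ≤ _ := by gcongr; linarith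
  · rw [← lintegral_const_mul _ hmeas]
    have h3 := lintegral_temperedLevyMeasure_radial_le (μ := μ) (α := α) hQ hQC
      (hmeas.const_mul (ENNReal.ofReal (h ^ 2)))
      (g := fun s ↦ ENNReal.ofReal C *
        ENNReal.ofReal (s ^ (1 - α) * rexp (-(c / 2) * s))) fun θ s hs ↦ by
        by_cases hsh : h ≤ s
        · rw [Set.indicator_of_mem (by simpa [norm_smul_sphere θ hs] using hsh),
            norm_smul_sphere θ hs, mul_left_comm,
            ← ENNReal.ofReal_mul' (by positivity), ← ENNReal.ofReal_mul hC.le,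
            ← ENNReal.ofReal_mul (by positivity), hpt s]
          apply ENNReal.ofReal_le_ofReal
          have h2 : s ^ (1 - α) = s ^ (-1 - α) * s ^ 2 := by
            rw [← rpow_natCast s 2, ← rpow_add hs]; congr 1; push_cast; ring
          calc h ^ 2 * (C * (s ^ (-1 - α) * rexp (-(c / 2) * s)))
              ≤ s ^ 2 * (C * (s ^ (-1 - α) * rexp (-(c / 2) * s))) := by gcongr
            _ = _ := by rw [h2]; ring
        · rw [Set.indicator_of_notMem (by simpa [norm_smul_sphere θ hs] using hsh)]
          simp
    refine h3.trans ?_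
    rw [lintegral_const_mul _ (by fun_prop), lintegral_temperedMoment hα2 hc, hm,
      ← ENNReal.ofReal_mul hC.le, ← ENNReal.ofReal_mul (by positivity)]
    apply ENNReal.ofReal_le_ofReal
    have : 0 ≤ 1 / α := by positivity
    calc μ.real Set.univ * (C * temperedMoment α c)
        = μ.real Set.univ * C * temperedMoment α c := by ring
      _ ≤ _ := by gcongr; linarith

end TemperedBounds

/-! ### Mass of balls away from the origin, and the uniform constants. -/

section JumpBounds

open Filter Topology Real
open scoped RealInnerProductSpace ENNReal

variable {d : ℕ} {α γ c C : ℝ} {μ : Measure (Metric.sphere (0 : EuclideanSpace ℝ (Fin d)) 1)}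
  [IsFiniteMeasure μ] {Q : Metric.sphere (0 : EuclideanSpace ℝ (Fin d)) 1 → ℝ → ℝ}

/-- In polar coordinates, a small ball away from the origin lies in a product of a spherical cap
and an interval. -/
lemma mem_cap_of_smul_mem_ball {w : EuclideanSpace ℝ (Fin d)} {ρ R s : ℝ} (hR : 0 < R)
    (hw : 3 * R / 4 ≤ ‖w‖) {θ θ₀ : Metric.sphere (0 : EuclideanSpace ℝ (Fin d)) 1}
    (hθ₀ : (θ₀ : EuclideanSpace ℝ (Fin d)) = ‖w‖⁻¹ • w) (hs : 0 < s)
    (hmem : s • (θ : EuclideanSpace ℝ (Fin d)) ∈ Metric.ball w ρ) :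
    θ ∈ Metric.ball θ₀ (4 * ρ / R) ∧ s ∈ Set.Ioo (‖w‖ - ρ) (‖w‖ + ρ) := by
  have hw0 : 0 < ‖w‖ := lt_of_lt_of_le (by positivity) hw
  have h1 : ‖s • (θ : EuclideanSpace ℝ (Fin d)) - w‖ < ρ := by
    simpa [dist_eq_norm] using hmem
  have hρ : 0 < ρ := (norm_nonneg _).trans_lt h1
  have h2 : |s - ‖w‖| < ρ := by
    have h3 := abs_norm_sub_norm_le (s • (θ : EuclideanSpace ℝ (Fin d))) w
    rw [norm_smul_sphere θ hs] at h3
    exact h3.trans_lt h1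
  refine ⟨?_, by rw [abs_lt] at h2; exact ⟨by linarith [h2.1], by linarith [h2.2]⟩⟩
  rw [Metric.mem_ball, Subtype.dist_eq, dist_eq_norm, hθ₀]
  have h4 : ‖w‖ • ((θ : EuclideanSpace ℝ (Fin d)) - ‖w‖⁻¹ • w) =
      (s • (θ : EuclideanSpace ℝ (Fin d)) - w) - (s - ‖w‖) • (θ : EuclideanSpace ℝ (Fin d)) := by
    rw [smul_sub, smul_smul, mul_inv_cancel₀ hw0.ne', one_smul, sub_smul]
    abel
  have h5 : ‖w‖ * ‖(θ : EuclideanSpace ℝ (Fin d)) - ‖w‖⁻¹ • w‖ < 2 * ρ := by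
    calc ‖w‖ * ‖(θ : EuclideanSpace ℝ (Fin d)) - ‖w‖⁻¹ • w‖
        = ‖(s • (θ : EuclideanSpace ℝ (Fin d)) - w) -
          (s - ‖w‖) • (θ : EuclideanSpace ℝ (Fin d))‖ := by
          rw [← h4, norm_smul, norm_norm]
      _ ≤ ‖s • (θ : EuclideanSpace ℝ (Fin d)) - w‖ +
          ‖(s - ‖w‖) • (θ : EuclideanSpace ℝ (Fin d))‖ := norm_sub_le _ _
      _ < ρ + ρ := by
          rw [norm_smul (s - ‖w‖), norm_eq_of_mem_sphere, mul_one, Real.norm_eq_abs]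
          exact add_lt_add h1 h2
      _ = 2 * ρ := by ring
  -- From `‖w‖ ≥ 3R/4` and `‖w‖ ‖θ - θ₀‖ < 2ρ` the angular distance is below `8ρ/(3R)`, hence below
  -- `4ρ/R`.
  rw [lt_div_iff₀ hR]
  nlinarith [norm_nonneg ((θ : EuclideanSpace ℝ (Fin d)) - ‖w‖⁻¹ • w)]

/-- If `ρ > R/4`, the whole tail mass, of order `R^(-α)`, is already small enough. If `ρ ≤ R/4` and
`‖w‖ < 3R/4`, the set is empty. Otherwise it lies in a cap of radius `4ρ/R` times an interval of
length `2ρ`, on which the radial density is at most of order `R^(-1-α)`; the cap hypothesis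
contributes `(ρ/R)^(γ-1)`. -/
lemma lintegral_temperedLevyMeasure_ball_le (hα : 0 < α) (hγ : 1 ≤ γ) (hc : 0 ≤ c) (hC : 0 < C)
    (hQ : Measurable (Function.uncurry Q)) (hQC : IsTempering c C Q) {K : ℝ}
    (hK : ∀ (θ : Metric.sphere (0 : EuclideanSpace ℝ (Fin d)) 1) (ρ : ℝ), 0 < ρ →
      μ (Metric.ball θ ρ) ≤ ENNReal.ofReal (K * ρ ^ (γ - 1)))
    (w : EuclideanSpace ℝ (Fin d)) {ρ R : ℝ} (hρ : 0 < ρ) (hR : 0 < R) :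
    ∫⁻ y, (Metric.ball w ρ ∩ {y | R ≤ ‖y‖}).indicator
      (fun y ↦ ENNReal.ofReal (rexp (c / 2 * ‖y‖))) y ∂(temperedLevyMeasure α μ Q) ≤
      ENNReal.ofReal (C * (μ.real Set.univ * 4 ^ γ / α + 2 * 4 ^ (γ - 1) * |K|) * ρ ^ γ *
        R ^ (-γ - α)) := by
  have hm : μ Set.univ = ENNReal.ofReal (μ.real Set.univ) := by simp [Measure.real]
  have hsetm : MeasurableSet (Metric.ball w ρ ∩ {y | R ≤ ‖y‖}) :=
    Metric.isOpen_ball.measurableSet.inter (measurableSet_le (by fun_prop) (by fun_prop))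
  have hmeas : Measurable ((Metric.ball w ρ ∩ {y | R ≤ ‖y‖}).indicator
      (fun y ↦ ENNReal.ofReal (rexp (c / 2 * ‖y‖)))) := Measurable.indicator (by fun_prop) hsetm
  have hdens : ∀ (θ : Metric.sphere (0 : EuclideanSpace ℝ (Fin d)) 1) (s : ℝ), 0 < s →
      ENNReal.ofReal (s ^ (-1 - α) * (C * rexp (-c * s))) *
        ENNReal.ofReal (rexp (c / 2 * ‖s • (θ : EuclideanSpace ℝ (Fin d))‖)) ≤
      ENNReal.ofReal C * ENNReal.ofReal (s ^ (-1 - α)) := by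
    intro θ s hs
    rw [norm_smul_sphere θ hs, ← ENNReal.ofReal_mul' (by positivity), ← ENNReal.ofReal_mul hC.le]
    apply ENNReal.ofReal_le_ofReal
    have h1 : rexp (-c * s) * rexp (c / 2 * s) ≤ 1 := by
      rw [← Real.exp_add, Real.exp_le_one_iff]; nlinarith
    calc s ^ (-1 - α) * (C * rexp (-c * s)) * rexp (c / 2 * s)
        = C * s ^ (-1 - α) * (rexp (-c * s) * rexp (c / 2 * s)) := by ring
      _ ≤ C * s ^ (-1 - α) * 1 := by gcongr
      _ = _ := mul_one _
  rcases lt_or_ge (R / 4) ρ with hρR | hρR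
  · refine (lintegral_temperedLevyMeasure_radial_le hQ hQC hmeas (g := fun s ↦ ENNReal.ofReal C *
      (Set.Ici R).indicator (fun s ↦ ENNReal.ofReal (s ^ (-1 - α))) s) fun θ s hs ↦ ?_).trans ?_
    · by_cases hsR : R ≤ s
      · rw [Set.indicator_of_mem (s := Set.Ici R) hsR]
        exact (mul_le_mul_right (Set.indicator_le_self _ _ _) _).trans (hdens θ s hs)
      · rw [Set.indicator_of_notMem (fun h ↦ hsR (by simpa [norm_smul_sphere θ hs] using h.2))]
        simp
    · rw [lintegral_const_mul _ (Measurable.indicator (by fun_prop) measurableSet_Ici),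
        lintegral_rpow_Ici hα hR, hm, ← ENNReal.ofReal_mul hC.le,
        ← ENNReal.ofReal_mul (by positivity)]
      apply ENNReal.ofReal_le_ofReal
      have h1 : R ^ γ ≤ 4 ^ γ * ρ ^ γ := by
        rw [← mul_rpow (by norm_num) hρ.le]
        exact rpow_le_rpow hR.le (by linarith) (by linarith)
      have h2 : R ^ (-α) = R ^ γ * R ^ (-γ - α) := by
        rw [← rpow_add hR]; ring_nf
      calc μ.real Set.univ * (C * (R ^ (-α) / α))
          = C * (μ.real Set.univ / α) * (R ^ γ * R ^ (-γ - α)) := by rw [h2]; ring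
        _ ≤ C * (μ.real Set.univ / α) * (4 ^ γ * ρ ^ γ * R ^ (-γ - α)) := by gcongr
        _ = C * (μ.real Set.univ * 4 ^ γ / α + 0) * ρ ^ γ * R ^ (-γ - α) := by ring
        _ ≤ _ := by gcongr; positivity
  · rcases lt_or_ge ‖w‖ (3 * R / 4) with hw | hw
    · refine le_trans (le_of_eq ?_) zero_le
      rw [← lintegral_zero (μ := temperedLevyMeasure α μ Q)]
      refine lintegral_congr fun y ↦ Set.indicator_of_notMem (fun h ↦ ?_) _
      have h1 : ‖y - w‖ < ρ := by simpa [dist_eq_norm] using h.1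
      have h2 : R ≤ ‖y‖ := h.2
      have h3 := norm_sub_norm_le y w
      linarith
    have hw0 : 0 < ‖w‖ := lt_of_lt_of_le (by positivity) hw
    set θ₀ : Metric.sphere (0 : EuclideanSpace ℝ (Fin d)) 1 :=
      ⟨‖w‖⁻¹ • w, by simp [norm_smul, hw0.ne']⟩ with hθ₀
    refine (lintegral_temperedLevyMeasure_le hQ hQC hmeas).trans ?_
    have hinner : ∀ θ : Metric.sphere (0 : EuclideanSpace ℝ (Fin d)) 1,
        ∫⁻ s in Set.Ioi (0 : ℝ), ENNReal.ofReal (s ^ (-1 - α) * (C * rexp (-c * s))) *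
          (Metric.ball w ρ ∩ {y | R ≤ ‖y‖}).indicator
          (fun y ↦ ENNReal.ofReal (rexp (c / 2 * ‖y‖))) (s • (θ : EuclideanSpace ℝ (Fin d))) ≤
        (Metric.ball θ₀ (4 * ρ / R)).indicator
          (fun _ ↦ ENNReal.ofReal (C * R ^ (-1 - α) * (2 * ρ))) θ := by
      intro θ
      have hpt : ∀ s ∈ Set.Ioi (0 : ℝ), ENNReal.ofReal (s ^ (-1 - α) * (C * rexp (-c * s))) *
          (Metric.ball w ρ ∩ {y | R ≤ ‖y‖}).indicator
          (fun y ↦ ENNReal.ofReal (rexp (c / 2 * ‖y‖))) (s • (θ : EuclideanSpace ℝ (Fin d))) ≤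
          (Metric.ball θ₀ (4 * ρ / R)).indicator (fun _ ↦ ENNReal.ofReal (C * R ^ (-1 - α))) θ *
            (Set.Ioo (‖w‖ - ρ) (‖w‖ + ρ)).indicator 1 s := by
        intro s hs
        have hs0 : (0 : ℝ) < s := hs
        by_cases hmem : s • (θ : EuclideanSpace ℝ (Fin d)) ∈ Metric.ball w ρ ∩ {y | R ≤ ‖y‖}
        · obtain ⟨h1, h2⟩ := mem_cap_of_smul_mem_ball (θ₀ := θ₀) hR hw rfl hs0 hmem.1
          have h3 : R ≤ s := by simpa [norm_smul_sphere θ hs0] using hmem.2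
          rw [Set.indicator_of_mem hmem, Set.indicator_of_mem h1, Set.indicator_of_mem h2,
            Pi.one_apply, mul_one]
          refine (hdens θ s hs0).trans ?_
          rw [← ENNReal.ofReal_mul hC.le]
          apply ENNReal.ofReal_le_ofReal
          gcongr C * ?_
          exact rpow_le_rpow_of_nonpos hR h3 (by linarith)
        · rw [Set.indicator_of_notMem hmem]
          simp
      refine (setLIntegral_mono' measurableSet_Ioi hpt).trans ?_
      rw [lintegral_const_mul _ (measurable_one.indicator measurableSet_Ioo),
        lintegral_indicator_one measurableSet_Ioo]
      have hvol : volume.restrict (Set.Ioi (0 : ℝ)) (Set.Ioo (‖w‖ - ρ) (‖w‖ + ρ)) ≤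
          ENNReal.ofReal (2 * ρ) := by
        refine (Measure.restrict_apply_le _ _).trans ?_
        rw [Real.volume_Ioo]
        apply ENNReal.ofReal_le_ofReal
        linarith
      refine (mul_le_mul_right hvol _).trans ?_
      by_cases h1 : θ ∈ Metric.ball θ₀ (4 * ρ / R)
      · rw [Set.indicator_of_mem h1, Set.indicator_of_mem h1, ← ENNReal.ofReal_mul (by positivity)]
      · rw [Set.indicator_of_notMem h1, zero_mul]
        exact zero_le
    refine (lintegral_mono hinner).trans ?_
    rw [lintegral_indicator_const Metric.isOpen_ball.measurableSet]
    refine (mul_le_mul_right (hK θ₀ (4 * ρ / R) (by positivity)) _).trans ?_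
    rw [← ENNReal.ofReal_mul (by positivity)]
    apply ENNReal.ofReal_le_ofReal
    have h1 : (4 * ρ / R) ^ (γ - 1) = 4 ^ (γ - 1) * ρ ^ (γ - 1) * R ^ (-(γ - 1)) := by
      rw [div_rpow (by positivity) hR.le, mul_rpow (by norm_num) hρ.le, rpow_neg hR.le]
      rfl
    have h2 : ρ ^ γ = ρ * ρ ^ (γ - 1) := by
      rw [← rpow_one_add' hρ.le (by linarith)]; ring_nf
    have h3 : R ^ (-γ - α) = R ^ (-1 - α) * R ^ (-(γ - 1)) := by
      rw [← rpow_add hR]; ring_nf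
    calc C * R ^ (-1 - α) * (2 * ρ) * (K * (4 * ρ / R) ^ (γ - 1))
        ≤ C * R ^ (-1 - α) * (2 * ρ) * (|K| * (4 * ρ / R) ^ (γ - 1)) := by
          gcongr; exact le_abs_self K
      _ = C * (0 + 2 * 4 ^ (γ - 1) * |K|) * ρ ^ γ * R ^ (-γ - α) := by
          rw [h1, h2, h3]; ring
      _ ≤ _ := by gcongr; positivity

/-- The tempered stable jumps satisfy the abstract bounds, with constants that do not depend on the
tempering function or the time. -/
theorem exists_jumpBounds [Nontrivial (EuclideanSpace ℝ (Fin d))] (hα : 0 < α) (hα2 : α < 2)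
    (hγ : 1 ≤ γ) (hμ : IsNondegenerate (μ.map Subtype.val)) (hμγ : IsKappaMeasure μ (γ - 1))
    (hc : 0 < c) (hC : 0 < C) :
    ∃ κ M A : ℝ, 0 < κ ∧ 1 ≤ M ∧ 0 < A ∧
      ∀ Q : Metric.sphere (0 : EuclideanSpace ℝ (Fin d)) 1 → ℝ → ℝ,
        Measurable (Function.uncurry Q) → IsTempering c C Q → ∀ t h : ℝ, IsJumpScale α t h →
        SmallJumpBounds (smallJumps (temperedLevyMeasure α μ Q) t h) α h κ M ∧
        LargeJumpBounds (largeJumps (temperedLevyMeasure α μ Q) t h) α γ (c / 2) M (A * t) := by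
  obtain ⟨n₀, hn₀, hnd⟩ := exists_le_lintegral_inner_sq μ hμ
  obtain ⟨K, hK⟩ := hμγ
  have h2α : 0 < 2 - α := by linarith
  have hJ := temperedMoment_nonneg α c
  set κ := C⁻¹ * rexp (-c) * (2 / π ^ 2) / (2 - α) * n₀ with hκ
  have hκ0 : 0 < κ := by positivity
  set M₁ := μ.real Set.univ * C * (1 / (2 - α) + temperedMoment α c) with hM₁
  set M₂ := μ.real Set.univ * C * (1 / α + temperedMoment α c) with hM₂
  have hM₁0 : 0 ≤ M₁ := by positivity
  have hM₂0 : 0 ≤ M₂ := by positivity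
  set A := C * (μ.real Set.univ * 4 ^ γ / α + 2 * 4 ^ (γ - 1) * |K|) with hA
  have hA0 : 0 ≤ A := by positivity
  refine ⟨κ, 1 + M₁ + M₂, A + 1, hκ0, by linarith, by linarith, fun Q hQ hQC t h H ↦ ⟨?_, ?_⟩⟩
  · obtain ⟨ht, hh, -⟩ := id H
    have hsq := lintegral_sq_smallJumps_le (μ := μ) hα2 hc hC hQ hQC H
    have hint : Integrable (fun y ↦ ‖y‖ ^ 2) (smallJumps (temperedLevyMeasure α μ Q) t h) := by
      refine ⟨Continuous.aestronglyMeasurable (by fun_prop), ?_⟩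
      rw [hasFiniteIntegral_iff_ofReal (Eventually.of_forall fun y ↦ sq_nonneg _)]
      exact hsq.trans_lt ENNReal.ofReal_lt_top
    refine ⟨hα, hα2, hh, hκ0, by linarith, ?_, hint, ?_, fun ξ ↦ ?_⟩
    · rw [smallJumps]
      refine Measure.ae_smul_measure ?_ _
      filter_upwards [ae_restrict_mem Metric.isOpen_ball.measurableSet] with y hy
      exact (mem_ball_zero_iff.1 hy).le
    · rw [← ENNReal.ofReal_le_ofReal_iff (by positivity), ofReal_integral_eq_lintegral_ofReal hint
        (Eventually.of_forall fun y ↦ sq_nonneg _)]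
      refine hsq.trans (ENNReal.ofReal_le_ofReal ?_)
      gcongr
      linarith
    · have hcos0 : ∀ y, 0 ≤ 1 - Real.cos ⟪ξ, y⟫ := fun y ↦ by linarith [Real.cos_le_one ⟪ξ, y⟫]
      -- At low frequencies the required lower bound is nonpositive; this is the purpose of the
      -- `-1`. Only high frequencies need the cutoff argument.
      rcases le_or_gt (h * ‖ξ‖) 1 with h1 | h1
      · have h2 : (h * ‖ξ‖) ^ α ≤ 1 := rpow_le_one (by positivity) h1 hα.le
        refine le_trans ?_ (integral_nonneg hcos0)
        nlinarith
      · obtain ⟨δ, hδ, hδh, hδ1, hδξ, hle⟩ := H.exists_cutoff hα2 h1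
        have h3 := lintegral_temperedLevyMeasure_one_sub_cos_ge hα2 hc.le hC hQ hQC ξ (hnd ξ)
          hδ hδh hδ1 hδξ
        rw [← ENNReal.ofReal_le_ofReal_iff (integral_nonneg hcos0),
          ofReal_integral_eq_lintegral_ofReal (integrable_one_sub_cos hint ξ)
          (Eventually.of_forall hcos0), lintegral_smallJumps]
        refine le_trans ?_ (mul_le_mul_right h3 _)
        rw [← ENNReal.ofReal_mul ht.le, ← hκ]
        apply ENNReal.ofReal_le_ofReal
        calc κ * ((h * ‖ξ‖) ^ α - 1) ≤ κ * (t * (‖ξ‖ ^ 2 * δ ^ (2 - α))) := by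
              gcongr; linarith
          _ = _ := by ring
  · obtain ⟨ht, hh, -⟩ := id H
    refine ⟨by positivity, ?_, fun w ρ R hρ hR ↦ ?_⟩
    · refine (lintegral_exp_largeJumps_le (μ := μ) hα hα2 hc hC hQ hQC H).trans
        (ENNReal.ofReal_le_ofReal ?_)
      linarith
    · rw [lintegral_largeJumps]
      have h1 := lintegral_temperedLevyMeasure_ball_le (μ := μ) hα hγ hc.le hC hQ hQC hK w hρ hR
      refine (mul_le_mul_right ((lintegral_mono fun y ↦
        Set.indicator_le_self _ _ _).trans h1) _).trans ?_
      rw [← ENNReal.ofReal_mul ht.le]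
      apply ENNReal.ofReal_le_ofReal
      calc t * (A * ρ ^ γ * R ^ (-γ - α)) = A * t * ρ ^ γ * R ^ (-γ - α) := by ring
        _ ≤ _ := by gcongr; linarith

end JumpBounds

/-! ### From the uniform bounds to the two time regimes. -/

section Main

open Filter Topology Real
open scoped ENNReal

/-- The Poissonian profile of the small jumps is dominated by a tempered power. -/
lemma exists_smallJumpProfile_le_rpow_mul_exp {M s : ℝ} (hM : 0 < M) (hs : 0 ≤ s) :
    ∃ D : ℝ, 0 < D ∧ ∀ u : ℝ, 0 < u → smallJumpProfile M (u / 2) ≤ D * (u ^ (-s) * rexp (-u)) := by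
  -- At `u/2` this rate gives `e^(-(1+s)u)`, and `log u ≤ u` turns `e^(-s u)` into at most `u^(-s)`.
  obtain ⟨D, hD, h⟩ := smallJumpProfile_le_exp hM (2 * (1 + s)) (by positivity)
  refine ⟨D, hD, fun u hu ↦ (h (u / 2) (by positivity)).trans ?_⟩
  rw [rpow_def_of_pos hu, ← Real.exp_add]
  gcongr
  nlinarith [Real.log_le_self hu.le]

lemma le_mul_tailBound {γ α c τ ρ v k H : ℝ} (hk : 0 ≤ k) (hH : 0 ≤ H)
    (h1 : v ≤ k * H) (h2 : ρ ≠ 0 → v ≤ k * H * (τ * ρ ^ (-γ - α) * rexp (-c * ρ))) :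
    v ≤ k * H * tailBound γ α c τ ρ := by
  unfold tailBound
  split_ifs with h
  · simpa using h1
  · rw [mul_min_of_nonneg _ _ (by positivity : 0 ≤ k * H), mul_one]
    exact le_min h1 (h2 h)

lemma IsJumpScale.rpow_of_le_one {α t : ℝ} (hα : 0 < α) (ht : 0 < t) (ht1 : t ≤ 1) :
    IsJumpScale α t (t ^ (1 / α)) := by
  refine ⟨ht, by positivity, Or.inl ⟨rpow_le_one ht.le ht1 (by positivity), ?_⟩⟩
  rw [← rpow_mul ht.le, one_div_mul_cancel hα.ne', rpow_one]

lemma IsJumpScale.sqrt_of_one_le {α t : ℝ} (ht : 1 ≤ t) : IsJumpScale α t √t :=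
  ⟨by linarith, by positivity, Or.inr ⟨Real.one_le_sqrt.2 ht, (Real.sq_sqrt (by linarith)).symm⟩⟩

/-- Since `h^(γ+α) = t h^γ = t^(1+γ/α)`, the tempered power bounding the profile at `ρ/h` has the
same size as the large jump term, and `h ≤ 1` gives `e^(-ρ/h) ≤ e^(-ρ)`. The rate `c/4` is the rate
`c/2` at distance `ρ/2`. -/
lemma short_time_bound {α γ c K A D M t ρ v : ℝ} {d : ℕ} (hα : 0 < α) (hK : 0 < K)
    (hA : 0 < A) (hD : 0 < D)
    (hprof : ∀ u : ℝ, 0 < u →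
      smallJumpProfile M (u / 2) ≤ D * (u ^ (-(γ + α)) * rexp (-u)))
    (ht : 0 < t) (ht1 : t ≤ 1) (hρ : 0 ≤ ρ) (h1 : v ≤ K * ((t ^ (1 / α)) ^ d)⁻¹)
    (h2 : ρ ≠ 0 → v ≤ K * ((t ^ (1 / α)) ^ d)⁻¹ * (smallJumpProfile M (ρ / 2 / t ^ (1 / α)) +
      A * t * (t ^ (1 / α)) ^ γ * ρ ^ (-γ - α) * rexp (-(c / 2 * (ρ / 2))))) :
    v ≤ K * (1 + D + A) * t ^ (-(d : ℝ) / α) *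
      tailBound γ α (min 1 (c / 4)) (t ^ (1 + γ / α)) ρ := by
  have hH : ((t ^ (1 / α)) ^ d)⁻¹ = t ^ (-(d : ℝ) / α) := by
    rw [← rpow_natCast, ← rpow_mul ht.le, ← rpow_neg ht.le]
    congr 1
    ring
  rw [hH] at h1 h2
  have hH0 : 0 < t ^ (-(d : ℝ) / α) := by positivity
  refine le_mul_tailBound (by positivity) hH0.le (h1.trans ?_) fun hρ0 ↦ (h2 hρ0).trans ?_
  · gcongr
    nlinarith
  have hρ' : 0 < ρ := lt_of_le_of_ne hρ (Ne.symm hρ0)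
  set h := t ^ (1 / α) with hh
  have hh0 : 0 < h := by positivity
  have hh1 : h ≤ 1 := rpow_le_one ht.le ht1 (by positivity)
  have hτ : t * h ^ γ = t ^ (1 + γ / α) := by
    rw [hh, ← rpow_mul ht.le, rpow_add ht, rpow_one]
    congr 2
    ring
  have hτ' : h ^ (γ + α) = t ^ (1 + γ / α) := by
    rw [hh, ← rpow_mul ht.le]
    congr 1
    field_simp
    ring
  have hp : smallJumpProfile M (ρ / 2 / h) ≤
      D * (t ^ (1 + γ / α) * ρ ^ (-γ - α) * rexp (-(min 1 (c / 4)) * ρ)) := by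
    have h3 := hprof (ρ / h) (by positivity)
    rw [show ρ / h / 2 = ρ / 2 / h by ring] at h3
    refine h3.trans ?_
    rw [div_rpow hρ hh0.le, rpow_neg hh0.le (γ + α), hτ', div_inv_eq_mul,
      mul_comm (ρ ^ _), show -(γ + α) = -γ - α by ring]
    gcongr
    have h4 : ρ ≤ ρ / h := by
      rw [le_div_iff₀ hh0]
      nlinarith
    have h5 : min 1 (c / 4) ≤ 1 := min_le_left _ _
    nlinarith
  have he : rexp (-(c / 2 * (ρ / 2))) ≤ rexp (-(min 1 (c / 4)) * ρ) := by
    gcongr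
    have h5 : min 1 (c / 4) ≤ c / 4 := min_le_right _ _
    nlinarith
  set X := t ^ (1 + γ / α) * ρ ^ (-γ - α) * rexp (-(min 1 (c / 4)) * ρ) with hX
  have hX0 : 0 ≤ X := by positivity
  calc K * t ^ (-(d : ℝ) / α) * (smallJumpProfile M (ρ / 2 / h) +
        A * t * h ^ γ * ρ ^ (-γ - α) * rexp (-(c / 2 * (ρ / 2))))
      ≤ K * t ^ (-(d : ℝ) / α) * (D * X +
        A * t * h ^ γ * ρ ^ (-γ - α) * rexp (-(min 1 (c / 4)) * ρ)) := by gcongr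
    _ = K * t ^ (-(d : ℝ) / α) * (D + A) * X := by rw [hX, ← hτ]; ring
    _ ≤ K * t ^ (-(d : ℝ) / α) * (1 + D + A) * X := by gcongr; linarith
    _ = _ := by ring

/-- Here the profile is not absorbed: it is subtracted first, and the remainder is compared with
each entry of the minimum separately. -/
lemma long_time_bound {α γ c K A M t ρ v : ℝ} {d : ℕ} (hK : 0 < K)
    (hA : 0 < A) (hM : 0 < M) (ht : 0 < t) (hρ : 0 ≤ ρ) (h1 : v ≤ K * (√t ^ d)⁻¹)
    (h2 : ρ ≠ 0 → v ≤ K * (√t ^ d)⁻¹ * (smallJumpProfile M (ρ / 2 / √t) +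
      A * t * √t ^ γ * ρ ^ (-γ - α) * rexp (-(c / 2 * (ρ / 2))))) :
    v ≤ K * (1 + A) * t ^ (-(d : ℝ) / 2) *
      (tailBound γ α (c / 4) (t ^ (1 + γ / 2)) ρ +
        rexp (-(1 / 8 * ρ / √t) * Real.log (1 + 1 / (4 * M) * ρ / √t))) := by
  have hH : (√t ^ d)⁻¹ = t ^ (-(d : ℝ) / 2) := by
    rw [sqrt_eq_rpow, ← rpow_natCast, ← rpow_mul ht.le, ← rpow_neg ht.le]
    congr 1
    ring
  have hτ : t * √t ^ γ = t ^ (1 + γ / 2) := by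
    rw [sqrt_eq_rpow, ← rpow_mul ht.le, rpow_add ht, rpow_one]
    congr 2
    ring
  have hg : smallJumpProfile M (ρ / 2 / √t) =
      rexp (-(1 / 8 * ρ / √t) * Real.log (1 + 1 / (4 * M) * ρ / √t)) := by
    unfold smallJumpProfile
    congr 2
    · ring
    · congr 2
      field_simp
      ring
  rw [← hg]
  rw [hH] at h1 h2
  have hG0 := smallJumpProfile_nonneg M (ρ / 2 / √t)
  set G := smallJumpProfile M (ρ / 2 / √t)
  have hH0 : 0 < t ^ (-(d : ℝ) / 2) := by positivity
  set H := t ^ (-(d : ℝ) / 2)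
  set τ := t ^ (1 + γ / 2) with hτ'
  have key : v - K * (1 + A) * H * G ≤ K * (1 + A) * H * tailBound γ α (c / 4) τ ρ := by
    have hKG : K * H * G ≤ K * (1 + A) * H * G := by
      gcongr
      nlinarith
    have hKG0 : 0 ≤ K * H * G := by positivity
    refine le_mul_tailBound (by positivity) hH0.le ?_ fun hρ0 ↦ ?_
    · have : K * H ≤ K * (1 + A) * H := by
        gcongr
        nlinarith
      linarith
    · have h3 := h2 hρ0
      have he : -(c / 2 * (ρ / 2)) = -(c / 4) * ρ := by ring
      rw [he] at h3
      have hX0 : 0 ≤ τ * ρ ^ (-γ - α) * rexp (-(c / 4) * ρ) := by positivity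
      set X := τ * ρ ^ (-γ - α) * rexp (-(c / 4) * ρ) with hX
      have h4 : A * t * √t ^ γ * ρ ^ (-γ - α) * rexp (-(c / 4) * ρ) = A * X := by
        rw [hX, ← hτ]; ring
      rw [h4] at h3
      have h5 : K * H * (A * X) ≤ K * (1 + A) * H * X := by
        have : 0 ≤ K * H * X := by positivity
        nlinarith
      linarith
  linarith

end Main

theorem mainTheorem5 (d : ℕ) (α γ : ℝ) (hα : 0 < α) (hα2 : α < 2)
    (hγ : 1 ≤ γ) (hγd : γ ≤ (d : ℝ))
    (μ : Measure (Metric.sphere (0 : EuclideanSpace ℝ (Fin d)) 1)) [IsFiniteMeasure μ]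
    (hμ : IsNondegenerate (μ.map Subtype.val)) (hμγ : IsKappaMeasure μ (γ - 1))
    (c C : ℝ) (hc : 0 < c) (hC : 0 < C) :
    ∃ c₁ c₂ c₃ c₄ c₅ c₆ : ℝ, 0 < c₁ ∧ 0 < c₂ ∧ 0 < c₃ ∧ 0 < c₄ ∧ 0 < c₅ ∧ 0 < c₆ ∧
      ∀ Q : Metric.sphere (0 : EuclideanSpace ℝ (Fin d)) 1 → ℝ → ℝ,
        Measurable (Function.uncurry Q) →
        (∀ θ, ∀ s : ℝ, 0 < s →
          C⁻¹ * Real.exp (-c * s) ≤ Q θ s ∧ Q θ s ≤ C * Real.exp (-c * s)) →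
      ∀ b : EuclideanSpace ℝ (Fin d), ∀ P : ℝ → Measure (EuclideanSpace ℝ (Fin d)),
        IsConvolutionSemigroup (charExponent (temperedLevyMeasure α μ Q) b) P →
      ∃ p : ℝ → EuclideanSpace ℝ (Fin d) → ℝ,
        (∀ t : ℝ, 0 < t → Continuous (p t) ∧ (∀ x, 0 ≤ p t x) ∧
          P t = volume.withDensity (fun x => ENNReal.ofReal (p t x))) ∧
        (∀ t : ℝ, 0 < t → t ≤ 1 → ∀ x : EuclideanSpace ℝ (Fin d),
          p t (x + t • shiftedDrift (temperedLevyMeasure α μ Q) b (t ^ (1 / α))) ≤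
            c₁ * t ^ (-(d : ℝ) / α) * tailBound γ α c₂ (t ^ (1 + γ / α)) ‖x‖) ∧
        (∀ t : ℝ, 1 < t → ∀ x : EuclideanSpace ℝ (Fin d),
          p t (x + t • shiftedDrift (temperedLevyMeasure α μ Q) b (Real.sqrt t)) ≤
            c₃ * t ^ (-(d : ℝ) / 2) *
              (tailBound γ α c₄ (t ^ (1 + γ / 2)) ‖x‖ +
                Real.exp (-(c₅ * ‖x‖ / Real.sqrt t) *
                  Real.log (1 + c₆ * ‖x‖ / Real.sqrt t)))) := by
  have hd : 0 < d := by
    have : (0 : ℝ) < d := by linarith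
    exact_mod_cast this
  have hfr : Module.finrank ℝ (EuclideanSpace ℝ (Fin d)) = d := finrank_euclideanSpace_fin
  have : Nontrivial (EuclideanSpace ℝ (Fin d)) :=
    Module.nontrivial_of_finrank_pos (R := ℝ) (by rw [hfr]; exact hd)
  have hγ0 : 0 < γ := by linarith
  obtain ⟨κ, M, A, hκ, hM, hA, hb⟩ := exists_jumpBounds hα hα2 hγ hμ hμγ hc hC
  have hM0 : 0 < M := by linarith
  obtain ⟨K, hK, hinv⟩ := exists_norm_inversionIntegral_le (EuclideanSpace ℝ (Fin d)) hα hκ hM hγ0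
    (by positivity : 0 ≤ c / 2)
  rw [hfr] at hinv
  obtain ⟨D, hD, hprof⟩ := exists_smallJumpProfile_le_rpow_mul_exp hM0
    (by positivity : 0 ≤ γ + α)
  -- The constants `1/8` and `1/(4M)` come from evaluating the profile at `u = ‖x‖/(2√t)`, where
  -- `u/4 = ‖x‖/(8√t)` and `u/(2M) = ‖x‖/(4M√t)`.
  refine ⟨K * (1 + D + A), min 1 (c / 4), K * (1 + A), c / 4, 1 / 8, 1 / (4 * M), by positivity,
    by positivity, by positivity, by positivity, by positivity, by positivity,
    fun Q hQ hQC b P hP ↦ ?_⟩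
  set ν := temperedLevyMeasure α μ Q with hν
  have hfin : ∀ r : ℝ, 0 < r → ν {y | r ≤ ‖y‖} < ⊤ := fun r hr ↦
    temperedLevyMeasure_compl_ball_lt_top hα hc.le hC.le hQ hQC hr
  have hnull : ∀ r : ℝ, 0 < r → ν {y | ‖y‖ = r} = 0 := fun r _ ↦
    temperedLevyMeasure_sphere_null hQ hQC r
  -- The truncation level is a function of `t` across both regimes, so that a single choice of
  -- densities serves both estimates.
  have hdens : ∀ t : ℝ, 0 < t → ∃ q : EuclideanSpace ℝ (Fin d) → ℝ,
      (Continuous q ∧ (∀ x, 0 ≤ q x) ∧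
        P t = volume.withDensity (fun x ↦ ENNReal.ofReal (q x))) ∧
      ∀ h : ℝ, h = (if t ≤ 1 then t ^ (1 / α) else √t) → ∀ x,
        q (x + t • shiftedDrift ν b h) ≤ K * (h ^ d)⁻¹ ∧
        (x ≠ 0 → q (x + t • shiftedDrift ν b h) ≤ K * (h ^ d)⁻¹ *
          (smallJumpProfile M (‖x‖ / 2 / h) +
            A * t * h ^ γ * ‖x‖ ^ (-γ - α) * Real.exp (-(c / 2 * (‖x‖ / 2))))) := by
    intro t ht
    obtain ⟨h, rfl⟩ : ∃ h : ℝ, h = (if t ≤ 1 then t ^ (1 / α) else √t) := ⟨_, rfl⟩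
    have hscale : IsJumpScale α t (if t ≤ 1 then t ^ (1 / α) else √t) := by
      split_ifs with ht1
      · exact .rpow_of_le_one hα ht ht1
      · exact .sqrt_of_one_le (not_le.1 ht1).le
    set h := if t ≤ 1 then t ^ (1 / α) else √t
    obtain ⟨hS, hL⟩ := hb Q hQ hQC t h hscale
    have := hP.isProbabilityMeasure t ht.le
    have : SFinite (smallJumps ν t h) := by unfold smallJumps; infer_instance
    have := isFiniteMeasure_largeJumps hfin t hS.h_pos
    obtain ⟨q, hq, hq0, hPq, hle⟩ := density_le_norm_inversionIntegral ht hfin hnull hS b (P t)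
      (hP.charFun_eq t ht.le)
    refine ⟨q, ⟨hq, hq0, hPq⟩, ?_⟩
    rintro _ rfl x
    obtain ⟨h1, h2⟩ := hinv _ _ h (A * t) hS hL x
    exact ⟨(hle x).trans h1, fun hx ↦ (hle x).trans (h2 hx)⟩
  choose! p hp hpb using hdens
  refine ⟨p, hp, fun t ht ht1 x ↦ ?_, fun t ht x ↦ ?_⟩
  · obtain ⟨h1, h2⟩ := hpb t ht (t ^ (1 / α)) (if_pos ht1).symm x
    exact short_time_bound hα hK hA hD hprof ht ht1 (norm_nonneg x) h1
      fun hx ↦ h2 (norm_ne_zero_iff.1 hx)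
  · have ht0 : 0 < t := by linarith
    obtain ⟨h1, h2⟩ := hpb t ht0 √t (if_neg (not_le.2 ht)).symm x
    exact long_time_bound hK hA hM0 ht0 (norm_nonneg x) h1 fun hx ↦ h2 (norm_ne_zero_iff.1 hx)
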